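/- Let $\Omega\subset\mathbb R^2$ be a convex polygon with $m\ge 3$ sides (no three vertices collinear), given by the array of its vertices in counterclockwise order, and let $p\neq q$ be points of $\operatorname{int}\Omega$. For distinct $a,b\in\operatorname{int}\Omega$ let $a',b'$ be the endpoints of the chord of $\Omega$ through $a,b$, in the order $a',a,b,b'$, let $$d_\Omega(a,b)=\tfrac12\ln\Big(\frac{\|b-a'\|}{\|a-a'\|}\cdot\frac{\|a-b'\|}{\|b-b'\|}\Big),\qquad d_\Omega(a,a)=0,$$ and let the $(p,q)$-bisector be $\{x\in\operatorname{int}\Omega : d_\Omega(x,p)=d_\Omega(x,q)\}$. Its limit points on $\partial\Omega$ are the points of $\partial\Omega$ that lie in its closure. There is a single real-RAM program (field operations and exact comparisons on reals; addition, subtraction, halving and comparison on indices; each at unit cost) that, given any such $\Omega$, $p$ and $q$, computes in $O(\log^2 m)$ time two points $x,y\in\partial\Omega$, where $x$ lies strictly to the left and $y$ strictly to the right of the directed line from $p$ to $q$, and both are limit points of the $(p,q)$-bisector. If no two distinct side lines of $\Omega$ are concurrent with the line $pq$ (three lines being concurrent if they have a common point or are all parallel), then $x$ and $y$ are the only limit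 points of the bisector on $\partial\Omega$, that is, they are its two endpoints. -/

import Mathlib

/-! ### Real RAM: a structured program language with unit-cost semantics -/

namespace RealRAM

/-- A machine state: index registers, real registers, and a random-access memory of reals. -/
structure State where
  idx : ℕ → ℕ
  reg : ℕ → ℝ
  mem : ℕ → ℝ

/-- Index expressions: natural-number literals, registers, addition, truncated subtraction,
and halving (rounded down). -/
inductive IExp where
  | lit (n : ℕ)
  | var (i : ℕ)
  | add (a b : IExp)
  | sub (a b : IExp)
  | half (a : IExp)

namespace IExp

def eval (s : State) : IExp → ℕ
  | lit n => n
  | var i => s.idx i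
  | add a b => a.eval s + b.eval s
  | sub a b => a.eval s - b.eval s
  | half a => a.eval s / 2

/-- Every node of an expression costs one unit of time. -/
def cost : IExp → ℕ
  | lit _ => 1
  | var _ => 1
  | add a b => a.cost + b.cost + 1
  | sub a b => a.cost + b.cost + 1
  | half a => a.cost + 1

end IExp

/-- Real expressions: integer literals, registers, memory reads at a computed address, and the
four field operations. Division by zero yields zero. -/
inductive RExp where
  | lit (z : ℤ)
  | var (i : ℕ)
  | load (a : IExp)
  | add (a b : RExp)
  | sub (a b : RExp)
  | mul (a b : RExp)
  | div (a b : RExp)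

namespace RExp

noncomputable def eval (s : State) : RExp → ℝ
  | lit z => (z : ℝ)
  | var i => s.reg i
  | load a => s.mem (a.eval s)
  | add a b => a.eval s + b.eval s
  | sub a b => a.eval s - b.eval s
  | mul a b => a.eval s * b.eval s
  | div a b => a.eval s / b.eval s

def cost : RExp → ℕ
  | lit _ => 1
  | var _ => 1
  | load a => a.cost + 1
  | add a b => a.cost + b.cost + 1
  | sub a b => a.cost + b.cost + 1
  | mul a b => a.cost + b.cost + 1
  | div a b => a.cost + b.cost + 1

end RExp

/-- Tests: comparisons of indices, exact comparisons of reals, and Boolean combinations. -/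
inductive BExp where
  | ltI (a b : IExp)
  | ltR (a b : RExp)
  | not (a : BExp)
  | and (a b : BExp)

namespace BExp

def Holds (s : State) : BExp → Prop
  | ltI a b => a.eval s < b.eval s
  | ltR a b => a.eval s < b.eval s
  | not a => ¬ a.Holds s
  | and a b => a.Holds s ∧ b.Holds s

def cost : BExp → ℕ
  | ltI a b => a.cost + b.cost + 1
  | ltR a b => a.cost + b.cost + 1
  | not a => a.cost + 1
  | and a b => a.cost + b.cost + 1

end BExp

/-- Programs. A program is a finite object that does not depend on the input. -/
inductive Prog where
  | skip
  | setI (i : ℕ) (e : IExp)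
  | setR (i : ℕ) (e : RExp)
  | store (a : IExp) (e : RExp)
  | seq (c d : Prog)
  | ite (b : BExp) (c d : Prog)
  | loop (b : BExp) (c : Prog)

/-- `Exec c s t s'`: the program `c`, started in the state `s`, halts after exactly `t` units of
time in the state `s'`. The program `loop b c` repeats `c` while `b` holds. -/
inductive Exec : Prog → State → ℕ → State → Prop
  | skip (s : State) : Exec Prog.skip s 1 s
  | setI (s : State) (i : ℕ) (e : IExp) :
      Exec (Prog.setI i e) s (e.cost + 1) { s with idx := Function.update s.idx i (e.eval s) }
  | setR (s : State) (i : ℕ) (e : RExp) :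
      Exec (Prog.setR i e) s (e.cost + 1) { s with reg := Function.update s.reg i (e.eval s) }
  | store (s : State) (a : IExp) (e : RExp) :
      Exec (Prog.store a e) s (a.cost + e.cost + 1)
        { s with mem := Function.update s.mem (a.eval s) (e.eval s) }
  | seq {c d : Prog} {s s₁ s₂ : State} {t₁ t₂ : ℕ} :
      Exec c s t₁ s₁ → Exec d s₁ t₂ s₂ → Exec (Prog.seq c d) s (t₁ + t₂) s₂
  | iteTrue {b : BExp} {c d : Prog} {s s₁ : State} {t : ℕ} :
      b.Holds s → Exec c s t s₁ → Exec (Prog.ite b c d) s (b.cost + t + 1) s₁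
  | iteFalse {b : BExp} {c d : Prog} {s s₁ : State} {t : ℕ} :
      ¬ b.Holds s → Exec d s t s₁ → Exec (Prog.ite b c d) s (b.cost + t + 1) s₁
  | loopTrue {b : BExp} {c : Prog} {s s₁ s₂ : State} {t₁ t₂ : ℕ} :
      b.Holds s → Exec c s t₁ s₁ → Exec (Prog.loop b c) s₁ t₂ s₂ →
        Exec (Prog.loop b c) s (b.cost + t₁ + t₂ + 1) s₂
  | loopFalse {b : BExp} {c : Prog} {s : State} :
      ¬ b.Holds s → Exec (Prog.loop b c) s (b.cost + 1) s

end RealRAM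

/-! ### Convex polygons and the Hilbert metric -/

namespace HilbertPlane

/-- The Euclidean plane. -/
abbrev Plane : Type := EuclideanSpace ℝ (Fin 2)

/-- Twice the signed area of the triangle `a b c`; it is positive if and only if `c` lies strictly
to the left of the directed line from `a` to `b`. -/
def orient (a b c : Plane) : ℝ :=
  (b 0 - a 0) * (c 1 - a 1) - (b 1 - a 1) * (c 0 - a 0)

/-- `v` lists the vertices of a (strictly) convex polygon with `m` sides in counterclockwise
order. -/
def IsConvexPolygon {m : ℕ} (v : Fin m → Plane) : Prop :=
  3 ≤ m ∧ ∀ i j k : Fin m, i < j → j < k → 0 < orient (v i) (v j) (v k)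

/-- The closed region bounded by the polygon. -/
def region {m : ℕ} (v : Fin m → Plane) : Set Plane := convexHull ℝ (Set.range v)

/-- The line through the `i`-th side of the polygon, which joins the `i`-th vertex to the
(cyclically) next one. -/
noncomputable def sideLine {m : ℕ} (v : Fin m → Plane) (i : Fin m) : AffineSubspace ℝ Plane :=
  line[ℝ, v i, v (finRotate m i)]

/-- Three lines are concurrent if they have a common point or are parallel. -/
def Concurrent (L₁ L₂ L₃ : AffineSubspace ℝ Plane) : Prop :=
  (∃ z : Plane, z ∈ L₁ ∧ z ∈ L₂ ∧ z ∈ L₃) ∨ (L₁.Parallel L₂ ∧ L₂.Parallel L₃)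

/-- The endpoint, beyond `q`, of the chord of the convex body `K` through `p` and `q`. -/
noncomputable def chordEnd (K : Set Plane) (p q : Plane) : Plane :=
  AffineMap.lineMap p q (sSup {t : ℝ | AffineMap.lineMap p q t ∈ K})

open Classical in
/-- The Hilbert distance in the convex body `K`. -/
noncomputable def hilbertDist (K : Set Plane) (p q : Plane) : ℝ :=
  if p = q then 0
  else (1 / 2) * Real.log
    (dist q (chordEnd K q p) / dist p (chordEnd K q p) *
      (dist p (chordEnd K p q) / dist q (chordEnd K p q)))

/-- The `(p,q)`-bisector: the interior points that are Hilbert equidistant from `p` and `q`. -/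
def bisector (K : Set Plane) (p q : Plane) : Set Plane :=
  {x | x ∈ interior K ∧ hilbertDist K x p = hilbertDist K x q}

/-- The points of the boundary of `K` that are limit points of the `(p,q)`-bisector. -/
def bisectorEnds (K : Set Plane) (p q : Plane) : Set Plane :=
  closure (bisector K p q) ∩ frontier K

/-- The state `s` holds the input `(v, p, q)`: the number of vertices in index register `0`, the
coordinates of `p` and `q` in the real registers `0, 1, 2, 3`, and the coordinates of the vertices
in consecutive memory cells. All other cells are arbitrary. -/
def HoldsInput {m : ℕ} (s : RealRAM.State) (v : Fin m → Plane) (p q : Plane) : Prop :=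
  s.idx 0 = m ∧ s.reg 0 = p 0 ∧ s.reg 1 = p 1 ∧ s.reg 2 = q 0 ∧ s.reg 3 = q 1 ∧
    ∀ i : Fin m, s.mem (2 * (i : ℕ)) = v i 0 ∧ s.mem (2 * (i : ℕ) + 1) = v i 1

/-- The state `s` holds the output `(x, y)` in the real registers `0, 1, 2, 3`. -/
def HoldsOutput (s : RealRAM.State) (x y : Plane) : Prop :=
  s.reg 0 = x 0 ∧ s.reg 1 = x 1 ∧ s.reg 2 = y 0 ∧ s.reg 3 = y 1

end HilbertPlane

namespace HilbertPlane

/-! ### Signed areas -/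

/-! Put `M(a,b) = max_j side_j a / side_j b` (`ratioMax`). The ray from `a` through `b` leaves the
polygon through a side where this maximum is attained, and the distances of `a` and `b` to that
endpoint have ratio `M(a,b)`. Hence `exp (2 d(a,b)) = M(a,b) M(b,a)` (`hilbertDist_eq`).

Let `x` tend to a boundary point `z`. The factors `M(p,x)` and `M(q,x)` blow up, governed by a side
`i` through `z`, while `M(x,p)` and `M(x,q)` converge. What remains is the sign of `balance i z =
side_i p * M(z,p) - side_i q * M(z,q)`. A boundary point is a limit point of the bisector exactly
when `balance` is nonnegative for some side through it and nonpositive for some side through it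
(`mem_bisectorEnds`, `exists_balance_nonpos`, `exists_balance_nonneg`); at a vertex these may be two
different sides.

Let the directed line `pq` leave through the side `f` and enter through the side `b`. At the exit
`balance` is positive and at the entry negative (`balance_pos_of_line`, `balance_neg_of_line`).
Going counterclockwise from exit to entry, on the left of `pq`, it changes sign either inside a side
or at a vertex, which yields a limit point. For uniqueness, `side_i p / side_i q` strictly decreases
along this walk and `M(z,p) / M(z,q)` does not increase, so the sign changes only once
(`not_balance_nonpos_nonneg`). The second ratio may be constant along a side; there, non-concurrency
excludes that `balance` vanishes on a whole interval.

The algorithm follows the existence proof. `M(z,r)` costs one binary search over the sides on the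
right of `pq`, by `ratioMax_eq_of_exit`. A binary search over the vertices on the left, evaluating
`balance` at each, isolates a vertex or a side. On a side, the segment containing a sign change is
cut by lines through `p` (then `q`) and vertices on the right, again in a binary search, until the
exit sides for `p` and `q` are constant on it. There `balance` is affine and its root is a quotient
(`RootBracket.solve`). Two nested binary searches give `log² m`. The crossed sides `f` and `b` come
from searches started at vertex `0` (`exists_anchor`), and exchanging `p` and `q` gives the limit
point on the right. -/

theorem orient_rotate (a b c : Plane) : orient b c a = orient a b c := by
  simp only [orient]; ring

theorem orient_swap (a b c : Plane) : orient b a c = -orient a b c := by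
  simp only [orient]; ring

theorem orient_swap_right (a b c : Plane) : orient a c b = -orient a b c := by
  simp only [orient]; ring

@[simp] theorem orient_self_left (a b : Plane) : orient a b a = 0 := by
  simp only [orient]; ring

@[simp] theorem orient_self_right (a b : Plane) : orient a b b = 0 := by
  simp only [orient]; ring

@[simp] theorem orient_self (a b : Plane) : orient a a b = 0 := by
  simp only [orient]; ring

theorem lineMap_coord (a b : Plane) (t : ℝ) (i : Fin 2) :
    (AffineMap.lineMap a b t : Plane) i = a i + t * (b i - a i) := by
  simp [AffineMap.lineMap_apply]; ring

theorem orient_lineMap (a b c d : Plane) (t : ℝ) :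
    orient a b (AffineMap.lineMap c d t) = (1 - t) * orient a b c + t * orient a b d := by
  simp only [orient, lineMap_coord]; ring

theorem orient_lineMap_left (a b c d : Plane) (t : ℝ) :
    orient (AffineMap.lineMap c d t) a b = (1 - t) * orient c a b + t * orient d a b := by
  simp only [orient, lineMap_coord]; ring

theorem plane_ext {a b : Plane} (h0 : a 0 = b 0) (h1 : a 1 = b 1) : a = b := by
  ext i; fin_cases i <;> assumption

theorem continuous_orient (a b : Plane) : Continuous (orient a b) := by
  unfold orient; fun_prop

/-- Discrete intermediate value theorem. -/
theorem exists_transition {P : ℕ → Prop} {a b : ℕ} (hab : a ≤ b) (ha : P a) (hb : ¬ P b) :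
    ∃ c, a ≤ c ∧ c < b ∧ P c ∧ ¬ P (c + 1) := by
  induction b, hab using Nat.le_induction with
  | base => exact absurd ha hb
  | succ n hn ih =>
    by_cases h : P n
    · exact ⟨n, hn, n.lt_succ_self, h, hb⟩
    · obtain ⟨c, h1, h2, h3⟩ := ih h
      exact ⟨c, h1, by omega, h3⟩

/-! ### Polygons as periodic sequences of vertices -/

/-- `V` lists cyclically the vertices of a strictly convex polygon with `m` sides. -/
structure CyclicPolygon (m : ℕ) (V : ℕ → Plane) : Prop where
  three_le : 3 ≤ m
  periodic : ∀ j, V (j + m) = V j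
  convex : ∀ i j k, i < j → j < k → k < i + m → 0 < orient (V i) (V j) (V k)

/-- The affine function that vanishes on the `j`-th side and is positive inside the polygon. -/
def side (V : ℕ → Plane) (j : ℕ) (z : Plane) : ℝ := orient (V j) (V (j + 1)) z

/-- The intersection of the closed half-planes bounded by the side lines. -/
def body (V : ℕ → Plane) : Set Plane := {z | ∀ j, 0 ≤ side V j z}

/-- The intersection of the open half-planes bounded by the side lines. -/
def openBody (V : ℕ → Plane) : Set Plane := {z | ∀ j, 0 < side V j z}

theorem side_lineMap (V : ℕ → Plane) (j : ℕ) (a b : Plane) (t : ℝ) :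
    side V j (AffineMap.lineMap a b t) = (1 - t) * side V j a + t * side V j b :=
  orient_lineMap _ _ _ _ _

theorem continuous_side (V : ℕ → Plane) (j : ℕ) : Continuous (side V j) := continuous_orient _ _

@[simp] theorem side_left (V : ℕ → Plane) (j : ℕ) : side V j (V j) = 0 := by simp [side]

@[simp] theorem side_right (V : ℕ → Plane) (j : ℕ) : side V j (V (j + 1)) = 0 := by simp [side]

theorem openBody_subset_body (V : ℕ → Plane) : openBody V ⊆ body V := fun _ h j => (h j).le

theorem lineMap_mem_body {V : ℕ → Plane} {a b : Plane} (ha : a ∈ body V) (hb : b ∈ body V)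
    {t : ℝ} (h0 : 0 ≤ t) (h1 : t ≤ 1) : AffineMap.lineMap a b t ∈ body V := by
  intro j
  rw [side_lineMap]
  have := ha j
  have := hb j
  have : 0 ≤ 1 - t := by linarith
  positivity

theorem lineMap_mem_openBody {V : ℕ → Plane} {a b : Plane} (ha : a ∈ body V) (hb : b ∈ openBody V)
    {t : ℝ} (h0 : 0 < t) (h1 : t ≤ 1) : AffineMap.lineMap a b t ∈ openBody V := by
  intro j
  rw [side_lineMap]
  have := ha j
  have := hb j
  have : 0 ≤ 1 - t := by linarith
  positivity

namespace CyclicPolygon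

variable {m : ℕ} {V : ℕ → Plane}

theorem pos (hV : CyclicPolygon m V) : 0 < m := by have := hV.three_le; omega

theorem apply_add_mul (hV : CyclicPolygon m V) (j k : ℕ) : V (j + m * k) = V j := by
  induction k with
  | zero => simp
  | succ k ih => rw [Nat.mul_succ, ← add_assoc, hV.periodic, ih]

theorem apply_mod (hV : CyclicPolygon m V) (j : ℕ) : V (j % m) = V j := by
  conv_rhs => rw [← Nat.mod_add_div j m, hV.apply_add_mul]

theorem side_add (hV : CyclicPolygon m V) (j : ℕ) (z : Plane) : side V (j + m) z = side V j z := by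
  simp only [side]
  rw [hV.periodic, show j + m + 1 = j + 1 + m by ring, hV.periodic]

theorem side_mod (hV : CyclicPolygon m V) (j : ℕ) (z : Plane) : side V (j % m) z = side V j z := by
  simp only [side]
  rw [hV.apply_mod, ← hV.apply_mod (j % m + 1), ← hV.apply_mod (j + 1), Nat.mod_add_mod]

/-- Every vertex has an index in each window of length `m`. -/
theorem exists_index (hV : CyclicPolygon m V) (a j : ℕ) :
    ∃ j', a ≤ j' ∧ j' < a + m ∧ V j' = V j ∧ (∀ z, side V j' z = side V j z) ∧ j' % m = j % m := by
  have hm := hV.pos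
  -- The multiple `m * a` changes nothing modulo `m` and keeps the truncated subtraction exact.
  have key : ((a + (j + m * a - a) % m)) % m = j % m := by
    have h : a ≤ m * a := Nat.le_mul_of_pos_left a hm
    rw [Nat.add_mod, Nat.mod_mod, ← Nat.add_mod]
    rw [show a + (j + m * a - a) = j + m * a by omega, Nat.add_mul_mod_self_left]
  refine ⟨a + (j + m * a - a) % m, by omega, ?_, ?_, ?_, key⟩
  · have := Nat.mod_lt (j + m * a - a) hm
    omega
  · rw [← hV.apply_mod, key, hV.apply_mod]
  · intro z
    rw [← hV.side_mod, key, hV.side_mod]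

theorem orient_nonneg (hV : CyclicPolygon m V) {i j k : ℕ} (hij : i ≤ j) (hjk : j ≤ k)
    (hk : k ≤ i + m) : 0 ≤ orient (V i) (V j) (V k) := by
  rcases hij.eq_or_lt with rfl | hij
  · simp
  rcases hjk.eq_or_lt with rfl | hjk
  · simp
  rcases hk.eq_or_lt with rfl | hk
  · rw [hV.periodic]; simp
  exact (hV.convex i j k hij hjk hk).le

theorem side_vertex_pos (hV : CyclicPolygon m V) {j k : ℕ} (h1 : j + 1 < k) (h2 : k < j + m) :
    0 < side V j (V k) := hV.convex _ _ _ (Nat.lt_succ_self j) h1 h2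

theorem vertex_mem (hV : CyclicPolygon m V) (k : ℕ) : V k ∈ body V := by
  intro j
  obtain ⟨k', h1, h2, h3, -⟩ := hV.exists_index j k
  rw [← h3]
  rcases h1.eq_or_lt with rfl | h1
  · simp
  · exact hV.orient_nonneg (Nat.le_succ j) h1 h2.le

/-- The edge vectors of consecutive sides turn to the left. -/
theorem turn_pos (hV : CyclicPolygon m V) (j : ℕ) : 0 < orient (V j) (V (j + 1)) (V (j + 2)) :=
  hV.convex _ _ _ (by omega) (by omega) (by have := hV.three_le; omega)

end CyclicPolygon

/-- The Plücker relation for two consecutive sides. -/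
theorem side_mul_side_sub (V : ℕ → Plane) (j : ℕ) (x y : Plane) :
    side V j x * side V (j + 1) y - side V j y * side V (j + 1) x =
      orient (V j) (V (j + 1)) (V (j + 2)) * orient (V (j + 1)) x y := by
  simp only [side, orient]; ring

/-- The cyclic extension of a finite list of vertices. -/
def cyclicExtension {m : ℕ} (hm : 0 < m) (v : Fin m → Plane) (j : ℕ) : Plane :=
  v ⟨j % m, Nat.mod_lt j hm⟩

/-- Reduced modulo `m`, a triple inside a window of length `m` is a cyclic rotation of an increasing
triple, and `orient` is invariant under rotation. -/
theorem IsConvexPolygon.cyclicPolygon {m : ℕ} {v : Fin m → Plane} (hv : IsConvexPolygon v)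
    (hm : 0 < m) : CyclicPolygon m (cyclicExtension hm v) where
  three_le := hv.1
  periodic j := by simp [cyclicExtension]
  convex i j k hij hjk hk := by
    have key : ∀ a b c, a < m → b < m → c < m → a < b → b < c →
        0 < orient (cyclicExtension hm v a) (cyclicExtension hm v b) (cyclicExtension hm v c) := by
      intro a b c ha hb hc hab hbc
      refine hv.2 _ _ _ ?_ ?_ <;> simp [Nat.mod_eq_of_lt, *]
    have hmod : ∀ a, cyclicExtension hm v a = cyclicExtension hm v (a % m) := by
      intro a; simp [cyclicExtension]
    have hadd : ∀ a, cyclicExtension hm v (a + m) = cyclicExtension hm v a := by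
      intro a; simp [cyclicExtension]
    have hsub : ∀ a n, cyclicExtension hm v (a + m * n) = cyclicExtension hm v a := by
      intro a n; simp [cyclicExtension]
    have hi := Nat.mod_add_div i m
    have him := Nat.mod_lt i hm
    obtain ⟨j', hj'⟩ : ∃ j', j = j' + m * (i / m) := ⟨j - m * (i / m), by omega⟩
    obtain ⟨k', hk'⟩ : ∃ k', k = k' + m * (i / m) := ⟨k - m * (i / m), by omega⟩
    rw [hmod i, hj', hk', hsub, hsub]
    generalize i % m = i' at *
    by_cases h1 : k' < m
    · exact key _ _ _ him (by omega) h1 (by omega) (by omega)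
    obtain ⟨c, rfl⟩ : ∃ c, k' = c + m := ⟨k' - m, by omega⟩
    rw [hadd]
    by_cases h2 : j' < m
    · rw [orient_rotate]
      exact key c i' j' (by omega) him h2 (by omega) (by omega)
    obtain ⟨b, rfl⟩ : ∃ b, j' = b + m := ⟨j' - m, by omega⟩
    rw [hadd, ← orient_rotate]
    exact key _ _ _ (by omega) (by omega) him (by omega) (by omega)

/-! ### The convex hull of the vertices as an intersection of half-planes. -/

namespace CyclicPolygon

variable {m : ℕ} {V : ℕ → Plane}

theorem isOpen_openBody (hV : CyclicPolygon m V) : IsOpen (openBody V) := by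
  have : openBody V = ⋂ j ∈ Finset.range m, {z | 0 < side V j z} := by
    ext z
    simp only [openBody, Set.mem_ofPred_eq, Set.mem_iInter, Finset.mem_range]
    refine ⟨fun h j _ => h j, fun h j => ?_⟩
    rw [← hV.side_mod]
    exact h _ (Nat.mod_lt _ hV.pos)
  rw [this]
  exact isOpen_biInter_finset fun j _ => isOpen_lt continuous_const (continuous_side V j)

theorem isClosed_body (V : ℕ → Plane) : IsClosed (body V) := by
  have : body V = ⋂ j, {z | 0 ≤ side V j z} := by ext z; simp [body]
  rw [this]
  exact isClosed_iInter fun j => isClosed_le continuous_const (continuous_side V j)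

theorem convex_body (V : ℕ → Plane) : Convex ℝ (body V) := by
  rw [convex_iff_segment_subset]
  intro a ha b hb
  rw [segment_eq_image_lineMap]
  rintro _ ⟨t, ht, rfl⟩
  exact lineMap_mem_body ha hb ht.1 ht.2

theorem interior_body (hV : CyclicPolygon m V) : interior (body V) = openBody V := by
  apply Set.Subset.antisymm
  · intro z hz j
    by_contra hj
    have h0 : side V j z = 0 := le_antisymm (not_lt.1 hj) (interior_subset hz j)
    -- Moving from `z` away from `u`, that is, to a small negative parameter, makes `side V j`
    -- negative.
    set u : Plane := V (j + 2)
    have hu : 0 < side V j u := hV.turn_pos j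
    have hcont : Continuous fun t : ℝ => (AffineMap.lineMap z u t : Plane) :=
      AffineMap.lineMap_continuous
    have hmem : ∀ᶠ t in nhds (0 : ℝ), (AffineMap.lineMap z u t : Plane) ∈ body V := by
      have : body V ∈ nhds ((AffineMap.lineMap z u (0 : ℝ) : Plane)) := by
        rw [AffineMap.lineMap_apply_zero]; exact mem_interior_iff_mem_nhds.1 hz
      exact hcont.continuousAt.eventually_mem this
    obtain ⟨ε, hε, hball⟩ := Metric.eventually_nhds_iff.1 hmem
    have := hball (y := -(ε / 2)) (by simp [abs_of_pos hε]; linarith) j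
    rw [side_lineMap, h0] at this
    nlinarith
  · exact interior_maximal (openBody_subset_body V) hV.isOpen_openBody

theorem frontier_body (hV : CyclicPolygon m V) :
    frontier (body V) = {z | z ∈ body V ∧ ∃ j, side V j z = 0} := by
  rw [(isClosed_body V).frontier_eq, hV.interior_body]
  ext z
  simp only [Set.mem_sdiff, Set.mem_ofPred_eq, openBody, not_forall]
  refine and_congr_right fun hz => exists_congr fun j => ?_
  rw [not_lt]
  exact ⟨fun h => le_antisymm h (hz j), fun h => h.le⟩

/-- Triangulate the polygon as a fan from `V 0`: the point lies in some triangle `V 0, V c, V (c +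
1)`, and its barycentric coordinates there are quotients of signed areas. -/
theorem body_subset_convexHull (hV : CyclicPolygon m V) : body V ⊆ convexHull ℝ (Set.range V) := by
  intro z hz
  have h3 := hV.three_le
  -- The conjunct `c < m - 1` forces the predicate to fail at the last vertex. If the transition is
  -- caused only by this conjunct, the last side supplies the missing sign in `hle`.
  obtain ⟨c, hc1, hc2, hc3, hc4⟩ := exists_transition
    (P := fun c => 0 ≤ orient (V 0) (V c) z ∧ c < m - 1) (a := 1) (b := m - 1) (by omega)
    ⟨hz 0, by omega⟩ (by simp)
  have hle : orient (V 0) (V (c + 1)) z ≤ 0 := by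
    by_contra hcon
    push Not at hcon hc4
    have : c + 1 = m - 1 := by have := hc4 hcon.le; omega
    have h1 := hz (m - 1)
    have h2 : V (m - 1 + 1) = V 0 := by
      rw [show m - 1 + 1 = 0 + m by omega, hV.periodic]
    rw [side, h2, orient_swap, ← this] at h1
    linarith
  have hD : 0 < orient (V 0) (V c) (V (c + 1)) :=
    hV.convex _ _ _ (by omega) (by omega) (by omega)
  set D := orient (V 0) (V c) (V (c + 1)) with hDdef
  have hs : 0 ≤ orient (V c) (V (c + 1)) z := hz c
  have := (convex_convexHull ℝ (Set.range V)).sum_mem (t := Finset.univ)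
    (w := ![orient (V c) (V (c + 1)) z / D, -orient (V 0) (V (c + 1)) z / D,
      orient (V 0) (V c) z / D]) (z := ![V 0, V c, V (c + 1)]) ?_ ?_ ?_
  · convert this using 1
    rw [Fin.sum_univ_three]
    simp only [Matrix.cons_val_zero, Matrix.cons_val_one, Matrix.cons_val]
    have e : ∀ i : Fin 2, D * z i = orient (V c) (V (c + 1)) z * V 0 i +
        -orient (V 0) (V (c + 1)) z * V c i + orient (V 0) (V c) z * V (c + 1) i := by
      intro i
      fin_cases i <;> simp only [hDdef, orient] <;> simp <;> ring
    apply plane_ext <;>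
    · simp only [PiLp.add_apply, PiLp.smul_apply, smul_eq_mul]
      field_simp
      rw [mul_comm, e]
      ring
  · intro i _
    fin_cases i <;> simp <;> apply div_nonneg <;> linarith [hc3.1]
  · rw [Fin.sum_univ_three]
    simp only [Matrix.cons_val_zero, Matrix.cons_val_one, Matrix.cons_val]
    rw [← add_div, ← add_div, div_eq_one_iff_eq hD.ne']
    simp only [hDdef, orient]; ring
  · intro i _
    apply subset_convexHull
    fin_cases i <;> simp

theorem convexHull_eq_body (hV : CyclicPolygon m V) : convexHull ℝ (Set.range V) = body V := by
  apply Set.Subset.antisymm _ hV.body_subset_convexHull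
  apply convexHull_min _ (convex_body V)
  rintro _ ⟨k, rfl⟩
  exact hV.vertex_mem k

end CyclicPolygon

theorem IsConvexPolygon.region_eq {m : ℕ} {v : Fin m → Plane} (hv : IsConvexPolygon v)
    (hm : 0 < m) : region v = body (cyclicExtension hm v) := by
  rw [← (hv.cyclicPolygon hm).convexHull_eq_body, region]
  congr 1
  ext z
  constructor
  · rintro ⟨i, rfl⟩
    exact ⟨i, by simp [cyclicExtension, Nat.mod_eq_of_lt]⟩
  · rintro ⟨j, rfl⟩
    exact ⟨_, rfl⟩

end HilbertPlane

namespace HilbertPlane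

/-! ### The Hilbert metric of a polygon -/

/-- The largest ratio `side j a / side j b`. -/
noncomputable def ratioMax (m : ℕ) (V : ℕ → Plane) (a b : Plane) : ℝ :=
  (Finset.range (m + 1)).sup' Finset.nonempty_range_add_one fun j => side V j a / side V j b

/-- Coordinates with respect to the edge vectors of two consecutive sides. -/
theorem turn_mul_sub (V : ℕ → Plane) (j : ℕ) (a b : Plane) (i : Fin 2) :
    orient (V j) (V (j + 1)) (V (j + 2)) * (b i - a i) =
      (side V j b - side V j a) * (V (j + 2) i - V (j + 1) i) -
        (side V (j + 1) b - side V (j + 1) a) * (V (j + 1) i - V j i) := by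
  fin_cases i <;> simp only [orient, side] <;> simp <;> ring

theorem exists_ratioMax_eq (m : ℕ) (V : ℕ → Plane) (a b : Plane) :
    ∃ j, ratioMax m V a b = side V j a / side V j b := by
  obtain ⟨j, -, hj⟩ := Finset.exists_mem_eq_sup' (Finset.nonempty_range_add_one (n := m))
    fun j => side V j a / side V j b
  exact ⟨j, hj⟩

theorem continuous_ratioMax (m : ℕ) (V : ℕ → Plane) (b : Plane) :
    Continuous fun a => ratioMax m V a b :=
  Continuous.finset_sup'_apply _ fun j _ => (continuous_side V j).div_const _

theorem continuousOn_ratioMax (m : ℕ) (V : ℕ → Plane) (a : Plane) :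
    ContinuousOn (fun b => ratioMax m V a b) (openBody V) :=
  ContinuousOn.finset_sup'_apply _ fun j _ =>
    continuousOn_const.div (continuous_side V j).continuousOn fun _ h => (h j).ne'

namespace CyclicPolygon

variable {m : ℕ} {V : ℕ → Plane}

theorem le_ratioMax (hV : CyclicPolygon m V) (j : ℕ) (a b : Plane) :
    side V j a / side V j b ≤ ratioMax m V a b := by
  rw [← hV.side_mod j a, ← hV.side_mod j b]
  exact Finset.le_sup' (fun j => side V j a / side V j b)
    (Finset.mem_range.2 ((Nat.mod_lt j hV.pos).trans m.lt_succ_self))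

theorem side_le_ratioMax_mul (hV : CyclicPolygon m V) (j : ℕ) (a : Plane) {b : Plane}
    (hb : b ∈ openBody V) : side V j a ≤ ratioMax m V a b * side V j b :=
  (div_le_iff₀ (hb j)).1 (hV.le_ratioMax j a b)

theorem ratioMax_eq (hV : CyclicPolygon m V) {a b : Plane} {j : ℕ}
    (h : ∀ i, side V i a / side V i b ≤ side V j a / side V j b) :
    ratioMax m V a b = side V j a / side V j b := by
  obtain ⟨i, hi⟩ := exists_ratioMax_eq m V a b
  exact le_antisymm (hi ▸ h i) (hV.le_ratioMax j a b)

/-- The edge vectors sum to zero, so the differences `side j b - side j a` do too. Being nonnegative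
they all vanish, and two consecutive sides already determine a point. -/
theorem eq_of_side_le (hV : CyclicPolygon m V) {a b : Plane}
    (h : ∀ j, side V j a ≤ side V j b) : a = b := by
  have hsum : ∑ j ∈ Finset.range m, (side V j b - side V j a) = 0 := by
    have e : ∀ j, side V j b - side V j a =
        ((V (j + 1) 0 - V j 0) * (b 1 - a 1) - (V (j + 1) 1 - V j 1) * (b 0 - a 0)) := by
      intro j; simp only [side, orient]; ring
    have p0 : V m = V 0 := by simpa using hV.periodic 0
    simp only [e]
    rw [Finset.sum_sub_distrib, ← Finset.sum_mul, ← Finset.sum_mul,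
      Finset.sum_range_sub (fun j => V j 0), Finset.sum_range_sub (fun j => V j 1), p0]
    ring
  have hz := (Finset.sum_eq_zero_iff_of_nonneg fun j _ => sub_nonneg.2 (h j)).1 hsum
  have h3 := hV.three_le
  have h0 := hz 0 (Finset.mem_range.2 (by omega))
  have h1 := hz 1 (Finset.mem_range.2 (by omega))
  have t := hV.turn_pos 0
  have ee := turn_mul_sub V 0 a b
  simp only [zero_add, h0, h1] at ee
  apply plane_ext
  · have := ee 0
    simp only [zero_mul, sub_zero, mul_eq_zero, t.ne', false_or] at this
    linarith
  · have := ee 1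
    simp only [zero_mul, sub_zero, mul_eq_zero, t.ne', false_or] at this
    linarith

theorem exists_side_pos (hV : CyclicPolygon m V) (a : Plane) :
    ∃ j, 0 < side V j a := by
  by_contra! h
  have h0 := hV.eq_of_side_le fun j => (h j).trans (hV.vertex_mem 0 j)
  have h1 := hV.eq_of_side_le fun j => (h j).trans (hV.vertex_mem 1 j)
  have t := hV.turn_pos 0
  rw [← h0, zero_add, ← h1, orient_self] at t
  exact t.false

theorem ratioMax_pos (hV : CyclicPolygon m V) (a : Plane) {b : Plane} (hb : b ∈ openBody V) :
    0 < ratioMax m V a b := by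
  obtain ⟨j, hj⟩ := hV.exists_side_pos a
  exact (div_pos hj (hb j)).trans_le (hV.le_ratioMax j a b)

theorem side_pos_of_ratioMax_eq (hV : CyclicPolygon m V) {a b : Plane}
    (hb : b ∈ openBody V) {j : ℕ} (h : ratioMax m V a b = side V j a / side V j b) :
    0 < side V j a := by
  have := hV.ratioMax_pos a hb
  rw [h] at this
  exact (div_pos_iff_of_pos_right (hb j)).1 this

theorem one_lt_ratioMax (hV : CyclicPolygon m V) {a b : Plane} (hb : b ∈ openBody V)
    (hab : a ≠ b) : 1 < ratioMax m V a b := by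
  by_contra! h
  apply hab
  apply hV.eq_of_side_le
  intro j
  have h1 := hV.side_le_ratioMax_mul j a hb
  have := hb j
  nlinarith

theorem ratioMax_self {a : Plane} (ha : a ∈ openBody V) : ratioMax m V a a = 1 := by
  obtain ⟨j, hj⟩ := exists_ratioMax_eq m V a a
  have := ha j
  rw [hj, div_self this.ne']

/-- The parameter of the endpoint of a chord. -/
theorem sSup_chord (hV : CyclicPolygon m V) {a b : Plane} (hb : b ∈ openBody V) (hab : a ≠ b) :
    sSup {t : ℝ | AffineMap.lineMap a b t ∈ body V} =
      ratioMax m V a b / (ratioMax m V a b - 1) := by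
  have hN := hV.one_lt_ratioMax hb hab
  obtain ⟨j, hj⟩ := exists_ratioMax_eq m V a b
  have hle := fun i => hV.side_le_ratioMax_mul i a hb
  rw [eq_div_iff (hb j).ne'] at hj
  generalize ratioMax m V a b = N at *
  have hN' : 0 < N - 1 := by linarith
  apply IsGreatest.csSup_eq
  constructor
  · intro i
    rw [side_lineMap]
    have : (1 - N / (N - 1)) * side V i a + N / (N - 1) * side V i b =
        (N * side V i b - side V i a) / (N - 1) := by field_simp; ring
    rw [this]
    exact div_nonneg (by linarith [hle i]) hN'.le
  -- The side attaining the maximum vanishes at the parameter `N / (N - 1)` and is negative beyond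
  -- it.
  · intro t ht
    have h := ht j
    rw [side_lineMap, ← hj] at h
    rw [le_div_iff₀ hN']
    have hbj := hb j
    by_contra! hcon
    nlinarith

/-- With the endpoint at parameter `t = N / (N - 1)`, the quotient of distances is `t / (t - 1) =
N`. -/
theorem dist_chordEnd_div (hV : CyclicPolygon m V) {a b : Plane} (hb : b ∈ openBody V)
    (hab : a ≠ b) :
    dist a (chordEnd (body V) a b) / dist b (chordEnd (body V) a b) = ratioMax m V a b := by
  have hN := hV.one_lt_ratioMax hb hab
  rw [chordEnd, hV.sSup_chord hb hab, dist_left_lineMap, dist_right_lineMap]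
  generalize ratioMax m V a b = N at *
  have hN' : 0 < N - 1 := by linarith
  have hd : dist a b ≠ 0 := dist_ne_zero.2 hab
  have h1 : 1 - N / (N - 1) = -(1 / (N - 1)) := by field_simp; ring
  rw [h1, norm_neg, Real.norm_of_nonneg (by positivity), Real.norm_of_nonneg (by positivity)]
  field_simp

theorem hilbertDist_eq (hV : CyclicPolygon m V) {a b : Plane} (ha : a ∈ openBody V)
    (hb : b ∈ openBody V) : hilbertDist (body V) a b =
      1 / 2 * Real.log (ratioMax m V a b * ratioMax m V b a) := by
  unfold hilbertDist
  split_ifs with h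
  · subst h
    simp [ratioMax_self ha]
  · rw [hV.dist_chordEnd_div hb h, hV.dist_chordEnd_div ha (Ne.symm h), mul_comm (ratioMax m V b a)]

theorem bisector_eq (hV : CyclicPolygon m V) {p q : Plane} (hp : p ∈ openBody V)
    (hq : q ∈ openBody V) : bisector (body V) p q = {x | x ∈ openBody V ∧
      ratioMax m V x p * ratioMax m V p x = ratioMax m V x q * ratioMax m V q x} := by
  ext x
  simp only [bisector, hV.interior_body, Set.mem_ofPred_eq]
  refine and_congr_right fun hx => ?_
  rw [hV.hilbertDist_eq hx hp, hV.hilbertDist_eq hx hq]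
  have h1 := mul_pos (hV.ratioMax_pos x hp) (hV.ratioMax_pos p hx)
  have h2 := mul_pos (hV.ratioMax_pos x hq) (hV.ratioMax_pos q hx)
  constructor
  · intro h
    exact Real.log_injOn_pos h1 h2 (by linarith)
  · intro h
    rw [h]

end CyclicPolygon

/-- The boundary comparison function of the side `i`: on that side, its sign is the sign of the
limit of `d(x,p) - d(x,q)`. -/
noncomputable def balance (m : ℕ) (V : ℕ → Plane) (p q : Plane) (i : ℕ) (z : Plane) : ℝ :=
  side V i p * ratioMax m V z p - side V i q * ratioMax m V z q

theorem balance_swap (m : ℕ) (V : ℕ → Plane) (p q : Plane) (i : ℕ) (z : Plane) :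
    balance m V q p i z = -balance m V p q i z := by
  simp only [balance]; ring

theorem continuous_balance (m : ℕ) (V : ℕ → Plane) (p q : Plane) (i : ℕ) :
    Continuous (balance m V p q i) :=
  ((continuous_ratioMax m V p).const_mul _).sub ((continuous_ratioMax m V q).const_mul _)

/-! ### Limit points of the bisector and the sign of the boundary comparison. -/

namespace CyclicPolygon

variable {m : ℕ} {V : ℕ → Plane} {p q : Plane}

/-- On the segment from a boundary point `z` to `q`, the distance to `q` is at most the distance
to `p` when the boundary comparison is nonnegative at `z`. -/
theorem le_on_segment (hV : CyclicPolygon m V) (hp : p ∈ openBody V)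
    (hq : q ∈ openBody V) {z : Plane} (hz : z ∈ body V) {i : ℕ} (hi : side V i z = 0)
    (hT : 0 ≤ balance m V p q i z) {ε : ℝ} (h0 : 0 < ε) (h1 : ε < 1) :
    ratioMax m V (AffineMap.lineMap z q ε) q * ratioMax m V q (AffineMap.lineMap z q ε) ≤
      ratioMax m V (AffineMap.lineMap z q ε) p * ratioMax m V p (AffineMap.lineMap z q ε) := by
  set x : Plane := AffineMap.lineMap z q ε with hx
  have hxo : x ∈ openBody V := lineMap_mem_openBody hz hq h0 h1.le
  have hsx : ∀ k, side V k x = (1 - ε) * side V k z + ε * side V k q :=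
    fun k => side_lineMap V k z q ε
  have hzq : z ≠ q := fun h => (hq i).ne' (h ▸ hi)
  have hM := hV.one_lt_ratioMax hq hzq
  set Mq := ratioMax m V z q with hMq
  set Mp := ratioMax m V z p with hMp
  -- the nearer end of the chord
  have hNq : ratioMax m V q x ≤ 1 / ε := by
    obtain ⟨k, hk⟩ := exists_ratioMax_eq m V q x
    rw [hk, div_le_div_iff₀ (hxo k) h0, hsx]
    nlinarith [hz k]
  have hNp : side V i p / (ε * side V i q) ≤ ratioMax m V p x := by
    have := hV.le_ratioMax i p x
    rwa [hsx, hi, mul_zero, zero_add] at this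
  -- the farther end
  have hfar_q : ratioMax m V x q ≤ (1 - ε) * Mq + ε := by
    obtain ⟨k, hk⟩ := exists_ratioMax_eq m V x q
    rw [hk, div_le_iff₀ (hq k), hsx]
    have := hV.side_le_ratioMax_mul k z hq
    nlinarith
  have hfar_p : Mp / Mq * ((1 - ε) * Mq + ε) ≤ ratioMax m V x p := by
    obtain ⟨j, hj⟩ := exists_ratioMax_eq m V z p
    -- Only the side `j` attaining `M(z,p)` is needed; the loss is controlled by `side j z ≤ M(z,q)
    -- * side j q`.
    refine le_trans ?_ (hV.le_ratioMax j x p)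
    rw [← hMp] at hj
    rw [hj, hsx]
    have := hV.side_le_ratioMax_mul j z hq
    have hMq0 : 0 < Mq := by linarith
    have hpj := hp j
    rw [div_div, div_mul_eq_mul_div, div_le_div_iff₀ (by positivity) hpj]
    have e : side V j z * ((1 - ε) * Mq + ε) ≤
        ((1 - ε) * side V j z + ε * side V j q) * Mq := by
      nlinarith
    nlinarith
  have hMq0 : 0 < Mq := by linarith
  have hMp0 : 0 < Mp := hV.ratioMax_pos z hp
  have hA : 0 < (1 - ε) * Mq + ε := by nlinarith
  have hqi := hq i
  have hpi := hp i
  calc ratioMax m V x q * ratioMax m V q x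
      ≤ ((1 - ε) * Mq + ε) * (1 / ε) :=
        mul_le_mul hfar_q hNq (hV.ratioMax_pos q hxo).le hA.le
    _ ≤ (Mp / Mq * ((1 - ε) * Mq + ε)) * (side V i p / (ε * side V i q)) := by
        rw [show Mp / Mq * ((1 - ε) * Mq + ε) * (side V i p / (ε * side V i q)) =
          ((1 - ε) * Mq + ε) * (1 / ε) * (side V i p * Mp / (side V i q * Mq)) by field_simp]
        apply le_mul_of_one_le_right (by positivity)
        rw [one_le_div (by positivity)]
        unfold balance at hT
        linarith
    _ ≤ ratioMax m V x p * ratioMax m V p x :=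
        mul_le_mul hfar_p hNp (by positivity) (hV.ratioMax_pos x hp).le

/-- A boundary point at which the boundary comparison takes both signs is a limit point of the
bisector. -/
theorem mem_bisectorEnds (hV : CyclicPolygon m V) (hp : p ∈ openBody V) (hq : q ∈ openBody V)
    {z : Plane} (hz : z ∈ body V) {i j : ℕ} (hi : side V i z = 0) (hj : side V j z = 0)
    (hTi : 0 ≤ balance m V p q i z) (hTj : balance m V p q j z ≤ 0) :
    z ∈ bisectorEnds (body V) p q := by
  refine ⟨?_, by rw [hV.frontier_body]; exact ⟨hz, i, hi⟩⟩
  rw [Metric.mem_closure_iff]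
  intro δ hδ
  set B : ℝ := dist z q + dist z p + 1 with hB
  have hBpos : 0 < B := by positivity
  -- This choice puts the points at parameter `ε` on the segments from `z` to `q` and to `p` within
  -- `δ` of `z`. The intermediate value theorem is then applied between these two points.
  set ε : ℝ := min (1 / 2) (δ / (2 * B)) with hε
  have hε0 : 0 < ε := by positivity
  have hε1 : ε < 1 := (min_le_left _ _).trans_lt (by norm_num)
  have hεδ : ε * B < δ := by
    have : ε * B ≤ δ / (2 * B) * B := mul_le_mul_of_nonneg_right (min_le_right _ _) hBpos.le
    have e : δ / (2 * B) * B = δ / 2 := by field_simp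
    linarith
  set x : Plane := AffineMap.lineMap z q ε
  set y : Plane := AffineMap.lineMap z p ε
  have hx := hV.le_on_segment hp hq hz hi hTi hε0 hε1
  have hy := hV.le_on_segment hq hp hz hj (by rw [balance_swap]; linarith) hε0 hε1
  have hxo : x ∈ openBody V := lineMap_mem_openBody hz hq hε0 hε1.le
  have hyo : y ∈ openBody V := lineMap_mem_openBody hz hp hε0 hε1.le
  let D : Plane → ℝ := fun x => ratioMax m V x p * ratioMax m V p x -
    ratioMax m V x q * ratioMax m V q x
  have hD : ContinuousOn D (openBody V) :=
    ((continuous_ratioMax m V p).continuousOn.mul (continuousOn_ratioMax m V p)).sub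
      ((continuous_ratioMax m V q).continuousOn.mul (continuousOn_ratioMax m V q))
  have hγ : ∀ t ∈ Set.Icc (0 : ℝ) 1, (AffineMap.lineMap x y t : Plane) ∈ openBody V := by
    intro t ht
    rcases ht.1.eq_or_lt with rfl | h0
    · rwa [AffineMap.lineMap_apply_zero]
    · exact lineMap_mem_openBody (openBody_subset_body V hxo) hyo h0 ht.2
  have hcont : ContinuousOn (fun t : ℝ => D (AffineMap.lineMap x y t)) (Set.Icc 0 1) :=
    hD.comp AffineMap.lineMap_continuous.continuousOn hγ
  have := intermediate_value_Icc' (zero_le_one' ℝ) hcont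
  have h0 : (0 : ℝ) ∈ Set.Icc (D (AffineMap.lineMap x y (1 : ℝ)))
      (D (AffineMap.lineMap x y (0 : ℝ))) := by
    rw [AffineMap.lineMap_apply_zero, AffineMap.lineMap_apply_one]
    constructor
    · simp only [D]; linarith
    · simp only [D]; linarith
  obtain ⟨t, ht, hDt⟩ := this h0
  refine ⟨AffineMap.lineMap x y t, ?_, ?_⟩
  · rw [hV.bisector_eq hp hq]
    exact ⟨hγ t ht, sub_eq_zero.1 hDt⟩
  · have hball : ∀ r : Plane, dist z r ≤ B → AffineMap.lineMap z r ε ∈ Metric.ball z δ := by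
      intro r hr
      rw [Metric.mem_ball, dist_comm, dist_left_lineMap, Real.norm_of_nonneg hε0.le]
      exact (mul_le_mul_of_nonneg_left hr hε0.le).trans_lt hεδ
    have hxb : x ∈ Metric.ball z δ := hball q (by rw [hB]; linarith [dist_nonneg (x := z) (y := p)])
    have hyb : y ∈ Metric.ball z δ := hball p (by rw [hB]; linarith [dist_nonneg (x := z) (y := q)])
    have := (convex_ball z δ).segment_subset hxb hyb
    rw [segment_eq_image_lineMap] at this
    have := this ⟨t, ht, rfl⟩
    rwa [Metric.mem_ball, dist_comm] at this

/-- At a limit point of the bisector the boundary comparison is nonpositive on some side through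
the point. -/
theorem exists_balance_nonpos (hV : CyclicPolygon m V) (hp : p ∈ openBody V) (hq : q ∈ openBody V)
    {z : Plane} (hz : z ∈ bisectorEnds (body V) p q) :
    ∃ i, side V i z = 0 ∧ balance m V p q i z ≤ 0 := by
  obtain ⟨hcl, hfr⟩ := hz
  rw [hV.frontier_body] at hfr
  obtain ⟨hzb, i₀, hi₀⟩ := hfr
  by_contra! hcon
  -- close to `z`, the sides that do not pass through `z` do not matter
  have hev : ∀ᶠ x in nhds z, ∀ k ∈ Finset.range m,
      (side V k z = 0 → 0 < balance m V p q k x) ∧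
      (side V k z ≠ 0 → side V k q * side V i₀ x < side V i₀ q * side V k x) := by
    rw [Filter.eventually_all_finset]
    intro k _
    by_cases hk : side V k z = 0
    · have := (continuous_balance m V p q k).continuousAt.eventually (lt_mem_nhds (hcon k hk))
      filter_upwards [this] with x hx
      exact ⟨fun _ => hx, fun h => absurd hk h⟩
    · have hlt : side V k q * side V i₀ z < side V i₀ q * side V k z := by
        rw [hi₀, mul_zero]
        exact mul_pos (hq i₀) (lt_of_le_of_ne (hzb k) (Ne.symm hk))
      have := (isOpen_lt ((continuous_side V i₀).const_mul (side V k q))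
        ((continuous_side V k).const_mul (side V i₀ q))).mem_nhds hlt
      filter_upwards [this] with x hx
      exact ⟨fun h => absurd h hk, fun _ => hx⟩
  obtain ⟨x, hx, hxb⟩ := (mem_closure_iff_nhds.1 hcl) _ hev
  rw [hV.bisector_eq hp hq] at hxb
  obtain ⟨hxo, hxe⟩ := hxb
  obtain ⟨k', hk'⟩ := exists_ratioMax_eq m V q x
  obtain ⟨k, hkm, hk⟩ : ∃ k ∈ Finset.range m, ratioMax m V q x = side V k q / side V k x :=
    ⟨k' % m, Finset.mem_range.2 (Nat.mod_lt _ hV.pos), by rw [hV.side_mod, hV.side_mod, hk']⟩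
  obtain ⟨h1, h2⟩ := hx k hkm
  by_cases hkz : side V k z = 0
  · have hT := h1 hkz
    have hle := hV.le_ratioMax k p x
    have hM := hV.ratioMax_pos x hp
    have hxk := hxo k
    have : ratioMax m V x q * ratioMax m V q x < ratioMax m V x p * ratioMax m V p x := by
      calc ratioMax m V x q * ratioMax m V q x = side V k q * ratioMax m V x q / side V k x := by
            rw [hk]; ring
        _ < side V k p * ratioMax m V x p / side V k x := by
            apply div_lt_div_of_pos_right _ hxk
            unfold balance at hT
            linarith
        _ = ratioMax m V x p * (side V k p / side V k x) := by ring
        _ ≤ _ := mul_le_mul_of_nonneg_left hle hM.le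
    linarith
  · have := h2 hkz
    have hle := hV.le_ratioMax i₀ q x
    rw [hk, div_le_div_iff₀ (hxo _) (hxo _)] at hle
    linarith

theorem bisectorEnds_swap (K : Set Plane) (p q : Plane) :
    bisectorEnds K q p = bisectorEnds K p q := by
  have : bisector K q p = bisector K p q := by
    ext x; simp only [bisector, Set.mem_ofPred_eq, eq_comm]
  simp only [bisectorEnds, this]

theorem exists_balance_nonneg (hV : CyclicPolygon m V) (hp : p ∈ openBody V) (hq : q ∈ openBody V)
    {z : Plane} (hz : z ∈ bisectorEnds (body V) p q) :
    ∃ i, side V i z = 0 ∧ 0 ≤ balance m V p q i z := by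
  rw [← bisectorEnds_swap] at hz
  obtain ⟨i, h1, h2⟩ := hV.exists_balance_nonpos hq hp hz
  rw [balance_swap] at h2
  exact ⟨i, h1, by linarith⟩

end CyclicPolygon

end HilbertPlane

namespace HilbertPlane

/-! ### The line through `p` and `q` -/

/-- Two affine functions determine signed areas. -/
theorem orient_mul_sub (p q a b z r g : Plane) :
    orient z r g * (orient p q a - orient p q b) =
      orient a b z * (orient p q r - orient p q g) - orient p q z * (orient a b r - orient a b g)
        - orient p q r * orient a b g + orient a b r * orient p q g := by
  simp only [orient]; ring

theorem side_sub_side (V : ℕ → Plane) (i : ℕ) (p q : Plane) :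
    side V i p - side V i q = orient p q (V (i + 1)) - orient p q (V i) := by
  simp only [side, orient]; ring

theorem exists_lineMap_eq {p q z : Plane} (hpq : p ≠ q) (hz : orient p q z = 0) :
    ∃ t : ℝ, z = AffineMap.lineMap p q t := by
  by_cases h0 : q 0 - p 0 = 0
  · have h1 : q 1 - p 1 ≠ 0 := by
      intro h1
      exact hpq (plane_ext (by linarith) (by linarith))
    refine ⟨(z 1 - p 1) / (q 1 - p 1), ?_⟩
    simp only [orient, h0, zero_mul, zero_sub, neg_eq_zero, mul_eq_zero, h1, false_or] at hz
    apply plane_ext <;> rw [lineMap_coord]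
    · rw [h0]; linarith
    · field_simp; ring
  · refine ⟨(z 0 - p 0) / (q 0 - p 0), ?_⟩
    apply plane_ext <;> rw [lineMap_coord]
    · field_simp; ring
    · unfold orient at hz
      field_simp
      linarith

namespace CyclicPolygon

variable {m : ℕ} {V : ℕ → Plane} {p q : Plane}

/-- Beyond `q`, any side `j` with `side j z > 0` has a smaller ratio `side j p / side j q` than the
side `i` that vanishes at `z`. Take for `j` the side attaining `M(z,q)` and use it as a lower bound
for `M(z,p)`. -/
theorem balance_pos_of_beyond (hV : CyclicPolygon m V) (hp : p ∈ openBody V) (hq : q ∈ openBody V)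
    {t : ℝ} (ht : 1 < t) {i : ℕ}
    (hi : side V i (AffineMap.lineMap p q t) = 0) :
    0 < balance m V p q i (AffineMap.lineMap p q t) := by
  set z : Plane := AffineMap.lineMap p q t with hzdef
  have hs : ∀ k, side V k z = (1 - t) * side V k p + t * side V k q :=
    fun k => side_lineMap V k p q t
  obtain ⟨j, hj⟩ := exists_ratioMax_eq m V z q
  have hjz := hV.side_pos_of_ratioMax_eq hq hj
  have hle := hV.le_ratioMax j z p
  have hpi := hp i
  have hqi := hq i
  have hpj := hp j
  have hqj := hq j
  have h1 := hs i
  have h2 := hs j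
  rw [hi] at h1
  have key : side V i q * side V j p < side V i p * side V j q := by nlinarith
  unfold balance
  rw [hj]
  have : side V i q * (side V j z / side V j q) < side V i p * (side V j z / side V j p) := by
    rw [← mul_div_assoc, ← mul_div_assoc, div_lt_div_iff₀ hqj hpj]
    nlinarith
  nlinarith

/-- Since `side i` decreases from `p` to `q` and is positive at both, its zero on the line lies
beyond `q`. -/
theorem balance_pos_of_line (hV : CyclicPolygon m V) (hp : p ∈ openBody V) (hq : q ∈ openBody V)
    (hpq : p ≠ q) {z : Plane} (hs : orient p q z = 0) {i : ℕ}
    (hi : side V i z = 0) (hlt : side V i q < side V i p) : 0 < balance m V p q i z := by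
  obtain ⟨t, rfl⟩ := exists_lineMap_eq hpq hs
  refine hV.balance_pos_of_beyond hp hq ?_ hi
  rw [side_lineMap] at hi
  have := hq i
  by_contra! h
  nlinarith

theorem balance_neg_of_line (hV : CyclicPolygon m V) (hp : p ∈ openBody V) (hq : q ∈ openBody V)
    (hpq : p ≠ q) {z : Plane} (hs : orient p q z = 0) {i : ℕ}
    (hi : side V i z = 0) (hlt : side V i p < side V i q) : balance m V p q i z < 0 := by
  have := hV.balance_pos_of_line hq hp hpq.symm (by rw [orient_swap, hs, neg_zero]) hi hlt
  rw [balance_swap] at this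
  linarith

theorem balance_ne_zero_of_line (hV : CyclicPolygon m V) (hp : p ∈ openBody V)
    (hq : q ∈ openBody V) (hpq : p ≠ q) {z : Plane} (hs : orient p q z = 0)
    {i : ℕ} (hi : side V i z = 0) : balance m V p q i z ≠ 0 := by
  rcases lt_trichotomy (side V i p) (side V i q) with h | h | h
  · exact (hV.balance_neg_of_line hp hq hpq hs hi h).ne
  · obtain ⟨t, rfl⟩ := exists_lineMap_eq hpq hs
    rw [side_lineMap, h] at hi
    have := hq i
    linarith
  · exact (hV.balance_pos_of_line hp hq hpq hs hi h).ne'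

/-- Limit points of the bisector do not lie on the line through `p` and `q`. -/
theorem orient_ne_zero_of_mem_bisectorEnds (hV : CyclicPolygon m V) (hp : p ∈ openBody V)
    (hq : q ∈ openBody V) (hpq : p ≠ q) {z : Plane} (hz : z ∈ bisectorEnds (body V) p q) :
    orient p q z ≠ 0 := by
  intro hs
  obtain ⟨i, hi, hTi⟩ := hV.exists_balance_nonpos hp hq hz
  obtain ⟨j, hj, hTj⟩ := hV.exists_balance_nonneg hp hq hz
  obtain ⟨t, rfl⟩ := exists_lineMap_eq hpq hs
  rcases lt_or_ge 1 t with ht | ht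
  · linarith [hV.balance_pos_of_beyond hp hq ht hi]
  -- A parameter in `[0, 1]` would make `side i` positive, so `z` lies before `p`, and the roles of
  -- `p` and `q` are exchanged.
  · have h0 : 1 < 1 - t := by
      rw [side_lineMap] at hi
      have := hq i
      have := hp i
      by_contra! h
      rcases (show 0 ≤ t by linarith).eq_or_lt with rfl | h0
      · linarith
      · nlinarith [mul_pos h0 (hq i), mul_nonneg (sub_nonneg.2 ht) (hp i).le]
    rw [← AffineMap.lineMap_apply_one_sub] at hj hTj
    have := hV.balance_pos_of_beyond hq hp h0 hj
    rw [balance_swap] at this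
    linarith

/-- Four vertices in cyclic order do not alternate between the sides of a line. -/
theorem not_alternating (hV : CyclicPolygon m V) (p q : Plane) {i j k l : ℕ} (hij : i < j)
    (hjk : j < k) (hkl : k < l) (hl : l < i + m) (hi : orient p q (V i) ≤ 0)
    (hj : 0 < orient p q (V j)) (hk : orient p q (V k) ≤ 0) : orient p q (V l) ≤ 0 := by
  by_contra! hl'
  have h1 := hV.convex j k l hjk hkl (by omega)
  have h2 := hV.convex i j l hij (by omega) (by omega)
  have h3 := hV.convex i k l (by omega) hkl (by omega)
  have h4 := hV.convex i j k hij hjk (by omega)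
  -- The diagonals of the quadrilateral meet: this affine relation between its vertices, to which
  -- `orient p q` is applied, puts the two diagonals on different sides of the equation.
  have e : orient (V j) (V k) (V l) * orient p q (V i) + orient (V i) (V j) (V l) *
      orient p q (V k) = orient (V i) (V k) (V l) * orient p q (V j) +
      orient (V i) (V j) (V k) * orient p q (V l) := by
    simp only [orient]; ring
  have := mul_pos h3 hj
  have := mul_pos h4 hl'
  have := mul_nonpos_of_nonneg_of_nonpos h1.le hi
  have := mul_nonpos_of_nonneg_of_nonpos h2.le hk
  linarith

end CyclicPolygon

/-- The directed line from `p` to `q` leaves the polygon through the side `f` and enters it through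
the side `b`; the vertices `f + 1, …, b` lie to its left. -/
structure Crossing (m : ℕ) (V : ℕ → Plane) (p q : Plane) (f b : ℕ) : Prop where
  lt : f < b
  lt_add : b < f + m
  start_nonpos : orient p q (V f) ≤ 0
  start_pos : 0 < orient p q (V (f + 1))
  end_pos : 0 < orient p q (V b)
  end_nonpos : orient p q (V (b + 1)) ≤ 0

/-! ### Vertices and rays relative to the line `pq`. -/

namespace CyclicPolygon

variable {m : ℕ} {V : ℕ → Plane} {p q r : Plane} {f b : ℕ}

/-- An exceptional vertex would alternate with `V f`, `V (f + 1)` and `V b`. -/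
theorem left_vertex (hV : CyclicPolygon m V) (hc : Crossing m V p q f b) {j : ℕ} (h1 : f < j)
    (h2 : j ≤ b) : 0 < orient p q (V j) := by
  by_contra! h
  have hb := hc.end_pos
  have hf := hc.start_pos
  have h3 : f + 1 ≠ j := fun e => by rw [e] at hf; linarith
  have h4 : j ≠ b := fun e => by rw [← e] at hb; linarith
  have := hV.not_alternating p q (i := f) (j := f + 1) (k := j) (l := b) (by omega) (by omega)
    (by omega) hc.lt_add hc.start_nonpos hc.start_pos h
  linarith

theorem right_vertex (hV : CyclicPolygon m V) (hc : Crossing m V p q f b) {j : ℕ} (h1 : b < j)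
    (h2 : j ≤ f + m) : orient p q (V j) ≤ 0 := by
  by_contra! h
  have hb := hc.end_nonpos
  have hf : orient p q (V (f + m)) ≤ 0 := by rw [hV.periodic]; exact hc.start_nonpos
  have h3 : b + 1 ≠ j := fun e => by rw [e] at hb; linarith
  have h4 : j ≠ f + m := fun e => by rw [← e] at hf; linarith
  have := hV.not_alternating p q (i := b + 1) (j := j) (k := f + m) (l := b + m) (by omega)
    (by omega) (by have := hc.lt; omega) (by omega) hb h hf
  rw [hV.periodic] at this
  linarith [hc.end_pos]

/-- The line meets a side with end points on different sides. -/
theorem exists_crossing_point (hV : CyclicPolygon m V) {i : ℕ}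
    (h : orient p q (V i) * orient p q (V (i + 1)) ≤ 0)
    (hne : orient p q (V i) ≠ orient p q (V (i + 1))) :
    ∃ g ∈ body V, side V i g = 0 ∧ orient p q g = 0 := by
  set a := orient p q (V i)
  set c := orient p q (V (i + 1))
  have hne' : a - c ≠ 0 := sub_ne_zero.2 hne
  refine ⟨AffineMap.lineMap (V i) (V (i + 1)) (a / (a - c)),
    lineMap_mem_body (hV.vertex_mem _) (hV.vertex_mem _) ?_ ?_, by simp [side_lineMap], ?_⟩
  · rw [show a / (a - c) = a * (a - c) / ((a - c) * (a - c)) by field_simp]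
    exact div_nonneg (by nlinarith [mul_self_nonneg a]) (mul_self_nonneg _)
  · rw [show a / (a - c) = 1 + c * (a - c) / ((a - c) * (a - c)) by field_simp; ring]
    have : c * (a - c) / ((a - c) * (a - c)) ≤ 0 :=
      div_nonpos_of_nonpos_of_nonneg (by nlinarith [mul_self_nonneg c]) (mul_self_nonneg _)
    linarith
  · rw [orient_lineMap]
    change (1 - a / (a - c)) * a + a / (a - c) * c = 0
    field_simp
    ring

/-- As `r` and `g` lie on `pq` and `g` on the side `b`, `orient_mul_sub` collapses: `orient z r g`
times the positive drop of `orient p q` along the side equals `-(orient p q z) * side V b r`. Seen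
from the left, the entry point is therefore never left of the ray through `r`; the exit point, by
the same computation, is never right of it. -/
theorem orient_entry_nonpos (hc : Crossing m V p q f b) (hr : r ∈ openBody V)
    (hsr : orient p q r = 0) {g : Plane} (hg : side V b g = 0) (hsg : orient p q g = 0) {z : Plane}
    (hz : 0 ≤ orient p q z) : orient z r g ≤ 0 := by
  have e := orient_mul_sub p q (V b) (V (b + 1)) z r g
  have hr' := hr b
  rw [hsr, hsg] at e
  unfold side at hg hr'
  rw [hg] at e
  have := hc.end_pos
  have := hc.end_nonpos
  by_contra! h
  nlinarith [mul_pos h (show 0 < orient p q (V b) - orient p q (V (b + 1)) by linarith),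
    mul_nonneg hz hr'.le]

theorem orient_exit_pos (hc : Crossing m V p q f b) (hr : r ∈ openBody V)
    (hsr : orient p q r = 0) {g : Plane} (hg : side V f g = 0) (hsg : orient p q g = 0) {z : Plane}
    (hz : 0 < orient p q z) : 0 < orient z r g := by
  have e := orient_mul_sub p q (V f) (V (f + 1)) z r g
  have hr' := hr f
  rw [hsr, hsg] at e
  unfold side at hg hr'
  rw [hg] at e
  have := hc.start_pos
  have := hc.start_nonpos
  by_contra! h
  nlinarith [mul_nonneg (neg_nonneg.2 h)
    (show 0 ≤ orient p q (V (f + 1)) - orient p q (V f) by linarith), mul_pos hz hr']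

theorem orient_exit_nonneg (hc : Crossing m V p q f b) (hr : r ∈ openBody V)
    (hsr : orient p q r = 0) {g : Plane} (hg : side V f g = 0) (hsg : orient p q g = 0) {z : Plane}
    (hz : 0 ≤ orient p q z) : 0 ≤ orient z r g := by
  have e := orient_mul_sub p q (V f) (V (f + 1)) z r g
  have hr' := hr f
  rw [hsr, hsg] at e
  unfold side at hg hr'
  rw [hg] at e
  have := hc.start_pos
  have := hc.start_nonpos
  by_contra! h
  nlinarith [mul_pos (neg_pos.2 h)
    (show 0 < orient p q (V (f + 1)) - orient p q (V f) by linarith), mul_nonneg hz hr'.le]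

/-- The ray from `z` through `r` leaves the polygon through the side `j`. -/
theorem ratioMax_eq_of_exit (hV : CyclicPolygon m V) (hr : r ∈ openBody V)
    (hsr : orient p q r = 0) {z g h : Plane} (hz : 0 < orient p q z) (hg : g ∈ body V)
    (hh : h ∈ body V) {j : ℕ} (hjg : side V j g = 0) (hjh : side V j h = 0)
    (hsg : orient p q g ≤ 0) (hsh : orient p q h ≤ 0) (hog : orient z r g ≤ 0)
    (hoh : 0 ≤ orient z r h) : ratioMax m V z r = side V j z / side V j r := by
  -- The points `g` and `h` of side `j` are weakly separated by the line `zr`, so the segment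
  -- between them contains a point `e` of that line.
  obtain ⟨e, he, hje, hse, hoe⟩ : ∃ e ∈ body V, side V j e = 0 ∧ orient p q e ≤ 0 ∧
      orient z r e = 0 := by
    rcases hog.eq_or_lt with h0 | h0
    · exact ⟨g, hg, hjg, hsg, h0⟩
    have hd : 0 < orient z r h - orient z r g := by linarith
    have h1 : 0 ≤ -orient z r g / (orient z r h - orient z r g) :=
      div_nonneg (by linarith) hd.le
    have h2 : -orient z r g / (orient z r h - orient z r g) ≤ 1 := by
      rw [div_le_one hd]; linarith
    refine ⟨AffineMap.lineMap g h (-orient z r g / (orient z r h - orient z r g)),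
      lineMap_mem_body hg hh h1 h2, ?_, ?_, ?_⟩
    · rw [side_lineMap, hjg, hjh]; ring
    · rw [orient_lineMap]; nlinarith
    · rw [orient_lineMap]; field_simp; ring
  -- Here `z`, `r`, `e` are collinear and `r` lies on `pq`, so the coefficients of the affine
  -- relation between them are read off from `orient p q`. Nonnegativity of `side i e`, with
  -- equality for `i = j`, bounds every ratio by that of `j`.
  have key : ∀ i, side V i e * orient p q z =
      orient p q e * side V i z + (orient p q z - orient p q e) * side V i r := by
    intro i
    have := orient_mul_sub p q (V i) (V (i + 1)) z r e
    rw [hoe, hsr] at this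
    unfold side
    linarith
  have hj := key j
  rw [hje, zero_mul] at hj
  have hrj := hr j
  have hσ : orient p q e < 0 := by
    refine hse.lt_of_ne fun h0 => ?_
    rw [h0] at hj
    nlinarith
  apply hV.ratioMax_eq
  intro i
  have hi := key i
  have hei := mul_nonneg (he i) hz.le
  have hri := hr i
  rw [div_le_div_iff₀ hri hrj]
  have e1 : -orient p q e * side V j z = (orient p q z - orient p q e) * side V j r := by linarith
  have e2 : -orient p q e * side V i z ≤ (orient p q z - orient p q e) * side V i r := by linarith
  have e3 := mul_le_mul_of_nonneg_right e2 hrj.le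
  have e4 : -orient p q e * (side V i z * side V j r) ≤ -orient p q e * (side V j z * side V i r) := by
    calc _ = -orient p q e * side V i z * side V j r := by ring
      _ ≤ _ := e3
      _ = (orient p q z - orient p q e) * side V j r * side V i r := by ring
      _ = _ := by rw [← e1]; ring
  exact le_of_mul_le_mul_left e4 (by linarith)

/-- A ray from a point on the left leaves the polygon on the right. -/
theorem exists_exit (hV : CyclicPolygon m V) (hc : Crossing m V p q f b) (hr : r ∈ openBody V)
    (hsr : orient p q r = 0) {z : Plane} (hz : 0 < orient p q z) :
    ∃ j, b ≤ j ∧ j ≤ f + m ∧ ratioMax m V z r = side V j z / side V j r := by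
  have hfm := hc.lt_add
  obtain ⟨g, hg, hbg, hsg⟩ := hV.exists_crossing_point (p := p) (q := q) (i := b)
    (mul_nonpos_of_nonneg_of_nonpos hc.end_pos.le hc.end_nonpos)
    (hc.end_nonpos.trans_lt hc.end_pos).ne'
  obtain ⟨h, hh, hfh, hsh⟩ := hV.exists_crossing_point (p := p) (q := q) (i := f)
    (mul_nonpos_of_nonpos_of_nonneg hc.start_nonpos hc.start_pos.le)
    (hc.start_nonpos.trans_lt hc.start_pos).ne
  -- Where `P` fails for the first time, the common vertex of the two sides lies on the left of the
  -- ray, so the preceding side is crossed.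
  let P : ℕ → Prop := fun j => ∃ g ∈ body V, side V j g = 0 ∧ orient p q g ≤ 0 ∧ orient z r g ≤ 0
  have hPb : P b := ⟨g, hg, hbg, hsg.le, orient_entry_nonpos hc hr hsr hbg hsg hz.le⟩
  by_cases hP : P (f + m)
  · obtain ⟨g', hg', h1, h2, h3⟩ := hP
    refine ⟨f + m, hfm.le, le_rfl, ?_⟩
    exact hV.ratioMax_eq_of_exit hr hsr hz hg' hh h1 (by rw [hV.side_add, hfh]) h2 hsh.le h3
      (orient_exit_pos hc hr hsr hfh hsh hz).le
  · obtain ⟨j, h1, h2, ⟨g', hg', h3, h4, h5⟩, h6⟩ := exists_transition hfm.le hPb hP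
    have hs := hV.right_vertex hc (j := j + 1) (by omega) (by omega)
    refine ⟨j, h1, h2.le, ?_⟩
    refine hV.ratioMax_eq_of_exit hr hsr hz hg' (hV.vertex_mem (j + 1)) h3 (by simp) h4 hs h5 ?_
    by_contra! hcon
    exact h6 ⟨V (j + 1), hV.vertex_mem _, by simp, hs, hcon.le⟩

/-! ### Uniqueness of the limit point on each side -/

/-- Along the vertices to the left of `pq`, the ratio of the distances of `p` and `q` to the side
lines decreases. -/
theorem side_ratio_strictAnti (hV : CyclicPolygon m V) (hc : Crossing m V p q f b)
    (hq : q ∈ openBody V) {i j : ℕ} (hi : f ≤ i) (hij : i < j) (hj : j ≤ b) :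
    side V j p / side V j q < side V i p / side V i q := by
  have step : ∀ k, f ≤ k → k < b →
      side V (k + 1) p / side V (k + 1) q < side V k p / side V k q := by
    intro k h1 h2
    rw [div_lt_div_iff₀ (hq _) (hq _)]
    have e := side_mul_side_sub V k p q
    rw [orient_rotate (V (k + 1)) p q |>.symm] at e
    have := mul_pos (hV.turn_pos k) (hV.left_vertex hc (j := k + 1) (by omega) h2)
    linarith
  induction j, hij using Nat.le_induction with
  | base => exact step i hi (by omega)
  | succ n hn ih => exact (step n (by omega) (by omega)).trans (ih (by omega))

/-- The Plücker relation of consecutive sides again; its sign is reversed because the vertices are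
now on the right of `pq`, and equality can occur at a vertex on `pq`. -/
theorem side_ratio_mono (hV : CyclicPolygon m V) (hc : Crossing m V p q f b)
    (hq : q ∈ openBody V) {i j : ℕ} (hi : b ≤ i) (hij : i ≤ j)
    (hj : j ≤ f + m) : side V i p / side V i q ≤ side V j p / side V j q := by
  induction j, hij using Nat.le_induction with
  | base => exact le_rfl
  | succ n hn ih =>
    refine (ih (by omega)).trans ?_
    rw [div_le_div_iff₀ (hq _) (hq _)]
    have e := side_mul_side_sub V n p q
    rw [orient_rotate (V (n + 1)) p q |>.symm] at e
    have := mul_nonpos_of_nonneg_of_nonpos (hV.turn_pos n).le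
      (hV.right_vertex hc (j := n + 1) (by omega) hj)
    linarith

/-- The ratio `side t y / side t x` increases from one side to the next by the Plücker relation. The
product form permits `x` to lie on the two extreme sides; the steps in between are chained by
cancelling positive values. -/
theorem side_mul_side_le (hV : CyclicPolygon m V) {x y : Plane} (hx : x ∈ body V) {j k : ℕ}
    (hjk : j < k) (hpos : ∀ t, j < t → t < k → 0 < side V t x)
    (h : ∀ c, j < c → c ≤ k → 0 ≤ orient (V c) x y) :
    side V j y * side V k x ≤ side V j x * side V k y := by
  induction k, hjk using Nat.le_induction with
  | base =>
    have e := side_mul_side_sub V j x y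
    have := mul_nonneg (hV.turn_pos j).le (h (j + 1) (by omega) le_rfl)
    simp only [Nat.succ_eq_add_one]
    linarith
  | succ k hk ih =>
    have h1 := ih (fun t h1 h2 => hpos t h1 (by omega)) fun c h1 h2 => h c h1 (by omega)
    have e := side_mul_side_sub V k x y
    have h2 := mul_nonneg (hV.turn_pos k).le (h (k + 1) (by omega) le_rfl)
    have hk0 := hpos k (by omega) (by omega)
    have hj0 := hx j
    have hk1 := hx (k + 1)
    refine le_of_mul_le_mul_left ?_ hk0
    calc side V k x * (side V j y * side V (k + 1) x)
        = side V j y * side V k x * side V (k + 1) x := by ring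
      _ ≤ side V j x * side V k y * side V (k + 1) x := mul_le_mul_of_nonneg_right h1 hk1
      _ = side V j x * (side V k y * side V (k + 1) x) := by ring
      _ ≤ side V j x * (side V k x * side V (k + 1) y) :=
        mul_le_mul_of_nonneg_left (by linarith) hj0
      _ = _ := by ring

theorem side_mul_side_lt (hV : CyclicPolygon m V) {x y : Plane} (hx : x ∈ body V) {j k : ℕ}
    (hjk : j < k) (hpos : ∀ t, j < t → t ≤ k → 0 < side V t x)
    (h : ∀ c, j < c → c ≤ k → 0 < orient (V c) x y) :
    side V j y * side V k x < side V j x * side V k y := by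
  induction k, hjk using Nat.le_induction with
  | base =>
    have e := side_mul_side_sub V j x y
    have := mul_pos (hV.turn_pos j) (h (j + 1) (by omega) le_rfl)
    simp only [Nat.succ_eq_add_one]
    linarith
  | succ k hk ih =>
    have h1 := ih (fun t h1 h2 => hpos t h1 (by omega)) fun c h1 h2 => h c h1 (by omega)
    have e := side_mul_side_sub V k x y
    have h2 := mul_pos (hV.turn_pos k) (h (k + 1) (by omega) le_rfl)
    have hk0 := hpos k (by omega) (by omega)
    have hj0 := hx j
    have hk1 := hpos (k + 1) (by omega) le_rfl
    refine lt_of_mul_lt_mul_left ?_ hk0.le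
    calc side V k x * (side V j y * side V (k + 1) x)
        = side V j y * side V k x * side V (k + 1) x := by ring
      _ < side V j x * side V k y * side V (k + 1) x := mul_lt_mul_of_pos_right h1 hk1
      _ = side V j x * (side V k y * side V (k + 1) x) := by ring
      _ ≤ side V j x * (side V k x * side V (k + 1) y) :=
        mul_le_mul_of_nonneg_left (by linarith) hj0
      _ = _ := by ring

/-- A boundary point on a side line lies on the side. -/
theorem exists_lineMap_of_side (hV : CyclicPolygon m V) {z : Plane} (hz : z ∈ body V) {i : ℕ}
    (hi : side V i z = 0) :
    ∃ t : ℝ, 0 ≤ t ∧ t ≤ 1 ∧ z = AffineMap.lineMap (V i) (V (i + 1)) t := by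
  have h3 := hV.three_le
  have hD := hV.turn_pos i
  set D := orient (V i) (V (i + 1)) (V (i + 2)) with hDdef
  -- The parameter is read off from the next side, which vanishes at `V (i + 1)` and equals `D` at
  -- `V i`. That side bounds the parameter above by `1`, and the preceding side `i + m - 1` bounds
  -- it below by `0`.
  have e : z = AffineMap.lineMap (V i) (V (i + 1)) (1 - side V (i + 1) z / D) := by
    have h := turn_mul_sub V i (V (i + 1)) z
    rw [hi, side_right, side_left, ← hDdef] at h
    apply plane_ext <;> rw [lineMap_coord]
    · have := h 0
      field_simp
      linarith
    · have := h 1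
      field_simp
      linarith
  refine ⟨_, ?_, ?_, e⟩
  · have h1 := hz (i + m - 1)
    rw [e, side_lineMap] at h1
    have h2 : V (i + m - 1 + 1) = V i := by
      rw [show i + m - 1 + 1 = i + m by omega, hV.periodic]
    have h4 : side V (i + m - 1) (V i) = 0 := by
      rw [← h2, side_right]
    have h5 : 0 < side V (i + m - 1) (V (i + 1)) := by
      rw [← hV.periodic (i + 1)]
      exact hV.side_vertex_pos (by omega) (by omega)
    rw [h4, mul_zero, zero_add] at h1
    exact nonneg_of_mul_nonneg_left h1 h5
  · have := div_nonneg (hz (i + 1)) hD.le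
    linarith

/-- Boundary points to the left of `pq` lie on the sides `f, …, b`. -/
theorem exists_left_side (hV : CyclicPolygon m V) (hc : Crossing m V p q f b) {z : Plane}
    (hz : z ∈ body V) (hs : 0 < orient p q z) {i : ℕ} (hi : side V i z = 0) :
    ∃ i', f ≤ i' ∧ i' ≤ b ∧ i' % m = i % m ∧ (∀ w, side V i' w = side V i w) ∧
      ∃ t : ℝ, 0 ≤ t ∧ t ≤ 1 ∧ z = AffineMap.lineMap (V i') (V (i' + 1)) t := by
  obtain ⟨i', h1, h2, -, h4, h5⟩ := hV.exists_index f i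
  obtain ⟨t, ht0, ht1, ht⟩ := hV.exists_lineMap_of_side hz (i := i') (by rw [h4, hi])
  refine ⟨i', h1, ?_, h5, h4, t, ht0, ht1, ht⟩
  by_contra! hb
  rw [ht, orient_lineMap] at hs
  have a1 := hV.right_vertex hc hb (by omega)
  have a2 := hV.right_vertex hc (j := i' + 1) (by omega) (by omega)
  nlinarith

theorem side_pos_of_right (hV : CyclicPolygon m V) (hc : Crossing m V p q f b) {z : Plane}
    (hz : z ∈ body V) (hs : 0 < orient p q z) {i : ℕ} (h1 : b < i) (h2 : i < f + m) :
    0 < side V i z := by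
  refine (hz i).lt_of_ne' fun hi => ?_
  obtain ⟨t, ht0, ht1, ht⟩ := hV.exists_lineMap_of_side hz hi
  rw [ht, orient_lineMap] at hs
  have a1 := hV.right_vertex hc h1 h2.le
  have a2 := hV.right_vertex hc (j := i + 1) (by omega) (by omega)
  nlinarith

theorem orient_of_same_side (V : ℕ → Plane) (i : ℕ) (u : Plane) (s t : ℝ) :
    orient u (AffineMap.lineMap (V i) (V (i + 1)) s) (AffineMap.lineMap (V i) (V (i + 1)) t) =
      (t - s) * side V i u := by
  simp only [side, orient, lineMap_coord]; ring

/-- The boundary points to the left of `pq` are ordered counterclockwise. -/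
theorem orient_left_nonneg (hV : CyclicPolygon m V) {i j c : ℕ} {s t : ℝ}
    (hs0 : 0 ≤ s) (hs1 : s ≤ 1) (ht0 : 0 ≤ t) (ht1 : t ≤ 1) (hij : i + s ≤ j + t) (hj : j < c)
    (hc : c ≤ i + m) :
    0 ≤ orient (V c) (AffineMap.lineMap (V i) (V (i + 1)) s)
      (AffineMap.lineMap (V j) (V (j + 1)) t) := by
  rcases lt_trichotomy i j with h | rfl | h
  · have hw : ∀ a e, i ≤ a → a ≤ i + 1 → j ≤ e → e ≤ j + 1 →
        0 ≤ orient (V c) (V a) (V e) := by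
      intro a e h1 h2 h3 h4
      rw [← orient_rotate]
      exact hV.orient_nonneg (by omega) (by omega) (by omega)
    have e : orient (V c) (AffineMap.lineMap (V i) (V (i + 1)) s)
        (AffineMap.lineMap (V j) (V (j + 1)) t) =
        (1 - s) * (1 - t) * orient (V c) (V i) (V j) +
        (1 - s) * t * orient (V c) (V i) (V (j + 1)) +
        s * (1 - t) * orient (V c) (V (i + 1)) (V j) +
        s * t * orient (V c) (V (i + 1)) (V (j + 1)) := by
      simp only [orient, lineMap_coord]; ring
    rw [e]
    have := hw i j (by omega) (by omega) (by omega) (by omega)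
    have := hw i (j + 1) (by omega) (by omega) (by omega) (by omega)
    have := hw (i + 1) j (by omega) (by omega) (by omega) (by omega)
    have := hw (i + 1) (j + 1) (by omega) (by omega) (by omega) (by omega)
    have : 0 ≤ 1 - s := by linarith
    have : 0 ≤ 1 - t := by linarith
    positivity
  · rw [orient_of_same_side]
    exact mul_nonneg (by linarith) (hV.vertex_mem c i)
  · have h1 : (j : ℝ) + 1 ≤ i := by exact_mod_cast h
    have hs : s = 0 := by linarith
    have ht : t = 1 := by linarith
    have hji : j + 1 = i := by
      have : (j : ℝ) + 1 = i := by linarith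
      exact_mod_cast this
    rw [hs, ht, AffineMap.lineMap_apply_zero, AffineMap.lineMap_apply_one, hji]
    simp

/-- The boundary comparison changes its sign at most once along the left part of the boundary. -/
theorem not_balance_nonpos_nonneg (hV : CyclicPolygon m V) (hc : Crossing m V p q f b)
    (hp : p ∈ openBody V) (hq : q ∈ openBody V)
    (hinj : ∀ i j, side V i p * side V j q = side V j p * side V i q → i % m = j % m)
    {x y : Plane} (hx : x ∈ body V) (hy : y ∈ body V) (hsx : 0 < orient p q x)
    (hsy : 0 < orient p q y) {i j : ℕ} {s t : ℝ} (hs0 : 0 ≤ s) (hs1 : s ≤ 1) (ht0 : 0 ≤ t)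
    (ht1 : t ≤ 1) (hfi : f ≤ i) (hjb : j ≤ b)
    (hxe : x = AffineMap.lineMap (V i) (V (i + 1)) s)
    (hye : y = AffineMap.lineMap (V j) (V (j + 1)) t) (hlt : i + s < j + t)
    (hTx : balance m V p q i x ≤ 0) : balance m V p q j y < 0 := by
  by_contra! hTy
  have hij : i ≤ j := by
    by_contra! h
    have h1 : (j : ℝ) + 1 ≤ i := by exact_mod_cast h
    linarith
  have hfb := hc.lt
  have hfm := hc.lt_add
  obtain ⟨k, hk1, hk2, hk⟩ := hV.exists_exit hc hp (orient_self_left p q) hsy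
  obtain ⟨l, hl1, hl2, hl⟩ := hV.exists_exit hc hq (orient_self_right p q) hsx
  have hky := hV.side_pos_of_ratioMax_eq hp hk
  have hlx := hV.side_pos_of_ratioMax_eq hq hl
  have hpk := hp k
  have hqk := hq k
  have hpl := hp l
  have hql := hq l
  have hpi := hp i
  have hqi := hq i
  have hpj := hp j
  have hqj := hq j
  have hxk := hV.le_ratioMax k x p
  have hxl := hV.le_ratioMax l x p
  have hyl := hV.le_ratioMax l y q
  have hyk := hV.le_ratioMax k y q
  have hMx := hV.ratioMax_pos x hp
  have hMx' := hV.ratioMax_pos x hq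
  have hMy := hV.ratioMax_pos y hp
  have hMy' := hV.ratioMax_pos y hq
  have hori : ∀ c, b < c → c ≤ f + m → 0 ≤ orient (V c) x y := by
    intro c h1 h2
    rw [hxe, hye]
    exact hV.orient_left_nonneg hs0 hs1 ht0 ht1 hlt.le (by omega) (by omega)
  unfold balance at hTx hTy
  -- the comparison of the far ends is monotone
  have mono : ratioMax m V y p * ratioMax m V x q ≤ ratioMax m V x p * ratioMax m V y q ∧
      (i = j → ratioMax m V y p * ratioMax m V x q < ratioMax m V x p * ratioMax m V y q) := by
    -- The exit sides `k` (of `y` through `p`) and `l` (of `x` through `q`) serve as lower bounds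
    -- for the other two maxima, matched so that only one factor has to be compared: the values at
    -- `x` and `y` if `k < l`, the values at `p` and `q` otherwise.
    rcases lt_or_ge k l with hkl | hlk
    · have hyl0 := hy l
      have hxk0 := hx k
      have hlow : side V k x / side V k p * (side V l y / side V l q) ≤
          ratioMax m V x p * ratioMax m V y q := by
        gcongr
      have hle := hV.side_mul_side_le hx hkl
        (fun c h1 h2 => hV.side_pos_of_right hc hx hsx (by omega) (by omega))
        (fun c h1 h2 => hori c (by omega) (by omega))
      refine ⟨le_trans ?_ hlow, fun e => lt_of_lt_of_le ?_ hlow⟩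
      · rw [hk, hl, div_mul_div_comm, div_mul_div_comm]
        gcongr
      · subst e
        have hst : 0 < t - s := by linarith
        have hltt := hV.side_mul_side_lt (y := y) hx hkl (fun c h1 h2 => by
          rcases h2.eq_or_lt with rfl | h2
          · exact hlx
          · exact hV.side_pos_of_right hc hx hsx (by omega) (by omega)) (fun c h1 h2 => by
          rw [hxe, hye, orient_of_same_side]
          refine mul_pos hst ?_
          -- A vertex `c` on the side `i` itself would force an exit side equal to `i`, although an
          -- exit side never contains the starting point.
          by_cases h3 : i + 1 = c
          · have : k = i := by omega
            rw [this, hye, side_lineMap] at hky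
            simp at hky
          by_cases h4 : c = i + m
          · have : l = i + m := by omega
            rw [this, hV.side_add, hxe, side_lineMap] at hlx
            simp at hlx
          exact hV.side_vertex_pos (by omega) (by omega))
        rw [hk, hl, div_mul_div_comm, div_mul_div_comm]
        gcongr
    · have hlow : side V l x / side V l p * (side V k y / side V k q) ≤
          ratioMax m V x p * ratioMax m V y q := by
        gcongr
      have hR := hV.side_ratio_mono (p := p) hc hq hl1 hlk hk2
      rw [div_le_div_iff₀ hql hqk] at hR
      have hxy := mul_pos hlx hky
      have e1 : ratioMax m V y p * ratioMax m V x q =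
          side V l x * side V k y / (side V k p * side V l q) := by
        rw [hk, hl]; field_simp
      have e2 : side V l x / side V l p * (side V k y / side V k q) =
          side V l x * side V k y / (side V l p * side V k q) := by
        field_simp
      refine ⟨le_trans ?_ hlow, fun e => ?_⟩
      · rw [e1, e2]
        gcongr
      · rcases hR.eq_or_lt with hR | hR
        · -- both far ends lie on one side line
          exfalso
          subst e
          have hmod := hinj l k hR
          have hsk : ∀ w, side V l w = side V k w := by
            intro w
            rw [← hV.side_mod l, hmod, hV.side_mod]
          have a1 : side V l x * side V l q ≤ ratioMax m V x p * side V l p * side V l q := by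
            have := (div_le_iff₀ hpl).1 hxl
            gcongr
          have a2 := (div_le_iff₀ hqk).1 hyk
          rw [eq_div_iff hql.ne'] at hl
          rw [eq_div_iff hpk.ne'] at hk
          rw [← hk] at a2
          rw [← hl] at hxl
          -- `R i ≤ R l` and `R k ≤ R i`
          have b1 : side V i p * side V l q ≤ side V l p * side V i q := by
            have h1 : side V i p * ratioMax m V x p ≤ side V i q * ratioMax m V x q := by linarith
            have h2 : ratioMax m V x q * side V l q ≤ ratioMax m V x p * side V l p :=
              (div_le_iff₀ hpl).1 hxl
            have h3 : side V i p * side V l q * ratioMax m V x p ≤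
                side V l p * side V i q * ratioMax m V x p := by
              calc _ = side V i p * ratioMax m V x p * side V l q := by ring
                _ ≤ side V i q * ratioMax m V x q * side V l q := by gcongr
                _ = side V i q * (ratioMax m V x q * side V l q) := by ring
                _ ≤ side V i q * (ratioMax m V x p * side V l p) := by gcongr
                _ = _ := by ring
            exact le_of_mul_le_mul_right h3 hMx
          have b2 : side V l p * side V i q ≤ side V i p * side V l q := by
            have h1 : side V i q * ratioMax m V y q ≤ side V i p * ratioMax m V y p := by linarith
            rw [hsk p, hsk q]
            have h3 : side V k p * side V i q * ratioMax m V y p ≤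
                side V i p * side V k q * ratioMax m V y p := by
              calc _ = side V i q * (ratioMax m V y p * side V k p) := by ring
                _ ≤ side V i q * (ratioMax m V y q * side V k q) := by gcongr
                _ = side V i q * ratioMax m V y q * side V k q := by ring
                _ ≤ side V i p * ratioMax m V y p * side V k q := by gcongr
                _ = _ := by ring
            exact le_of_mul_le_mul_right h3 hMy
          have hil := hinj i l (le_antisymm b1 b2)
          rw [← hV.side_mod, ← hil, hV.side_mod, hxe, side_lineMap] at hlx
          simp at hlx
        · refine lt_of_lt_of_le ?_ hlow
          rw [e1, e2]
          gcongr
  have h1 : side V i p * ratioMax m V x p ≤ side V i q * ratioMax m V x q := by linarith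
  have h2 : side V j q * ratioMax m V y q ≤ side V j p * ratioMax m V y p := by linarith
  have h3 : side V i p * side V j q * (ratioMax m V x p * ratioMax m V y q) ≤
      side V j p * side V i q * (ratioMax m V y p * ratioMax m V x q) := by
    calc _ = (side V i p * ratioMax m V x p) * (side V j q * ratioMax m V y q) := by ring
      _ ≤ (side V i q * ratioMax m V x q) * (side V j p * ratioMax m V y p) := by gcongr
      _ = _ := by ring
  have hA := mul_pos hMy hMx'
  have hB := mul_pos hMx hMy'
  -- On one side the strictness comes from the far ends, between different sides from the ratios
  -- `side i p / side i q`.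
  rcases hij.eq_or_lt with e | hij
  · have h4 := mono.2 e
    subst e
    have := mul_lt_mul_of_pos_left h4 (mul_pos hpi hqi)
    linarith
  · have hR := hV.side_ratio_strictAnti hc hq hfi hij hjb
    rw [div_lt_div_iff₀ hqj hqi] at hR
    have h5 := mul_lt_mul_of_pos_right hR hA
    have h6 := mul_le_mul_of_nonneg_left mono.1 (mul_pos hpi hqj).le
    linarith

end CyclicPolygon

end HilbertPlane

/-! ### Positions along the left boundary and the number of limit points. -/

namespace HilbertPlane

namespace CyclicPolygon

variable {m : ℕ} {V : ℕ → Plane} {p q r : Plane} {f b : ℕ}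

/-- Two different sides share at most a vertex. For consecutive sides this is position `i + 1` for
both; the wrap-around vertex `V f`, shared by the sides `f` and `f + m - 1`, is not strictly left of
`pq`. -/
theorem position_unique_of_lt (hV : CyclicPolygon m V) (hc : Crossing m V p q f b) {x : Plane}
    (hsx : 0 < orient p q x) {i j : ℕ} {s t : ℝ} (hs0 : 0 ≤ s) (hs1 : s ≤ 1)
    (hfi : f ≤ i) (hij : i < j) (hjb : j ≤ b)
    (hxi : x = AffineMap.lineMap (V i) (V (i + 1)) s)
    (hxj : x = AffineMap.lineMap (V j) (V (j + 1)) t) : (i : ℝ) + s = j + t := by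
  have hfm := hc.lt_add
  have h3 := hV.three_le
  have h0 : side V j x = 0 := by rw [hxj, side_lineMap]; simp
  rw [hxi, side_lineMap] at h0
  have hji := hV.vertex_mem i j
  have hji1 := hV.vertex_mem (i + 1) j
  by_cases h1 : j = i + 1
  · subst h1
    have hpos : 0 < side V (i + 1) (V i) := by
      rw [← hV.periodic i]
      exact hV.side_vertex_pos (by omega) (by omega)
    simp only [side_left, mul_zero, add_zero, mul_eq_zero, hpos.ne', or_false] at h0
    have hs : s = 1 := by linarith
    rw [hs, AffineMap.lineMap_apply_one] at hxi
    have hturn : 0 < side V (i + 1 + 1) (V (i + 1)) := by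
      rw [← hV.periodic (i + 1)]
      exact hV.side_vertex_pos (by omega) (by omega)
    have h2 : side V (i + 1 + 1) x = (1 - t) * side V (i + 1 + 1) (V (i + 1)) := by
      rw [hxj, side_lineMap]; simp
    rw [hxi] at h2
    have ht : t = 0 := by nlinarith
    rw [hs, ht]
    push_cast
    ring
  · have hpos : 0 < side V j (V (i + 1)) := by
      rw [← hV.periodic (i + 1)]
      exact hV.side_vertex_pos (by omega) (by omega)
    have h4 : 0 ≤ (1 - s) * side V j (V i) := mul_nonneg (by linarith) hji
    have h5 : 0 ≤ s * side V j (V (i + 1)) := mul_nonneg hs0 hji1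
    have hs : s = 0 := by
      have : s * side V j (V (i + 1)) = 0 := by linarith
      simpa [hpos.ne'] using this
    rw [hs] at h0 hxi
    rw [AffineMap.lineMap_apply_zero] at hxi
    by_cases h6 : i + m = j + 1
    · have : i = f := by omega
      rw [hxi, this] at hsx
      linarith [hc.start_nonpos]
    · have hpos' : 0 < side V j (V i) := by
        rw [← hV.periodic i]
        exact hV.side_vertex_pos (by omega) (by omega)
      simp only [sub_zero, one_mul, zero_mul, add_zero] at h0
      linarith

/-- The position of a boundary point to the left of `pq` does not depend on the side chosen. -/
theorem position_unique (hV : CyclicPolygon m V) (hc : Crossing m V p q f b) {x : Plane}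
    (hsx : 0 < orient p q x) {i j : ℕ} {s t : ℝ} (hs0 : 0 ≤ s) (hs1 : s ≤ 1) (ht0 : 0 ≤ t)
    (ht1 : t ≤ 1) (hfi : f ≤ i) (hib : i ≤ b) (hfj : f ≤ j) (hjb : j ≤ b)
    (hxi : x = AffineMap.lineMap (V i) (V (i + 1)) s)
    (hxj : x = AffineMap.lineMap (V j) (V (j + 1)) t) : (i : ℝ) + s = j + t := by
  rcases lt_trichotomy i j with h | rfl | h
  · exact hV.position_unique_of_lt hc hsx hs0 hs1 hfi h hjb hxi hxj
  · have h3 := hV.three_le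
    have hpos : 0 < side V (i + 1) (V i) := by
      rw [← hV.periodic i]
      exact hV.side_vertex_pos (by omega) (by omega)
    have h1 : side V (i + 1) x = (1 - s) * side V (i + 1) (V i) := by
      rw [hxi, side_lineMap]; simp
    have h2 : side V (i + 1) x = (1 - t) * side V (i + 1) (V i) := by
      rw [hxj, side_lineMap]; simp
    have : (1 - s) = 1 - t := mul_right_cancel₀ hpos.ne' (h1.symm.trans h2)
    linarith
  · exact (hV.position_unique_of_lt hc hsx ht0 ht1 hfj h hib hxj hxi).symm

/-- If no two side lines are concurrent with `pq`, then the bisector has at most one limit point on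
the left of `pq`. -/
theorem eq_of_mem_bisectorEnds (hV : CyclicPolygon m V) (hc : Crossing m V p q f b)
    (hp : p ∈ openBody V) (hq : q ∈ openBody V)
    (hinj : ∀ i j, side V i p * side V j q = side V j p * side V i q → i % m = j % m)
    {x y : Plane} (hx : x ∈ bisectorEnds (body V) p q) (hy : y ∈ bisectorEnds (body V) p q)
    (hsx : 0 < orient p q x) (hsy : 0 < orient p q y) : x = y := by
  have hmem : ∀ z ∈ bisectorEnds (body V) p q, z ∈ body V := by
    intro z hz
    have := hz.2
    rw [hV.frontier_body] at this
    exact this.1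
  have rep : ∀ z ∈ bisectorEnds (body V) p q, 0 < orient p q z → ∀ i, side V i z = 0 →
      ∃ i' : ℕ, ∃ t : ℝ, f ≤ i' ∧ i' ≤ b ∧ 0 ≤ t ∧ t ≤ 1 ∧
        z = AffineMap.lineMap (V i') (V (i' + 1)) t ∧
        balance m V p q i' z = balance m V p q i z := by
    intro z hz hs i hi
    obtain ⟨i', h1, h2, -, h4, t, h5, h6, h7⟩ := hV.exists_left_side hc (hmem z hz) hs hi
    exact ⟨i', t, h1, h2, h5, h6, h7, by simp only [balance, h4]⟩
  obtain ⟨i, hi, hTi⟩ := hV.exists_balance_nonpos hp hq hx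
  obtain ⟨i', s, a1, a2, a3, a4, a5, a6⟩ := rep x hx hsx i hi
  obtain ⟨j, hj, hTj⟩ := hV.exists_balance_nonneg hp hq hx
  obtain ⟨j', s', b1, b2, b3, b4, b5, b6⟩ := rep x hx hsx j hj
  obtain ⟨k, hk, hTk⟩ := hV.exists_balance_nonpos hp hq hy
  obtain ⟨k', t, c1, c2, c3, c4, c5, c6⟩ := rep y hy hsy k hk
  obtain ⟨l, hl, hTl⟩ := hV.exists_balance_nonneg hp hq hy
  obtain ⟨l', t', d1, d2, d3, d4, d5, d6⟩ := rep y hy hsy l hl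
  have e1 := hV.position_unique hc hsx a3 a4 b3 b4 a1 a2 b1 b2 a5 b5
  have e2 := hV.position_unique hc hsy c3 c4 d3 d4 c1 c2 d1 d2 c5 d5
  -- Each point has a side with nonpositive and a side with nonnegative comparison. Since a
  -- nonpositive one cannot be followed by a nonnegative one, neither point precedes the other.
  have n1 : (l' : ℝ) + t' ≤ i' + s := by
    by_contra! h
    have := hV.not_balance_nonpos_nonneg hc hp hq hinj (hmem x hx) (hmem y hy) hsx hsy a3 a4 d3 d4
      a1 d2 a5 d5 h (by rw [a6]; exact hTi)
    linarith
  have n2 : (j' : ℝ) + s' ≤ k' + t := by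
    by_contra! h
    have := hV.not_balance_nonpos_nonneg hc hp hq hinj (hmem y hy) (hmem x hx) hsy hsx c3 c4 b3 b4
      c1 b2 c5 b5 h (by rw [c6]; exact hTk)
    linarith
  have heq : (i' : ℝ) + s = k' + t := by linarith
  rcases lt_trichotomy i' k' with h | h | h
  · have h1 : (i' : ℝ) + 1 ≤ k' := by exact_mod_cast h
    have hs : s = 1 := by linarith
    have ht : t = 0 := by linarith
    have hk' : i' + 1 = k' := by
      have : (i' : ℝ) + 1 = k' := by linarith
      exact_mod_cast this
    rw [a5, c5, hs, ht, AffineMap.lineMap_apply_zero, AffineMap.lineMap_apply_one, hk']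
  · subst h
    rw [a5, c5, show s = t by linarith]
  · have h1 : (k' : ℝ) + 1 ≤ i' := by exact_mod_cast h
    have ht : t = 1 := by linarith
    have hs : s = 0 := by linarith
    have hk' : k' + 1 = i' := by
      have : (k' : ℝ) + 1 = i' := by linarith
      exact_mod_cast this
    rw [a5, c5, hs, ht, AffineMap.lineMap_apply_zero, AffineMap.lineMap_apply_one, hk']

/-- If no two side lines are concurrent with `pq`, then the bisector has at most two limit points
on the boundary. -/
theorem bisectorEnds_eq_pair (hV : CyclicPolygon m V) (hc : Crossing m V p q f b)
    (hc' : ∃ f' b', Crossing m V q p f' b') (hp : p ∈ openBody V) (hq : q ∈ openBody V)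
    (hpq : p ≠ q)
    (hinj : ∀ i j, side V i p * side V j q = side V j p * side V i q → i % m = j % m)
    {x y : Plane} (hx : x ∈ bisectorEnds (body V) p q) (hy : y ∈ bisectorEnds (body V) p q)
    (hsx : 0 < orient p q x) (hsy : orient p q y < 0) :
    bisectorEnds (body V) p q = {x, y} := by
  apply Set.Subset.antisymm
  · intro z hz
    rcases lt_trichotomy (orient p q z) 0 with h | h | h
    · right
      obtain ⟨f', b', hc'⟩ := hc'
      have hsw := bisectorEnds_swap (body V) p q
      refine hV.eq_of_mem_bisectorEnds hc' hq hp (fun i j h => hinj i j (by linarith))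
        (by rwa [hsw]) (by rwa [hsw]) ?_ ?_
      · rw [orient_swap]; linarith
      · rw [orient_swap]; linarith
    · exact absurd h (hV.orient_ne_zero_of_mem_bisectorEnds hp hq hpq hz)
    · left
      exact hV.eq_of_mem_bisectorEnds hc hp hq hinj hz hx h hsx
  · rintro z (rfl | rfl)
    · exact hx
    · exact hy

end CyclicPolygon

/-! ### Concurrent lines -/

theorem mem_line_of_orient_eq_zero {a b z : Plane} (hab : a ≠ b) (hz : orient a b z = 0) :
    z ∈ line[ℝ, a, b] := by
  obtain ⟨t, rfl⟩ := exists_lineMap_eq hab hz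
  exact AffineMap.lineMap_mem_affineSpan_pair t a b

theorem parallel_of_orient_eq {a b c d : Plane} (hab : a ≠ b) (hcd : c ≠ d)
    (h : orient a b c = orient a b d) : (line[ℝ, a, b]).Parallel line[ℝ, c, d] := by
  rw [AffineSubspace.affineSpan_pair_parallel_iff_vectorSpan_eq, vectorSpan_pair_rev,
    vectorSpan_pair_rev]
  obtain ⟨t, ht⟩ := exists_lineMap_eq (z := a + (d - c)) hab (by
    simp only [orient, PiLp.add_apply, PiLp.sub_apply] at h ⊢
    linarith)
  have e : d - c = t • (b - a) := by
    rw [AffineMap.lineMap_apply, vadd_eq_add, vsub_eq_sub, add_comm] at ht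
    exact add_right_cancel ht
  have ht0 : t ≠ 0 := by
    rintro rfl
    rw [zero_smul, sub_eq_zero] at e
    exact hcd e.symm
  rw [vsub_eq_sub, vsub_eq_sub, e]
  exact (Submodule.span_singleton_smul_eq (Ne.isUnit ht0) _).symm

/-- The quotient of the values of an affine function at `p` and `q` determines where its zero line
meets `pq`; quotient `1` means parallel. -/
theorem concurrent_of_side_ratio_eq {p q a b c d : Plane} (hpq : p ≠ q) (hab : a ≠ b) (hcd : c ≠ d)
    (haq : 0 < orient a b q)
    (h : orient a b p * orient c d q = orient c d p * orient a b q) :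
    Concurrent line[ℝ, p, q] line[ℝ, a, b] line[ℝ, c, d] := by
  by_cases h0 : orient a b p = orient a b q
  · right
    have h1 : orient c d p = orient c d q := by
      rw [h0, mul_comm] at h
      exact (mul_right_cancel₀ haq.ne' h).symm
    have h2 : (line[ℝ, p, q]).Parallel line[ℝ, a, b] := by
      apply parallel_of_orient_eq hpq hab
      simp only [orient] at h0 ⊢
      linarith
    have h3 : (line[ℝ, p, q]).Parallel line[ℝ, c, d] := by
      apply parallel_of_orient_eq hpq hcd
      simp only [orient] at h1 ⊢
      linarith
    exact ⟨h2, h2.symm.trans h3⟩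
  · left
    have hne : orient a b p - orient a b q ≠ 0 := sub_ne_zero.2 h0
    refine ⟨AffineMap.lineMap p q (orient a b p / (orient a b p - orient a b q)),
      AffineMap.lineMap_mem_affineSpan_pair _ _ _, mem_line_of_orient_eq_zero hab ?_,
      mem_line_of_orient_eq_zero hcd ?_⟩
    · rw [orient_lineMap]; field_simp; ring
    · rw [orient_lineMap]; field_simp; linarith

theorem side_ratio_injective {m : ℕ} {v : Fin m → Plane} (hv : IsConvexPolygon v) (hm : 0 < m)
    {p q : Plane} (hpq : p ≠ q) (hp : p ∈ openBody (cyclicExtension hm v))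
    (hq : q ∈ openBody (cyclicExtension hm v))
    (h : ∀ i j : Fin m, i ≠ j → ¬ Concurrent line[ℝ, p, q] (sideLine v i) (sideLine v j))
    (i j : ℕ) (hij : side (cyclicExtension hm v) i p * side (cyclicExtension hm v) j q =
      side (cyclicExtension hm v) j p * side (cyclicExtension hm v) i q) : i % m = j % m := by
  by_contra hne
  have hV := hv.cyclicPolygon hm
  have hline : ∀ k, sideLine v ⟨k % m, Nat.mod_lt k hm⟩ =
      line[ℝ, cyclicExtension hm v k, cyclicExtension hm v (k + 1)] := by
    intro k
    have : finRotate m ⟨k % m, Nat.mod_lt k hm⟩ = ⟨(k + 1) % m, Nat.mod_lt _ hm⟩ := by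
      obtain ⟨n, rfl⟩ : ∃ n, m = n + 1 := ⟨m - 1, by omega⟩
      rw [finRotate_apply]
      apply Fin.ext
      simp [Fin.val_add, Nat.add_mod]
    simp only [sideLine, cyclicExtension, this]
  have hvert : ∀ k, cyclicExtension hm v k ≠ cyclicExtension hm v (k + 1) := by
    intro k e
    have := hp k
    rw [side, ← e, orient_self] at this
    exact this.false
  apply h ⟨i % m, Nat.mod_lt i hm⟩ ⟨j % m, Nat.mod_lt j hm⟩ (by simpa [Fin.ext_iff] using hne)
  rw [hline, hline]
  exact concurrent_of_side_ratio_eq hpq (hvert i) (hvert j) (hq i) hij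

/-! ### Correctness of the searches -/

/-- Invariant of the search for the side through which the rays from the segment `[zl, zh]` through
`r` leave the polygon: the side is one of `lo, …, hi - 1`. -/
structure ExitBracket (V : ℕ → Plane) (p q r zl zh : Plane) (lo hi : ℕ) : Prop where
  lower : ∃ g ∈ body V, side V lo g = 0 ∧ orient p q g ≤ 0 ∧ orient zl r g ≤ 0 ∧ orient zh r g ≤ 0
  upper : ∃ g ∈ body V, side V (hi - 1) g = 0 ∧ orient p q g ≤ 0 ∧ 0 ≤ orient zl r g ∧
    0 ≤ orient zh r g

namespace ExitBracket

variable {m : ℕ} {V : ℕ → Plane} {p q r zl zh : Plane} {f b lo hi : ℕ}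

/-- The entry and exit points of `pq` bracket all rays from the left through `r`. The upper index is
`f + m + 1` because the last candidate, one below it, is the side `f` shifted by a period. -/
theorem init (hV : CyclicPolygon m V) (hc : Crossing m V p q f b) (hr : r ∈ openBody V)
    (hsr : orient p q r = 0) (hzl : 0 ≤ orient p q zl) (hzh : 0 ≤ orient p q zh) :
    ExitBracket V p q r zl zh b (f + m + 1) := by
  obtain ⟨g, hg, hbg, hsg⟩ := hV.exists_crossing_point (p := p) (q := q) (i := b)
    (mul_nonpos_of_nonneg_of_nonpos hc.end_pos.le hc.end_nonpos)
    (hc.end_nonpos.trans_lt hc.end_pos).ne'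
  obtain ⟨h, hh, hfh, hsh⟩ := hV.exists_crossing_point (p := p) (q := q) (i := f)
    (mul_nonpos_of_nonpos_of_nonneg hc.start_nonpos hc.start_pos.le)
    (hc.start_nonpos.trans_lt hc.start_pos).ne
  refine ⟨⟨g, hg, hbg, hsg.le, ?_, ?_⟩, ⟨h, hh, ?_, hsh.le, ?_, ?_⟩⟩
  · exact CyclicPolygon.orient_entry_nonpos hc hr hsr hbg hsg hzl
  · exact CyclicPolygon.orient_entry_nonpos hc hr hsr hbg hsg hzh
  · rw [Nat.add_sub_cancel, hV.side_add, hfh]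
  · exact CyclicPolygon.orient_exit_nonneg hc hr hsr hfh hsh hzl
  · exact CyclicPolygon.orient_exit_nonneg hc hr hsr hfh hsh hzh

theorem set_lower (h : ExitBracket V p q r zl zh lo hi) (hV : CyclicPolygon m V) {j : ℕ}
    (hj : orient p q (V j) ≤ 0) (h1 : orient zl r (V j) ≤ 0) (h2 : orient zh r (V j) ≤ 0) :
    ExitBracket V p q r zl zh j hi :=
  ⟨⟨V j, hV.vertex_mem j, side_left V j, hj, h1, h2⟩, h.upper⟩

theorem set_upper (h : ExitBracket V p q r zl zh lo hi) (hV : CyclicPolygon m V) {j : ℕ}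
    (hj0 : 0 < j) (hj : orient p q (V j) ≤ 0) (h1 : 0 ≤ orient zl r (V j))
    (h2 : 0 ≤ orient zh r (V j)) : ExitBracket V p q r zl zh lo j := by
  refine ⟨h.lower, V j, hV.vertex_mem j, ?_, hj, h1, h2⟩
  obtain ⟨k, rfl⟩ : ∃ k, j = k + 1 := ⟨j - 1, by omega⟩
  exact side_right V k

/-- The signed areas are affine in the starting point, so their signs persist on the segment. -/
theorem mono (h : ExitBracket V p q r zl zh lo hi) {s t : ℝ} (hs0 : 0 ≤ s) (hs1 : s ≤ 1)
    (ht0 : 0 ≤ t) (ht1 : t ≤ 1) :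
    ExitBracket V p q r (AffineMap.lineMap zl zh s) (AffineMap.lineMap zl zh t) lo hi := by
  obtain ⟨⟨g, h1, h2, h3, h4, h5⟩, ⟨g', k1, k2, k3, k4, k5⟩⟩ := h
  refine ⟨⟨g, h1, h2, h3, ?_, ?_⟩, ⟨g', k1, k2, k3, ?_, ?_⟩⟩ <;> rw [orient_lineMap_left] <;>
    nlinarith

/-- When the search has ended, the far end of the chords is known on the whole segment. -/
theorem ratioMax_eq (h : ExitBracket V p q r zl zh lo (lo + 1)) (hV : CyclicPolygon m V)
    (hr : r ∈ openBody V) (hsr : orient p q r = 0) (hzl : 0 ≤ orient p q zl)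
    (hzh : 0 ≤ orient p q zh) (hpos : 0 < orient p q zl + orient p q zh) {z : Plane}
    (hz : z ∈ segment ℝ zl zh) : ratioMax m V z r = side V lo z / side V lo r := by
  rw [segment_eq_image_lineMap] at hz
  obtain ⟨t, ht, rfl⟩ := hz
  -- An endpoint of the segment may lie on `pq`, where the ray argument fails. The formula is proved
  -- on the open segment and extended by continuity.
  have hopen : Set.EqOn (fun t : ℝ => ratioMax m V (AffineMap.lineMap zl zh t) r)
      (fun t : ℝ => side V lo (AffineMap.lineMap zl zh t) / side V lo r) (Set.Ioo 0 1) := by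
    intro t ht
    have hst : 0 < orient p q (AffineMap.lineMap zl zh t) := by
      rw [orient_lineMap]
      rcases hzl.eq_or_lt with h0 | h0
      · nlinarith [ht.1, ht.2]
      · nlinarith [ht.1, ht.2, mul_pos (sub_pos.2 ht.2) h0, mul_nonneg ht.1.le hzh]
    obtain ⟨⟨g, h1, h2, h3, h4, -⟩, ⟨g', k1, k2, k3, k4, -⟩⟩ :=
      h.mono ht.1.le ht.2.le ht.1.le ht.2.le
    exact hV.ratioMax_eq_of_exit hr hsr hst h1 k1 h2 k2 h3 k3 h4 k4
  have hcl := hopen.closure ((continuous_ratioMax m V r).comp AffineMap.lineMap_continuous)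
    (((continuous_side V lo).comp AffineMap.lineMap_continuous).div_const _)
  rw [closure_Ioo zero_ne_one] at hcl
  exact hcl ht

end ExitBracket

/-- Invariant of the search for a limit point on the side `i`: the boundary comparison changes its
sign on the segment `[zl, zh]`. -/
structure RootBracket (m : ℕ) (V : ℕ → Plane) (p q : Plane) (i : ℕ) (zl zh : Plane) : Prop where
  mem_left : zl ∈ body V
  mem_right : zh ∈ body V
  side_left : side V i zl = 0
  side_right : side V i zh = 0
  orient_left : 0 ≤ orient p q zl
  orient_right : 0 ≤ orient p q zh
  orient_pos : 0 < orient p q zl + orient p q zh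
  balance_left : 0 ≤ balance m V p q i zl
  balance_right : balance m V p q i zh ≤ 0

namespace RootBracket

variable {m : ℕ} {V : ℕ → Plane} {p q r zl zh : Plane} {i : ℕ}

theorem lineMap_mem (h : RootBracket m V p q i zl zh) {t : ℝ} (h0 : 0 < t) (h1 : t < 1) :
    AffineMap.lineMap zl zh t ∈ body V ∧ side V i (AffineMap.lineMap zl zh t) = 0 ∧
      0 < orient p q (AffineMap.lineMap zl zh t) := by
  refine ⟨lineMap_mem_body h.mem_left h.mem_right h0.le h1.le, ?_, ?_⟩
  · rw [side_lineMap, h.side_left, h.side_right]; ring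
  · rw [orient_lineMap]
    have := h.orient_pos
    have h2 := h.orient_right
    rcases h.orient_left.eq_or_lt with h3 | h3
    · nlinarith
    · nlinarith [mul_pos (sub_pos.2 h1) h3, mul_nonneg h0.le h2]

theorem shrink_left (h : RootBracket m V p q i zl zh) {t : ℝ} (h0 : 0 < t) (h1 : t < 1)
    (hT : 0 ≤ balance m V p q i (AffineMap.lineMap zl zh t)) :
    RootBracket m V p q i (AffineMap.lineMap zl zh t) zh := by
  obtain ⟨a, b, c⟩ := h.lineMap_mem h0 h1
  exact ⟨a, h.mem_right, b, h.side_right, c.le, h.orient_right, by linarith [h.orient_right], hT,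
    h.balance_right⟩

theorem shrink_right (h : RootBracket m V p q i zl zh) {t : ℝ} (h0 : 0 < t) (h1 : t < 1)
    (hT : balance m V p q i (AffineMap.lineMap zl zh t) ≤ 0) :
    RootBracket m V p q i zl (AffineMap.lineMap zl zh t) := by
  obtain ⟨a, b, c⟩ := h.lineMap_mem h0 h1
  exact ⟨h.mem_left, a, h.side_left, b, h.orient_left, c.le, by linarith [h.orient_left],
    h.balance_left, hT⟩

/-- Once the far ends of all chords are known, the limit point is the root of an affine function. -/
theorem solve (h : RootBracket m V p q i zl zh) (hV : CyclicPolygon m V) (hp : p ∈ openBody V)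
    (hq : q ∈ openBody V) (hpq : p ≠ q) {j k : ℕ}
    (hj : ∀ z ∈ segment ℝ zl zh, ratioMax m V z p = side V j z / side V j p)
    (hk : ∀ z ∈ segment ℝ zl zh, ratioMax m V z q = side V k z / side V k q)
    {F : Plane → ℝ} (hF : ∀ z, F z = side V i p * (side V j z / side V j p) -
      side V i q * (side V k z / side V k q)) :
    AffineMap.lineMap zl zh (F zl / (F zl - F zh)) ∈ bisectorEnds (body V) p q ∧
      0 < orient p q (AffineMap.lineMap zl zh (F zl / (F zl - F zh))) := by
  have hFT : ∀ z ∈ segment ℝ zl zh, F z = balance m V p q i z := by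
    intro z hz
    rw [hF, balance, hj z hz, hk z hz]
  have hl : 0 ≤ F zl := (hFT zl (left_mem_segment ℝ zl zh)).symm ▸ h.balance_left
  have hr : F zh ≤ 0 := (hFT zh (right_mem_segment ℝ zl zh)).symm ▸ h.balance_right
  set t := F zl / (F zl - F zh) with ht
  have ht0 : 0 ≤ t := div_nonneg hl (by linarith)
  have ht1 : t ≤ 1 := div_le_one_of_le₀ (by linarith) (by linarith)
  set z : Plane := AffineMap.lineMap zl zh t with hz
  have hzs : z ∈ segment ℝ zl zh := by
    rw [segment_eq_image_lineMap]
    exact ⟨t, ⟨ht0, ht1⟩, rfl⟩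
  have hFz : F z = 0 := by
    have e : F z = (1 - t) * F zl + t * F zh := by
      rw [hF, hF, hF, hz, side_lineMap, side_lineMap]; ring
    rw [e]
    -- If the denominator vanishes, both values do, and the parameter `0` given by division by zero
    -- still yields a root.
    by_cases h0 : F zl - F zh = 0
    · rw [show F zl = 0 by linarith, show F zh = 0 by linarith]; ring
    · rw [ht]; field_simp; ring
  have hzb : z ∈ body V := lineMap_mem_body h.mem_left h.mem_right ht0 ht1
  have hzi : side V i z = 0 := by
    rw [hz, side_lineMap, h.side_left, h.side_right]; ring
  have hT : balance m V p q i z = 0 := by rw [← hFT z hzs, hFz]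
  refine ⟨hV.mem_bisectorEnds hp hq hzb hzi hzi hT.ge hT.le, ?_⟩
  have hs0 : 0 ≤ orient p q z := by
    rw [hz, orient_lineMap]
    have := h.orient_left
    have := h.orient_right
    have : 0 ≤ 1 - t := by linarith
    positivity
  exact hs0.lt_of_ne' fun hs => hV.balance_ne_zero_of_line hp hq hpq hs hzi hT

end RootBracket

/-- Among the end vertices of the search from `V 0`, one lies on the other side of `pq`. -/
theorem CyclicPolygon.exists_anchor {m : ℕ} {V : ℕ → Plane} {p q : Plane} (hV : CyclicPolygon m V)
    (hp : p ∈ openBody V) (hpq : p ≠ q) {c : ℕ}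
    (hc : orient (V 0) p (V c) < 0) (hc' : 0 ≤ orient (V 0) p (V (c + 1))) :
    ¬ (0 < orient p q (V c) ↔ 0 < orient p q (V 0)) ∨
    ¬ (0 < orient p q (V (c + 1)) ↔ 0 < orient p q (V 0)) ∨
    ¬ (0 < orient p q (V (m - 1)) ↔ 0 < orient p q (V 0)) := by
  by_contra! hcon
  obtain ⟨e1, e2, e3⟩ := hcon
  have hpc : 0 < orient (V c) (V (c + 1)) p := hp c
  have hlast : 0 < orient (V 0) p (V (m - 1)) := by
    have h := hp (m - 1)
    have h3 := hV.three_le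
    rw [side, show m - 1 + 1 = 0 + m by omega, hV.periodic, ← orient_rotate] at h
    exact h
  -- The barycentric relation of `p` with respect to `V 0, V c, V (c + 1)`, evaluated by `orient p
  -- q`, which vanishes at `p`.
  have key : orient (V c) (V (c + 1)) p * orient p q (V 0) +
      orient (V 0) p (V (c + 1)) * orient p q (V c) +
      -orient (V 0) p (V c) * orient p q (V (c + 1)) = 0 := by
    simp only [orient]; ring
  by_cases h0 : 0 < orient p q (V 0)
  · have k1 := e1.2 h0
    have k2 := e2.2 h0
    nlinarith [mul_pos hpc h0, mul_nonneg hc' k1.le, mul_pos (neg_pos.2 hc) k2]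
  · have k1 := not_lt.1 fun h => h0 (e1.1 h)
    have k2 := not_lt.1 fun h => h0 (e2.1 h)
    have k3 := not_lt.1 fun h => h0 (e3.1 h)
    have k0 := not_lt.1 h0
    -- The remaining case has `V 0` on the line `pq`. Then `V c` and `V (m - 1)` lie strictly on
    -- opposite sides of it, so one of them is on the left; this is why `V (m - 1)` is a third
    -- candidate.
    have z0 : orient p q (V 0) = 0 := by
      nlinarith [mul_nonneg hpc.le (neg_nonneg.2 k0), mul_nonneg hc' (neg_nonneg.2 k1),
        mul_nonneg (neg_pos.2 hc).le (neg_nonneg.2 k2)]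
    obtain ⟨t, ht⟩ := exists_lineMap_eq hpq z0
    have hor : ∀ w, orient (V 0) p w = -t * orient p q w := by
      intro w
      rw [ht]
      simp only [orient, lineMap_coord]; ring
    rw [hor] at hc hlast
    rcases lt_or_ge 0 t with h | h
    · nlinarith
    · nlinarith

end HilbertPlane

/-! ### Time-bounded program logic -/

namespace RealRAM

namespace Prog

/-- The time of a program whose loops run at most `L` times each. -/
def bound (L : ℕ) : Prog → ℕ
  | skip => 1
  | setI _ e => e.cost + 1
  | setR _ e => e.cost + 1
  | store a e => a.cost + e.cost + 1
  | seq c d => c.bound L + d.bound L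
  | ite b c d => b.cost + (c.bound L + d.bound L) + 1
  | loop b c => L * (b.cost + c.bound L + 1) + (b.cost + 1)

/-- The nesting depth of the loops. -/
def depth : Prog → ℕ
  | skip => 0
  | setI _ _ => 0
  | setR _ _ => 0
  | store _ _ => 0
  | seq c d => max c.depth d.depth
  | ite _ c d => max c.depth d.depth
  | loop _ c => c.depth + 1

/-- Each enclosing loop multiplies the cost by at most a constant times `L + 1`, so the nesting
depth is the exponent. -/
theorem exists_bound_le (c : Prog) : ∃ K, ∀ L, c.bound L ≤ K * (L + 1) ^ c.depth := by
  have key : ∀ (K L d e : ℕ), d ≤ e → K * (L + 1) ^ d ≤ K * (L + 1) ^ e := fun K L d e h =>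
    Nat.mul_le_mul_left _ (Nat.pow_le_pow_right (by omega) h)
  have one : ∀ L d : ℕ, 1 ≤ (L + 1) ^ d := fun L d => Nat.one_le_pow _ _ (by omega)
  induction c with
  | skip => exact ⟨1, fun L => by simp [bound, depth]⟩
  | setI i e => exact ⟨e.cost + 1, fun L => by simp [bound, depth]⟩
  | setR i e => exact ⟨e.cost + 1, fun L => by simp [bound, depth]⟩
  | store a e => exact ⟨a.cost + e.cost + 1, fun L => by simp [bound, depth]⟩
  | seq c d ihc ihd =>
    obtain ⟨K, hK⟩ := ihc
    obtain ⟨K', hK'⟩ := ihd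
    refine ⟨K + K', fun L => ?_⟩
    rw [bound, depth, add_mul]
    exact Nat.add_le_add ((hK L).trans (key _ _ _ _ (le_max_left _ _)))
      ((hK' L).trans (key _ _ _ _ (le_max_right _ _)))
  | ite b c d ihc ihd =>
    obtain ⟨K, hK⟩ := ihc
    obtain ⟨K', hK'⟩ := ihd
    refine ⟨K + K' + (b.cost + 1), fun L => ?_⟩
    rw [bound, depth, add_mul, add_mul]
    have h1 := (hK L).trans (key _ _ _ _ (le_max_left c.depth d.depth))
    have h2 := (hK' L).trans (key _ _ _ _ (le_max_right c.depth d.depth))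
    have h3 := Nat.mul_le_mul_left (b.cost + 1) (one L (max c.depth d.depth))
    omega
  | loop b c ih =>
    obtain ⟨K, hK⟩ := ih
    refine ⟨K + (b.cost + 1), fun L => ?_⟩
    rw [bound, depth]
    have h3 := Nat.mul_le_mul_left (b.cost + 1) (one L c.depth)
    calc L * (b.cost + c.bound L + 1) + (b.cost + 1)
        ≤ (L + 1) * (b.cost + c.bound L + 1) := by
          rw [add_mul, one_mul]; omega
      _ ≤ (L + 1) * ((K + (b.cost + 1)) * (L + 1) ^ c.depth) := by
          apply Nat.mul_le_mul_left
          rw [add_mul]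
          have := hK L
          omega
      _ = _ := by rw [pow_succ]; ring

end Prog

namespace State

/-- Assignment to an index register. -/
def setI (s : State) (i n : ℕ) : State := { s with idx := Function.update s.idx i n }

/-- Assignment to a real register. -/
def setR (s : State) (i : ℕ) (x : ℝ) : State := { s with reg := Function.update s.reg i x }

@[simp] theorem setI_idx (s : State) (i n j : ℕ) :
    (s.setI i n).idx j = if j = i then n else s.idx j := by
  simp [setI, Function.update_apply]

@[simp] theorem setI_mem (s : State) (i n : ℕ) : (s.setI i n).mem = s.mem := rfl

@[simp] theorem setR_reg (s : State) (i : ℕ) (x : ℝ) (j : ℕ) :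
    (s.setR i x).reg j = if j = i then x else s.reg j := by
  simp [setR, Function.update_apply]

@[simp] theorem setR_idx (s : State) (i : ℕ) (x : ℝ) : (s.setR i x).idx = s.idx := rfl

@[simp] theorem setR_mem (s : State) (i : ℕ) (x : ℝ) : (s.setR i x).mem = s.mem := rfl

end State

/-- `Ensures L c s Q`: started in `s`, the program `c` halts in a state with `Q`, within the time
allowed when each loop runs at most `L` times. -/
def Ensures (L : ℕ) (c : Prog) (s : State) (Q : State → Prop) : Prop :=
  ∃ t s', Exec c s t s' ∧ t ≤ c.bound L ∧ Q s'

namespace Ensures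

variable {L : ℕ} {c d : Prog} {s : State} {P Q : State → Prop}

theorem skip (h : Q s) : Ensures L .skip s Q := ⟨_, _, .skip s, le_rfl, h⟩

theorem setI {i : ℕ} {e : IExp} (h : Q (s.setI i (e.eval s))) : Ensures L (.setI i e) s Q :=
  ⟨_, _, .setI s i e, le_rfl, h⟩

theorem setR {i : ℕ} {e : RExp} (h : Q (s.setR i (e.eval s))) : Ensures L (.setR i e) s Q :=
  ⟨_, _, .setR s i e, le_rfl, h⟩

theorem seq (h : Ensures L c s fun s' => Ensures L d s' Q) : Ensures L (.seq c d) s Q := by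
  obtain ⟨t, s', h1, h2, t', s'', h3, h4, h5⟩ := h
  exact ⟨_, _, .seq h1 h3, Nat.add_le_add h2 h4, h5⟩

theorem ite {b : BExp} (h : b.Holds s → Ensures L c s Q) (h' : ¬ b.Holds s → Ensures L d s Q) :
    Ensures L (.ite b c d) s Q := by
  by_cases hb : b.Holds s
  · obtain ⟨t, s', h1, h2, h3⟩ := h hb
    exact ⟨_, _, .iteTrue hb h1, by simp only [Prog.bound]; omega, h3⟩
  · obtain ⟨t, s', h1, h2, h3⟩ := h' hb
    exact ⟨_, _, .iteFalse hb h1, by simp only [Prog.bound]; omega, h3⟩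

end Ensures

/-- The loop of a binary search between the index registers `lo` and `hi`. -/
def bisect (lo hi : ℕ) (c : Prog) : Prog := .loop (.ltI (.add (.var lo) (.lit 1)) (.var hi)) c

/-- Partial correctness is carried by the invariant `I`; the time bound needs only that one end
moves to the midpoint, so that a width of at most `2 ^ L` reaches `1` within `L` rounds. -/
theorem Ensures.bisect {L : ℕ} {lo hi : ℕ} {c : Prog} {s : State} {I Q : State → Prop} (hI : I s)
    (hL : s.idx hi - s.idx lo ≤ 2 ^ L) (hlt : ∀ s, I s → s.idx lo < s.idx hi)
    (step : ∀ s, I s → s.idx lo + 1 < s.idx hi → Ensures L c s fun s' => I s' ∧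
      (s'.idx lo = (s.idx lo + s.idx hi) / 2 ∧ s'.idx hi = s.idx hi ∨
        s'.idx lo = s.idx lo ∧ s'.idx hi = (s.idx lo + s.idx hi) / 2))
    (hQ : ∀ s, I s → s.idx hi = s.idx lo + 1 → Q s) :
    Ensures L (bisect lo hi c) s Q := by
  set b : BExp := .ltI (.add (.var lo) (.lit 1)) (.var hi) with hb
  have hold : ∀ s, b.Holds s ↔ s.idx lo + 1 < s.idx hi := fun s => Iff.rfl
  have key : ∀ n s, I s → s.idx hi - s.idx lo ≤ 2 ^ n → ∃ t s', Exec (.loop b c) s t s' ∧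
      t ≤ n * (b.cost + c.bound L + 1) + (b.cost + 1) ∧ I s' ∧ s'.idx hi = s'.idx lo + 1 := by
    intro n
    induction n with
    | zero =>
      intro s hI hn
      have := hlt s hI
      refine ⟨_, s, .loopFalse ?_, by omega, hI, by omega⟩
      rw [hold]; omega
    | succ n ih =>
      intro s hI hn
      by_cases h : b.Holds s
      · obtain ⟨t, s', h1, h2, h3, h4⟩ := step s hI ((hold s).1 h)
        obtain ⟨t', s'', k1, k2, k3⟩ := ih s' h3 (by rw [pow_succ] at hn; omega)
        refine ⟨_, s'', .loopTrue h h1 k1, ?_, k3⟩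
        rw [add_mul, one_mul]
        omega
      · have := hlt s hI
        refine ⟨_, s, .loopFalse h, by omega, hI, ?_⟩
        rw [hold] at h
        omega
  obtain ⟨t, s', h1, h2, h3, h4⟩ := key L s hI hL
  exact ⟨t, s', h1, h2, hQ s' h3 h4⟩

/-- The states agree on the memory, the index registers below `a` and the real registers
below `b`. -/
structure Agree (a b : ℕ) (s s' : State) : Prop where
  mem : s'.mem = s.mem
  idx : ∀ i < a, s'.idx i = s.idx i
  reg : ∀ i < b, s'.reg i = s.reg i

namespace Agree

variable {a b a' b' : ℕ} {s s' s'' : State}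

theorem refl (s : State) : Agree a b s s := ⟨rfl, fun _ _ => rfl, fun _ _ => rfl⟩

theorem trans (h : Agree a b s s') (h' : Agree a' b' s' s'') (ha : a ≤ a') (hb : b ≤ b') :
    Agree a b s s'' :=
  ⟨h'.mem.trans h.mem, fun i hi => (h'.idx i (by omega)).trans (h.idx i hi),
    fun i hi => (h'.reg i (by omega)).trans (h.reg i hi)⟩

theorem setI (h : Agree a b s s') {i n : ℕ} (hi : a ≤ i) : Agree a b s (s'.setI i n) :=
  ⟨h.mem, fun j hj => by rw [State.setI_idx, if_neg (by omega), h.idx j hj], h.reg⟩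

theorem setR (h : Agree a b s s') {i : ℕ} {x : ℝ} (hi : b ≤ i) : Agree a b s (s'.setR i x) :=
  ⟨h.mem, h.idx, fun j hj => by rw [State.setR_reg, if_neg (by omega), h.reg j hj]⟩

end Agree

end RealRAM

namespace HilbertPlane

open RealRAM

/-- The point stored in the real registers `x` and `x + 1`. -/
def pt (s : State) (x : ℕ) : Plane := !₂[s.reg x, s.reg (x + 1)]

@[simp] theorem pt_coord_zero (s : State) (x : ℕ) : pt s x 0 = s.reg x := rfl

@[simp] theorem pt_coord_one (s : State) (x : ℕ) : pt s x 1 = s.reg (x + 1) := rfl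

@[simp] theorem pt_setI (s : State) (i n x : ℕ) : pt (s.setI i n) x = pt s x := rfl

theorem pt_setR_of_ne (s : State) {i x : ℕ} (a : ℝ) (h : i ≠ x) (h' : i ≠ x + 1) :
    pt (s.setR i a) x = pt s x := by
  simp [pt, h.symm, h'.symm]

end HilbertPlane

/-- Storing a point in the real registers `x` and `x + 1`. -/
def RealRAM.State.setPt (s : RealRAM.State) (x : ℕ) (w : HilbertPlane.Plane) : RealRAM.State :=
  (s.setR x (w 0)).setR (x + 1) (w 1)

namespace HilbertPlane

open RealRAM

@[simp] theorem setPt_idx (s : State) (x : ℕ) (w : Plane) : (s.setPt x w).idx = s.idx := rfl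

@[simp] theorem pt_setPt_self (s : State) (x : ℕ) (w : Plane) : pt (s.setPt x w) x = w := by
  apply plane_ext <;> simp [State.setPt]

theorem setPt_reg_of_ne (s : State) {i x : ℕ} (w : Plane) (h : i ≠ x) (h' : i ≠ x + 1) :
    (s.setPt x w).reg i = s.reg i := by
  simp [State.setPt, h, h']

theorem pt_setPt_of_lt (s : State) {x y : ℕ} (w : Plane) (h : y + 1 < x ∨ x + 1 < y) :
    pt (s.setPt x w) y = pt s y := by
  apply plane_ext
  · exact setPt_reg_of_ne s w (by omega) (by omega)
  · exact setPt_reg_of_ne s w (by omega) (by omega)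

theorem _root_.RealRAM.Agree.setPt {a b : ℕ} {s s' : State} (h : Agree a b s s') {x : ℕ} {w : Plane}
    (hx : b ≤ x) : Agree a b s (s'.setPt x w) := (h.setR hx).setR (by omega)

theorem _root_.RealRAM.Agree.pt {a b : ℕ} {s s' : State} (h : Agree a b s s') {x : ℕ}
    (hx : x + 1 < b) : pt s' x = pt s x := by
  apply plane_ext
  · exact h.reg _ (by omega)
  · exact h.reg _ hx

/-! ### Geometric expressions and memory access -/

/-- The signed area of three stored points. -/
def orientE (a b c : ℕ) : RExp :=
  .sub (.mul (.sub (.var b) (.var a)) (.sub (.var (c + 1)) (.var (a + 1))))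
    (.mul (.sub (.var (b + 1)) (.var (a + 1))) (.sub (.var c) (.var a)))

@[simp] theorem orientE_eval (s : State) (a b c : ℕ) :
    (orientE a b c).eval s = orient (pt s a) (pt s b) (pt s c) := rfl

/-- Copies the point `y` to `x`. -/
def copyPt (x y : ℕ) : Prog := .seq (.setR x (.var y)) (.setR (x + 1) (.var (y + 1)))

theorem Ensures.copyPt {L : ℕ} {x y : ℕ} {s : State} {Q : State → Prop} (hxy : x ≠ y + 1)
    (h : Q (s.setPt x (pt s y))) : Ensures L (copyPt x y) s Q := by
  refine .seq (.setR (.setR ?_))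
  simpa [State.setPt, RExp.eval, hxy.symm] using h

/-- Stores in `x` the point with parameter `t` (a real register) on the line through `y`
and `z`. -/
def interpolate (x y z t : ℕ) : Prog :=
  .seq (.setR x (.add (.var y) (.mul (.var t) (.sub (.var z) (.var y)))))
    (.setR (x + 1) (.add (.var (y + 1)) (.mul (.var t) (.sub (.var (z + 1)) (.var (y + 1))))))

theorem Ensures.interpolate {L : ℕ} {x y z t : ℕ} {s : State} {Q : State → Prop} (hxy : x ≠ y + 1)
    (hxz : x ≠ z + 1) (hxt : x ≠ t)
    (h : Q (s.setPt x (AffineMap.lineMap (pt s y) (pt s z) (s.reg t)))) :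
    Ensures L (interpolate x y z t) s Q := by
  refine .seq (.setR (.setR ?_))
  simpa [State.setPt, RExp.eval, lineMap_coord, hxy.symm, hxz.symm, hxt.symm] using h

/-- The memory holds the vertices, index register `0` their number, and the real registers
`0, …, 3` the points `p` and `q`. -/
structure Layout (m : ℕ) (V : ℕ → Plane) (p q : Plane) (s : State) : Prop where
  size : s.idx 0 = m
  vertex : ∀ k < m, s.mem (2 * k) = V k 0 ∧ s.mem (2 * k + 1) = V k 1
  pt_zero : pt s 0 = p
  pt_two : pt s 2 = q

theorem Layout.of_agree {m : ℕ} {V : ℕ → Plane} {p q : Plane} {s s' : State} {a b : ℕ}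
    (h : Layout m V p q s) (h' : Agree a b s s') (ha : 1 ≤ a) (hb : 4 ≤ b) :
    Layout m V p q s' where
  size := by rw [h'.idx 0 ha, h.size]
  vertex := by rw [h'.mem]; exact h.vertex
  pt_zero := by rw [h'.pt (by omega), h.pt_zero]
  pt_two := by rw [h'.pt (by omega), h.pt_two]

/-- Loads the vertex whose index is in the register `j` (reduced modulo the number of vertices)
into the point `x`. -/
def loadV (j x : ℕ) : Prog :=
  .seq (.setI 16 (.var j)) <|
  .seq (.ite (.ltI (.var 16) (.var 0)) .skip (.setI 16 (.sub (.var 16) (.var 0)))) <|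
  .seq (.ite (.ltI (.var 16) (.var 0)) .skip (.setI 16 (.sub (.var 16) (.var 0)))) <|
  .seq (.setR x (.load (.add (.var 16) (.var 16))))
    (.setR (x + 1) (.load (.add (.add (.var 16) (.var 16)) (.lit 1))))

/-- Indices stay below `3 * m`, so two conditional subtractions reduce them modulo `m`. The final
content of the scratch register `16` is left unspecified. -/
theorem Ensures.loadV {L m : ℕ} {V : ℕ → Plane} {p q : Plane} {s : State} {Q : State → Prop}
    (hV : CyclicPolygon m V) (hs : Layout m V p q s) {j x : ℕ} (hj : s.idx j < 3 * m)
    (h : ∀ n, Q ((s.setI 16 n).setPt x (V (s.idx j)))) : Ensures L (loadV j x) s Q := by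
  have hm := hV.pos
  -- one conditional subtraction
  have red : ∀ (n : ℕ) (R : State → Prop),
      (∀ k, V k = V n → (n < 3 * m → k < 2 * m) → (n < 2 * m → k < m) → R (s.setI 16 k)) →
      Ensures L (.ite (.ltI (.var 16) (.var 0)) .skip (.setI 16 (.sub (.var 16) (.var 0))))
        (s.setI 16 n) R := by
    intro n R hR
    have h0 : (s.setI 16 n).idx 0 = m := by simp [hs.size]
    have h16 : (s.setI 16 n).idx 16 = n := by simp
    refine .ite (fun hlt => .skip ?_) (fun hlt => .setI ?_)
    · simp only [BExp.Holds, IExp.eval, h0, h16] at hlt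
      exact hR n rfl (by omega) (by omega)
    · simp only [BExp.Holds, IExp.eval, h0, h16] at hlt
      simp only [IExp.eval, h0, h16]
      convert hR (n - m) (by rw [← hV.periodic (n - m)]; congr 1; omega) (by omega) (by omega)
        using 1
      simp [State.setI]
  refine .seq (.setI (.seq (red _ _ fun n hn h1 _ => .seq (red _ _ fun k hk _ h2 =>
    .seq (.setR (.setR ?_))))))
  simp only [IExp.eval] at h1 hn
  obtain ⟨e0, e1⟩ := hs.vertex k (h2 (h1 hj))
  have := h k
  rw [← hn, ← hk] at this
  simpa [State.setPt, RExp.eval, IExp.eval, ← two_mul, e0, e1] using this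

/-- Loads the end points of the side whose index is in the register `j` into the points `18`
and `20`. -/
def loadSide (j : ℕ) : Prog :=
  .seq (loadV j 18) <| .seq (.setI 15 (.add (.var j) (.lit 1))) (loadV 15 20)

theorem Ensures.loadSide {L m : ℕ} {V : ℕ → Plane} {p q : Plane} {s : State} {Q : State → Prop}
    (hV : CyclicPolygon m V) (hs : Layout m V p q s) {j : ℕ} (hj15 : j < 15)
    (hj : s.idx j + 1 < 3 * m)
    (h : ∀ s', Agree 15 18 s s' → pt s' 18 = V (s.idx j) → pt s' 20 = V (s.idx j + 1) → Q s') :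
    Ensures L (loadSide j) s Q := by
  refine .seq (Ensures.loadV hV hs (by omega) fun n => .seq (.setI ?_))
  have hag : Agree 15 18 s (((s.setI 16 n).setPt 18 (V (s.idx j))).setI 15
      (s.idx j + 1)) := (((Agree.refl s).setI (by omega)).setPt le_rfl).setI le_rfl
  have he : (IExp.add (.var j) (.lit 1)).eval ((s.setI 16 n).setPt 18 (V (s.idx j))) =
      s.idx j + 1 := by
    simp [IExp.eval, show j ≠ 16 by omega]
  rw [he]
  refine Ensures.loadV hV (hs.of_agree hag (by omega) (by omega)) (by simpa using hj) fun n' => ?_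
  apply h
  · exact (hag.setI (by omega)).setPt (by omega)
  · rw [pt_setPt_of_lt _ _ (by omega)]
    simp
  · simp

end HilbertPlane

/-! ### Inputs for which the two crossed sides are known. -/

namespace HilbertPlane

open RealRAM

/-- The vertices form a convex polygon with `p` and `q` inside, and the line `pq` crosses its sides
`f` and `b`. -/
structure CrossedPolygon (m : ℕ) (V : ℕ → Plane) (p q : Plane) (f b : ℕ) : Prop where
  poly : CyclicPolygon m V
  hp : p ∈ openBody V
  hq : q ∈ openBody V
  hpq : p ≠ q
  cross : Crossing m V p q f b
  lt_size : f < m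

/-- The state holds the input, and the crossed sides in the index registers `1` and `2`. -/
structure CrossedLayout (m : ℕ) (V : ℕ → Plane) (p q : Plane) (f b : ℕ) (s : State) : Prop
    extends Layout m V p q s where
  start : s.idx 1 = f
  finish : s.idx 2 = b

theorem CrossedLayout.of_agree {m : ℕ} {V : ℕ → Plane} {p q : Plane} {f b : ℕ} {s s' : State}
    {a c : ℕ} (h : CrossedLayout m V p q f b s) (h' : Agree a c s s') (ha : 3 ≤ a) (hc : 4 ≤ c) :
    CrossedLayout m V p q f b s' where
  toLayout := h.toLayout.of_agree h' (by omega) hc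
  start := by rw [h'.idx 1 (by omega), h.start]
  finish := by rw [h'.idx 2 (by omega), h.finish]

/-! ### Evaluating the boundary comparison -/

/-- Finds the side through which the ray from the point `12` through the point `r` leaves the
polygon, and stores the far ratio in the real register `dst`. -/
def farRatio (r dst : ℕ) : Prog :=
  .seq (.setI 12 (.var 2)) <|
  .seq (.setI 13 (.add (.add (.var 1) (.var 0)) (.lit 1))) <|
  .seq (bisect 12 13 <|
    .seq (.setI 14 (.half (.add (.var 12) (.var 13)))) <|
    .seq (loadV 14 18) <|
    .ite (.ltR (.lit 0) (orientE 12 r 18)) (.setI 13 (.var 14)) (.setI 12 (.var 14))) <|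
  .seq (loadSide 12) (.setR dst (.div (orientE 18 20 12) (orientE 18 20 r)))

variable {L m : ℕ} {V : ℕ → Plane} {p q : Plane} {f b : ℕ} {s : State} {Q : State → Prop}

/-- The invariant is `ExitBracket` on the degenerate segment at the starting point: a vertex to the
left of the ray bounds the exit side from above, any other vertex from below. -/
theorem Ensures.farRatio (h : CrossedPolygon m V p q f b) (hL : 2 * m + 2 ≤ 2 ^ L)
    (hs : CrossedLayout m V p q f b s) (hz : 0 < orient p q (pt s 12)) {r dst : ℕ} (hr : r < 12)
    (hrb : pt s r ∈ openBody V) (hsr : orient p q (pt s r) = 0)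
    (hQ : ∀ s', Agree 12 18 s s' → Q (s'.setR dst (ratioMax m V (pt s 12) (pt s r)))) :
    Ensures L (farRatio r dst) s Q := by
  have hbm := h.cross.lt_add
  have hfm := h.lt_size
  have hfb := h.cross.lt
  have hV := h.poly
  refine .seq (.setI (.seq (.setI (.seq ?_))))
  refine Ensures.bisect (I := fun s' => Agree 12 18 s s' ∧ b ≤ s'.idx 12 ∧ s'.idx 12 < s'.idx 13 ∧
    s'.idx 13 ≤ f + m + 1 ∧ ExitBracket V p q (pt s r) (pt s 12) (pt s 12) (s'.idx 12) (s'.idx 13))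
    ?_ ?_ (fun s' hs' => hs'.2.2.1) ?_ ?_
  · refine ⟨((Agree.refl s).setI le_rfl).setI (by omega), ?_⟩
    simp only [IExp.eval, State.setI_idx, hs.start, hs.finish, hs.size]
    simp only [Nat.reduceEqDiff, if_false, if_true, OfNat.one_ne_ofNat, OfNat.zero_ne_ofNat]
    exact ⟨le_rfl, by omega, le_rfl, ExitBracket.init hV h.cross hrb hsr hz.le hz.le⟩
  · simp only [IExp.eval, State.setI_idx, hs.start, hs.finish, hs.size]
    simp only [Nat.reduceEqDiff, if_false, if_true, OfNat.one_ne_ofNat, OfNat.zero_ne_ofNat]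
    omega
  · rintro s₁ ⟨hag, h1, h2, h3, h4⟩ hlt
    set mid := (s₁.idx 12 + s₁.idx 13) / 2 with hmid
    have hs₁ := hs.of_agree hag (by omega) (by omega)
    have hag₂ : Agree 12 18 s (s₁.setI 14 mid) := hag.setI (by omega)
    refine .seq (.setI (.seq (Ensures.loadV hV
      (hs.of_agree hag₂ (by omega) (by omega)).toLayout ?_ fun n => ?_)))
    · simp only [State.setI_idx, if_true]
      omega
    have hag₃ : Agree 12 18 s (((s₁.setI 14 mid).setI 16 n).setPt 18 (V mid)) :=
      (hag₂.setI (by omega)).setPt le_rfl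
    have e14 : (s₁.setI 14 mid).idx 14 = mid := by simp
    rw [e14]
    have hsm : orient p q (V mid) ≤ 0 := hV.right_vertex h.cross (by omega) (by omega)
    refine .ite (fun hb => .setI ⟨⟨hag₃.setI (by omega), ?_⟩, ?_⟩)
      (fun hb => .setI ⟨⟨hag₃.setI (by omega), ?_⟩, ?_⟩)
    · simp only [BExp.Holds, orientE_eval, RExp.eval, Int.cast_zero, pt_setPt_self,
        hag₃.pt (x := 12) (by omega), hag₃.pt (x := r) (by omega)] at hb
      have hup := h4.set_upper hV (j := mid) (by omega) hsm hb.le hb.le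
      simp only [IExp.eval, State.setI_idx, setPt_idx]
      simp only [Nat.reduceEqDiff, if_false, if_true]
      exact ⟨h1, by omega, by omega, hup⟩
    · simp [IExp.eval]
    · simp only [BExp.Holds, orientE_eval, RExp.eval, Int.cast_zero, pt_setPt_self,
        hag₃.pt (x := 12) (by omega), hag₃.pt (x := r) (by omega), not_lt] at hb
      have hup := h4.set_lower hV (j := mid) hsm hb hb
      simp only [IExp.eval, State.setI_idx, setPt_idx]
      simp only [Nat.reduceEqDiff, if_false, if_true]
      exact ⟨by omega, by omega, by omega, hup⟩
    · simp [IExp.eval]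
  · rintro s₁ ⟨hag, h1, h2, h3, h4⟩ heq
    have hs₁ := hs.of_agree hag (by omega) (by omega)
    refine .seq (Ensures.loadSide hV hs₁.toLayout (by omega) (by omega) fun s₂ hag₂ e1 e2 =>
      .setR ?_)
    have hag' : Agree 12 18 s s₂ := hag.trans hag₂ (by omega) le_rfl
    have hval := hQ s₂ hag'
    rw [heq] at h4
    rw [h4.ratioMax_eq hV hrb hsr hz.le hz.le (by linarith) (left_mem_segment ℝ _ _)] at hval
    simpa only [RExp.eval, orientE_eval, e1, e2, hag'.pt (x := 12) (by omega),
      hag'.pt (x := r) (by omega), side] using hval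

/-- Stores in the real register `17` the boundary comparison of the point `12` for the side in the
index register `7`. -/
def balanceProg : Prog :=
  .seq (farRatio 0 16) <| .seq (farRatio 2 17) <| .seq (loadSide 7) <|
  .setR 17 (.sub (.mul (orientE 18 20 0) (.var 16)) (.mul (orientE 18 20 2) (.var 17)))

theorem Ensures.balanceProg (h : CrossedPolygon m V p q f b) (hL : 2 * m + 2 ≤ 2 ^ L)
    (hs : CrossedLayout m V p q f b s) (hz : 0 < orient p q (pt s 12))
    (hi : s.idx 7 + 1 < 3 * m)
    (hQ : ∀ s', Agree 12 16 s s' →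
      s'.reg 17 = balance m V p q (s.idx 7) (pt s 12) → Q s') :
    Ensures L balanceProg s Q := by
  refine .seq (Ensures.farRatio h hL hs hz (by omega) (hs.pt_zero ▸ h.hp)
    (by rw [hs.pt_zero, orient_self_left]) fun s₁ hag₁ => ?_)
  have hag₂ : Agree 12 16 s (s₁.setR 16 (ratioMax m V (pt s 12) (pt s 0))) :=
    ((Agree.refl s).trans hag₁ le_rfl (by omega)).setR le_rfl
  have hs₂ := hs.of_agree hag₂ (by omega) (by omega)
  have hz₂ : pt (s₁.setR 16 (ratioMax m V (pt s 12) (pt s 0))) 12 = pt s 12 := hag₂.pt (by omega)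
  refine .seq (Ensures.farRatio h hL hs₂ (hz₂ ▸ hz) (by omega) (hs₂.pt_two ▸ h.hq)
    (by rw [hs₂.pt_two, orient_self_right]) fun s₃ hag₃ => ?_)
  rw [hz₂, hs₂.pt_two, hs.pt_zero] at *
  have hag₄ : Agree 12 16 s (s₃.setR 17 (ratioMax m V (pt s 12) q)) :=
    (hag₂.trans hag₃ le_rfl (by omega)).setR (by omega)
  refine .seq (Ensures.loadSide h.poly (hs.of_agree hag₄ (by omega) (by omega)).toLayout (by omega)
    (by rw [hag₄.idx 7 (by omega)]; exact hi) fun s₅ hag₅ e1 e2 => .setR ?_)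
  have hag₆ : Agree 12 16 s s₅ := hag₄.trans hag₅ (by omega) (by omega)
  refine hQ _ (hag₆.setR (by omega)) ?_
  have hs₆ := hs.of_agree hag₆ (by omega) (by omega)
  have r16 : s₅.reg 16 = ratioMax m V (pt s 12) p := by
    rw [hag₅.reg 16 (by omega)]
    simp [hag₃.reg 16 (by omega)]
  have r17 : s₅.reg 17 = ratioMax m V (pt s 12) q := by
    rw [hag₅.reg 17 (by omega)]
    simp
  rw [hag₄.idx 7 (by omega)] at e1 e2
  simp only [State.setR_reg, if_true, RExp.eval, orientE_eval, e1, e2, hs₆.pt_zero, hs₆.pt_two,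
    r16, r17]
  rfl

/-! ### Locating the limit point on one side -/

/-- Replaces one end of the segment between the points `8` and `10` by its intersection with the
line through the points `14` and `r`. -/
def shrinkProg (r : ℕ) : Prog :=
  .seq (.setR 16 (.div (orientE 8 r 14) (.sub (orientE 8 r 14) (orientE 10 r 14)))) <|
  .seq (interpolate 12 8 10 16) <|
  .seq balanceProg <|
  .ite (.ltR (.var 17) (.lit 0)) (copyPt 10 12) (copyPt 8 12)

/-- Shrinks the segment between the points `8` and `10` until all rays from it through the point `r`
leave the polygon through one side, whose index is stored in the index register `9`. -/
def exitProg (r : ℕ) : Prog :=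
  .seq (.setI 9 (.var 2)) <|
  .seq (.setI 10 (.add (.add (.var 1) (.var 0)) (.lit 1))) <|
  bisect 9 10 <|
    .seq (.setI 11 (.half (.add (.var 9) (.var 10)))) <|
    .seq (loadV 11 14) <|
    .seq (.ite (.ltR (.mul (orientE 8 r 14) (orientE 10 r 14)) (.lit 0)) (shrinkProg r) .skip) <|
    .ite (.and (.not (.ltR (.lit 0) (orientE 8 r 14))) (.not (.ltR (.lit 0) (orientE 10 r 14))))
      (.setI 9 (.var 11)) (.setI 10 (.var 11))

theorem segment_subset_of_lineMap {a c : Plane} {x y : Plane} (hx : x ∈ segment ℝ a c)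
    (hy : y ∈ segment ℝ a c) : segment ℝ x y ⊆ segment ℝ a c :=
  (convex_segment a c).segment_subset hx hy

/-- The line through the vertex and `r` cuts the segment at an interior point. The sign of `balance`
there selects the half that keeps the sign change. The new endpoint is collinear with `r` and the
vertex, so the vertex no longer separates the rays from the two ends. -/
theorem Ensures.shrinkProg (h : CrossedPolygon m V p q f b) (hL : 2 * m + 2 ≤ 2 ^ L)
    (hs : CrossedLayout m V p q f b s) (hi : s.idx 7 + 1 < 3 * m) {r : ℕ}
    (hroot : RootBracket m V p q (s.idx 7) (pt s 8) (pt s 10))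
    (hneg : orient (pt s 8) (pt s r) (pt s 14) * orient (pt s 10) (pt s r) (pt s 14) < 0)
    {lo up : ℕ} (hexit : ExitBracket V p q (pt s r) (pt s 8) (pt s 10) lo up)
    (hQ : ∀ s', Agree 12 8 s s' → pt s' 14 = pt s 14 →
      RootBracket m V p q (s.idx 7) (pt s' 8) (pt s' 10) →
      ExitBracket V p q (pt s r) (pt s' 8) (pt s' 10) lo up →
      segment ℝ (pt s' 8) (pt s' 10) ⊆ segment ℝ (pt s 8) (pt s 10) →
      0 ≤ orient (pt s' 8) (pt s r) (pt s 14) * orient (pt s' 10) (pt s r) (pt s 14) → Q s') :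
    Ensures L (shrinkProg r) s Q := by
  set zl := pt s 8 with hzl
  set zh := pt s 10 with hzh
  set u := pt s 14 with hu
  set w := pt s r with hw
  set A := orient zl w u with hA
  set B := orient zh w u with hB
  set t := A / (A - B) with ht
  have hAB : A - B ≠ 0 := by
    intro h0
    have : A = B := by linarith
    rw [this] at hneg
    nlinarith [mul_self_nonneg B]
  have ht0 : 0 < t := by
    -- Expanding by `A - B` makes the denominator a square; the numerator is positive because `A * B
    -- < 0`.
    rw [ht, show A / (A - B) = (A * A - A * B) / ((A - B) * (A - B)) by field_simp]
    apply div_pos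
    · nlinarith [mul_self_nonneg A]
    · exact mul_self_pos.2 hAB
  have ht1 : t < 1 := by
    have : 0 < 1 - t := by
      rw [ht, show 1 - A / (A - B) = (B * B - A * B) / ((A - B) * (A - B)) by field_simp; ring]
      apply div_pos
      · nlinarith [mul_self_nonneg B]
      · exact mul_self_pos.2 hAB
    linarith
  set z : Plane := AffineMap.lineMap zl zh t with hz
  have hzu : orient z w u = 0 := by
    rw [hz, orient_lineMap_left, ← hA, ← hB, ht]
    field_simp
    ring
  obtain ⟨-, -, hzs⟩ := hroot.lineMap_mem ht0 ht1
  have hzseg : z ∈ segment ℝ zl zh := by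
    rw [segment_eq_image_lineMap]
    exact ⟨t, ⟨ht0.le, ht1.le⟩, rfl⟩
  refine .seq (.setR (.seq (Ensures.interpolate (by omega) (by omega) (by omega) ?_)))
  have ev : (RExp.div (orientE 8 r 14) (.sub (orientE 8 r 14) (orientE 10 r 14))).eval s = t := rfl
  rw [ev, pt_setR_of_ne _ _ (by omega) (by omega), pt_setR_of_ne _ _ (by omega) (by omega),
    State.setR_reg, if_pos rfl, ← hzl, ← hzh, ← hz]
  set s₁ := (s.setR 16 t).setPt 12 z with hs₁
  have hag₁ : Agree 12 12 s s₁ := ((Agree.refl s).setR (by omega)).setPt le_rfl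
  have h14₁ : pt s₁ 14 = u := by
    rw [hs₁, pt_setPt_of_lt _ _ (by omega), pt_setR_of_ne _ _ (by omega) (by omega)]
  have h12₁ : pt s₁ 12 = z := pt_setPt_self _ _ _
  refine .seq (Ensures.balanceProg h hL (hs.of_agree hag₁ (by omega) (by omega)) (h12₁ ▸ hzs)
    (by rw [hag₁.idx 7 (by omega)]; exact hi) fun s₂ hag₂ hval => ?_)
  rw [h12₁, hag₁.idx 7 (by omega)] at hval
  have hag₃ : Agree 12 12 s s₂ := hag₁.trans hag₂ le_rfl (by omega)
  have h12 : pt s₂ 12 = z := by rw [hag₂.pt (by omega), h12₁]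
  have h14 : pt s₂ 14 = u := by rw [hag₂.pt (by omega), h14₁]
  have h8 : pt s₂ 8 = zl := hag₃.pt (by omega)
  have h10 : pt s₂ 10 = zh := hag₃.pt (by omega)
  have hag₄ : Agree 12 8 s s₂ := (Agree.refl s).trans hag₃ le_rfl (by omega)
  refine .ite (fun hb => Ensures.copyPt (by omega) ?_) (fun hb => Ensures.copyPt (by omega) ?_)
  · simp only [BExp.Holds, RExp.eval, Int.cast_zero, hval] at hb
    rw [h12]
    have e8 : pt (s₂.setPt 10 z) 8 = zl := by rw [pt_setPt_of_lt _ _ (by omega), h8]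
    have e14 : pt (s₂.setPt 10 z) 14 = u := by rw [pt_setPt_of_lt _ _ (by omega), h14]
    refine hQ _ (hag₄.setPt (by omega)) e14 ?_ ?_ ?_ ?_ <;> rw [e8, pt_setPt_self]
    · exact hroot.shrink_right ht0 ht1 hb.le
    · simpa using hexit.mono le_rfl zero_le_one ht0.le ht1.le
    · exact segment_subset_of_lineMap (left_mem_segment ℝ _ _) hzseg
    · rw [hzu, mul_zero]
  · simp only [BExp.Holds, RExp.eval, Int.cast_zero, hval, not_lt] at hb
    rw [h12]
    have e10 : pt (s₂.setPt 8 z) 10 = zh := by rw [pt_setPt_of_lt _ _ (by omega), h10]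
    have e14 : pt (s₂.setPt 8 z) 14 = u := by rw [pt_setPt_of_lt _ _ (by omega), h14]
    refine hQ _ (hag₄.setPt (by omega)) e14 ?_ ?_ ?_ ?_ <;> rw [e10, pt_setPt_self]
    · exact hroot.shrink_left ht0 ht1 hb
    · simpa using hexit.mono ht0.le ht1.le zero_le_one le_rfl
    · exact segment_subset_of_lineMap hzseg (right_mem_segment ℝ _ _)
    · rw [hzu, zero_mul]

/-- The search for the exit side is run for the whole segment at once: whenever the middle vertex
separates the rays from its ends, the segment is cut first. Thus both `RootBracket` and
`ExitBracket` are maintained. -/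
theorem Ensures.exitProg (h : CrossedPolygon m V p q f b) (hL : 2 * m + 2 ≤ 2 ^ L)
    (hs : CrossedLayout m V p q f b s) (hi : s.idx 7 + 1 < 3 * m) {r : ℕ} (hr : r < 3)
    (hrb : pt s r ∈ openBody V) (hsr : orient p q (pt s r) = 0)
    (hroot : RootBracket m V p q (s.idx 7) (pt s 8) (pt s 10))
    (hQ : ∀ s', Agree 9 8 s s' → s'.idx 9 + 1 < 3 * m →
      RootBracket m V p q (s.idx 7) (pt s' 8) (pt s' 10) →
      segment ℝ (pt s' 8) (pt s' 10) ⊆ segment ℝ (pt s 8) (pt s 10) →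
      (∀ z ∈ segment ℝ (pt s' 8) (pt s' 10),
        ratioMax m V z (pt s r) = side V (s'.idx 9) z / side V (s'.idx 9) (pt s r)) → Q s') :
    Ensures L (exitProg r) s Q := by
  have hbm := h.cross.lt_add
  have hfm := h.lt_size
  have hfb := h.cross.lt
  have hV := h.poly
  refine .seq (.setI (.seq (.setI ?_)))
  refine Ensures.bisect (I := fun s' => Agree 9 8 s s' ∧ b ≤ s'.idx 9 ∧ s'.idx 9 < s'.idx 10 ∧
    s'.idx 10 ≤ f + m + 1 ∧ RootBracket m V p q (s.idx 7) (pt s' 8) (pt s' 10) ∧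
    segment ℝ (pt s' 8) (pt s' 10) ⊆ segment ℝ (pt s 8) (pt s 10) ∧
    ExitBracket V p q (pt s r) (pt s' 8) (pt s' 10) (s'.idx 9) (s'.idx 10))
    ?_ ?_ (fun s' hs' => hs'.2.2.1) ?_ ?_
  · refine ⟨((Agree.refl s).setI le_rfl).setI (by omega), ?_⟩
    simp only [IExp.eval, State.setI_idx, hs.start, hs.finish, hs.size, pt_setI]
    simp only [Nat.reduceEqDiff, if_false, if_true, OfNat.one_ne_ofNat, OfNat.zero_ne_ofNat]
    exact ⟨le_rfl, by omega, le_rfl, hroot, subset_rfl,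
      ExitBracket.init hV h.cross hrb hsr hroot.orient_left hroot.orient_right⟩
  · simp only [IExp.eval, State.setI_idx, hs.start, hs.finish, hs.size]
    simp only [Nat.reduceEqDiff, if_false, if_true, OfNat.one_ne_ofNat, OfNat.zero_ne_ofNat]
    omega
  · rintro s₁ ⟨hag, h1, h2, h3, h4, h5, h6⟩ hlt
    set mid := (s₁.idx 9 + s₁.idx 10) / 2 with hmid
    have hag₂ : Agree 9 8 s (s₁.setI 11 mid) := hag.setI (by omega)
    refine .seq (.setI (.seq (Ensures.loadV hV
      (hs.of_agree hag₂ (by omega) (by omega)).toLayout ?_ fun n => ?_)))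
    · simp only [State.setI_idx, if_true]
      omega
    have e11 : (s₁.setI 11 mid).idx 11 = mid := by simp
    rw [e11]
    set s₂ := ((s₁.setI 11 mid).setI 16 n).setPt 14 (V mid) with hs₂
    have hag₃ : Agree 9 8 s s₂ := (hag₂.setI (by omega)).setPt (by omega)
    have hL₂ := hs.of_agree hag₃ (by omega) (by omega)
    have h14 : pt s₂ 14 = V mid := pt_setPt_self _ _ _
    have h8 : pt s₂ 8 = pt s₁ 8 := pt_setPt_of_lt _ _ (by omega)
    have h10 : pt s₂ 10 = pt s₁ 10 := pt_setPt_of_lt _ _ (by omega)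
    have hr₂ : pt s₂ r = pt s r := hag₃.pt (by omega)
    have hsm : orient p q (V mid) ≤ 0 := hV.right_vertex h.cross (by omega) (by omega)
    -- what the body of the loop does after the segment has been shrunk
    have final : ∀ s₃, Agree 12 8 s₂ s₃ → pt s₃ 14 = V mid →
        RootBracket m V p q (s.idx 7) (pt s₃ 8) (pt s₃ 10) →
        ExitBracket V p q (pt s r) (pt s₃ 8) (pt s₃ 10) (s₁.idx 9) (s₁.idx 10) →
        segment ℝ (pt s₃ 8) (pt s₃ 10) ⊆ segment ℝ (pt s₁ 8) (pt s₁ 10) →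
        0 ≤ orient (pt s₃ 8) (pt s r) (V mid) * orient (pt s₃ 10) (pt s r) (V mid) →
        Ensures L (.ite (.and (.not (.ltR (.lit 0) (orientE 8 r 14)))
          (.not (.ltR (.lit 0) (orientE 10 r 14)))) (.setI 9 (.var 11)) (.setI 10 (.var 11))) s₃
          fun s' => (Agree 9 8 s s' ∧ b ≤ s'.idx 9 ∧ s'.idx 9 < s'.idx 10 ∧
            s'.idx 10 ≤ f + m + 1 ∧ RootBracket m V p q (s.idx 7) (pt s' 8) (pt s' 10) ∧
            segment ℝ (pt s' 8) (pt s' 10) ⊆ segment ℝ (pt s 8) (pt s 10) ∧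
            ExitBracket V p q (pt s r) (pt s' 8) (pt s' 10) (s'.idx 9) (s'.idx 10)) ∧
            (s'.idx 9 = mid ∧ s'.idx 10 = s₁.idx 10 ∨ s'.idx 9 = s₁.idx 9 ∧ s'.idx 10 = mid) := by
      intro s₃ k1 k2 k3 k4 k5 k6
      have i9 : s₃.idx 9 = s₁.idx 9 := by rw [k1.idx 9 (by omega)]; simp [hs₂]
      have i10 : s₃.idx 10 = s₁.idx 10 := by rw [k1.idx 10 (by omega)]; simp [hs₂]
      have i11 : s₃.idx 11 = mid := by rw [k1.idx 11 (by omega)]; simp [hs₂]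
      have hr₃ : pt s₃ r = pt s r := by rw [k1.pt (by omega), hr₂]
      have hag₄ : Agree 9 8 s s₃ := hag₃.trans k1 (by omega) le_rfl
      refine .ite (fun hb => .setI ⟨⟨hag₄.setI le_rfl, ?_⟩, ?_⟩)
        (fun hb => .setI ⟨⟨hag₄.setI (by omega), ?_⟩, ?_⟩)
      · simp only [BExp.Holds, orientE_eval, RExp.eval, Int.cast_zero, k2, hr₃, not_lt] at hb
        have hup := k4.set_lower hV (j := mid) hsm hb.1 hb.2
        simp only [IExp.eval, State.setI_idx, pt_setI, i11]
        simp only [Nat.reduceEqDiff, if_false, if_true, i10]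
        exact ⟨by omega, by omega, by omega, k3, k5.trans h5, hup⟩
      · simp [IExp.eval, i10, i11]
      · simp only [BExp.Holds, orientE_eval, RExp.eval, Int.cast_zero, k2, hr₃, not_lt,
          not_and_or, not_le] at hb
        -- One area is positive and the product is nonnegative, so both are nonnegative.
        have hb' : 0 ≤ orient (pt s₃ 8) (pt s r) (V mid) ∧
            0 ≤ orient (pt s₃ 10) (pt s r) (V mid) := by
          rcases hb with hb | hb
          · exact ⟨hb.le, nonneg_of_mul_nonneg_right k6 hb⟩
          · exact ⟨nonneg_of_mul_nonneg_left k6 hb, hb.le⟩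
        have hup := k4.set_upper hV (j := mid) (by omega) hsm hb'.1 hb'.2
        simp only [IExp.eval, State.setI_idx, pt_setI, i11]
        simp only [Nat.reduceEqDiff, if_false, if_true, i9]
        exact ⟨by omega, by omega, by omega, k3, k5.trans h5, hup⟩
      · simp [IExp.eval, i9, i11]
    refine .seq (.ite (fun hb => ?_) (fun hb => .skip ?_))
    · simp only [BExp.Holds, orientE_eval, RExp.eval, Int.cast_zero] at hb
      refine Ensures.shrinkProg h hL hL₂ (by rw [hag₃.idx 7 (by omega)]; exact hi)
        (by rw [hag₃.idx 7 (by omega), h8, h10]; exact h4) hb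
        (by rw [hr₂, h8, h10]; exact h6) fun s₃ k1 k2 k3 k4 k5 k6 => ?_
      rw [hag₃.idx 7 (by omega)] at k3
      rw [hr₂] at k4 k6
      rw [h8, h10] at k5
      rw [h14] at k2 k6
      exact final s₃ k1 k2 k3 k4 k5 k6
    · simp only [BExp.Holds, orientE_eval, RExp.eval, Int.cast_zero, h8, h10, h14, hr₂,
        not_lt] at hb
      apply final s₂ (Agree.refl s₂) h14 <;> rw [h8, h10]
      · exact h4
      · exact h6
      · exact hb
  · rintro s₁ ⟨hag, h1, h2, h3, h4, h5, h6⟩ heq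
    rw [heq] at h6
    exact hQ s₁ hag (by omega) h4 h5 fun z hz =>
      h6.ratioMax_eq hV hrb hsr h4.orient_left h4.orient_right h4.orient_pos hz

/-- Finds the limit point on the segment between the points `8` and `10` of the side in the index
register `7`, and stores it in the point `8`. -/
def rootProg : Prog :=
  .seq (exitProg 0) <| .seq (.setI 8 (.var 9)) <| .seq (exitProg 2) <|
  .seq (loadSide 7) <| .seq (.setR 14 (orientE 18 20 0)) <| .seq (.setR 15 (orientE 18 20 2)) <|
  .seq (loadSide 8) <|
  .seq (.setR 16 (.mul (.var 14) (.div (orientE 18 20 8) (orientE 18 20 0)))) <|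
  .seq (.setR 17 (.mul (.var 14) (.div (orientE 18 20 10) (orientE 18 20 0)))) <|
  .seq (loadSide 9) <|
  .seq (.setR 16 (.sub (.var 16) (.mul (.var 15) (.div (orientE 18 20 8) (orientE 18 20 2))))) <|
  .seq (.setR 17 (.sub (.var 17) (.mul (.var 15) (.div (orientE 18 20 10) (orientE 18 20 2))))) <|
  .seq (.setR 16 (.div (.var 16) (.sub (.var 16) (.var 17)))) <|
  interpolate 8 8 10 16

theorem Ensures.rootProg (h : CrossedPolygon m V p q f b) (hL : 2 * m + 2 ≤ 2 ^ L)
    (hs : CrossedLayout m V p q f b s) (hi : s.idx 7 + 1 < 3 * m)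
    (hroot : RootBracket m V p q (s.idx 7) (pt s 8) (pt s 10))
    (hQ : ∀ s', Agree 8 8 s s' → pt s' 8 ∈ bisectorEnds (body V) p q →
      0 < orient p q (pt s' 8) → Q s') :
    Ensures L rootProg s Q := by
  have hV := h.poly
  refine .seq (Ensures.exitProg h hL hs hi (by omega) (hs.pt_zero ▸ h.hp)
    (by rw [hs.pt_zero, orient_self_left]) hroot fun s₁ hag₁ hj hroot₁ hseg₁ hM₁ => ?_)
  rw [hs.pt_zero] at hM₁
  refine .seq (.setI ?_)
  change Ensures L _ (s₁.setI 8 (s₁.idx 9)) Q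
  set s₂ := s₁.setI 8 (s₁.idx 9) with hs₂
  have hag₂ : Agree 8 8 s s₂ := ((Agree.refl s).trans hag₁ (by omega) le_rfl).setI le_rfl
  have hL₂ := hs.of_agree hag₂ (by omega) (by omega)
  have i7 : s₂.idx 7 = s.idx 7 := hag₂.idx 7 (by omega)
  refine .seq (Ensures.exitProg h hL hL₂ (by rw [i7]; exact hi) (by omega) (hL₂.pt_two ▸ h.hq)
    (by rw [hL₂.pt_two, orient_self_right]) (by rw [i7]; exact hroot₁)
    fun s₃ hag₃ hk hroot₃ hseg₃ hM₃ => ?_)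
  rw [hL₂.pt_two] at hM₃
  rw [i7] at hroot₃
  have i8 : s₃.idx 8 = s₁.idx 9 := by rw [hag₃.idx 8 (by omega)]; simp [hs₂]
  -- The second search only shrinks the segment, so the exit side found for `p` remains valid.
  have hM₁' : ∀ z ∈ segment ℝ (pt s₃ 8) (pt s₃ 10), ratioMax m V z p =
      side V (s₃.idx 8) z / side V (s₃.idx 8) p := by
    intro z hz
    rw [i8]
    exact hM₁ z (hseg₃ hz)
  have hag₄ : Agree 8 8 s s₃ := hag₂.trans hag₃ (by omega) le_rfl
  have hL₃ := hs.of_agree hag₄ (by omega) (by omega)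
  have i7' : s₃.idx 7 = s.idx 7 := hag₄.idx 7 (by omega)
  refine .seq (Ensures.loadSide hV hL₃.toLayout (by omega) (by rw [i7']; exact hi)
    fun s₄ hag e1 e2 => .seq (.setR (.seq (.setR ?_))))
  have hL₄ := hL₃.of_agree hag (by omega) (by omega)
  have v14 : (orientE 18 20 0).eval s₄ = side V (s.idx 7) p := by
    rw [orientE_eval, e1, e2, hL₄.pt_zero, i7']; rfl
  have v15 : (orientE 18 20 2).eval (s₄.setR 14 (side V (s.idx 7) p)) = side V (s.idx 7) q := by
    rw [orientE_eval, pt_setR_of_ne _ _ (by omega) (by omega),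
      pt_setR_of_ne _ _ (by omega) (by omega), pt_setR_of_ne _ _ (by omega) (by omega), e1, e2,
      hL₄.pt_two, i7']
    rfl
  rw [v14, v15]
  set s₅ := (s₄.setR 14 (side V (s.idx 7) p)).setR 15 (side V (s.idx 7) q) with hs₅
  have hag₅ : Agree 12 14 s₃ s₅ :=
    (((Agree.refl s₃).trans hag (by omega) (by omega)).setR (by omega)).setR (by omega)
  have hL₅ := hL₃.of_agree hag₅ (by omega) (by omega)
  have r14 : s₅.reg 14 = side V (s.idx 7) p := by simp [hs₅]
  have r15 : s₅.reg 15 = side V (s.idx 7) q := by simp [hs₅]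
  refine .seq (Ensures.loadSide hV hL₅.toLayout (by omega)
    (by rw [hag₅.idx 8 (by omega), i8]; exact hj) fun s₆ hag' e3 e4 => .seq (.setR (.seq (.setR ?_))))
  rw [hag₅.idx 8 (by omega)] at e3 e4
  have hag₆ : Agree 12 14 s₃ s₆ := hag₅.trans hag' (by omega) (by omega)
  have hL₆ := hL₃.of_agree hag₆ (by omega) (by omega)
  set zl := pt s₃ 8 with hzl
  set zh := pt s₃ 10 with hzh
  set j := s₃.idx 8 with hjdef
  set k := s₃.idx 9 with hkdef
  set i := s.idx 7 with hidef
  have v16 : (RExp.mul (.var 14) (.div (orientE 18 20 8) (orientE 18 20 0))).eval s₆ =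
      side V i p * (side V j zl / side V j p) := by
    simp only [RExp.eval, orientE_eval, e3, e4, hL₆.pt_zero, hag₆.pt (x := 8) (by omega),
      hag'.reg 14 (by omega), r14]
    rfl
  rw [v16]
  set a₁ := side V i p * (side V j zl / side V j p) with ha₁
  have v17 : (RExp.mul (.var 14) (.div (orientE 18 20 10) (orientE 18 20 0))).eval
      (s₆.setR 16 a₁) = side V i p * (side V j zh / side V j p) := by
    simp only [RExp.eval, orientE_eval, pt_setR_of_ne s₆ (i := 16) (x := 18) a₁ (by omega) (by omega),
      pt_setR_of_ne s₆ (i := 16) (x := 20) a₁ (by omega) (by omega),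
      pt_setR_of_ne s₆ (i := 16) (x := 10) a₁ (by omega) (by omega),
      pt_setR_of_ne s₆ (i := 16) (x := 0) a₁ (by omega) (by omega), e3, e4, hL₆.pt_zero,
      hag₆.pt (x := 10) (by omega)]
    simp only [State.setR_reg, Nat.reduceEqDiff, if_false, hag'.reg 14 (by omega), r14]
    rfl
  rw [v17]
  set a₂ := side V i p * (side V j zh / side V j p) with ha₂
  set s₇ := (s₆.setR 16 a₁).setR 17 a₂ with hs₇
  have hag₇ : Agree 12 14 s₃ s₇ := (hag₆.setR (by omega)).setR (by omega)
  have hL₇ := hL₃.of_agree hag₇ (by omega) (by omega)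
  have r15' : s₇.reg 15 = side V i q := by simp [hs₇, hag'.reg 15 (by omega), r15]
  have r16 : s₇.reg 16 = a₁ := by simp [hs₇]
  have r17 : s₇.reg 17 = a₂ := by simp [hs₇]
  refine .seq (Ensures.loadSide hV hL₇.toLayout (by omega)
    (by rw [hag₇.idx 9 (by omega)]; exact hk) fun s₈ hag'' e5 e6 => .seq (.setR (.seq (.setR ?_))))
  rw [hag₇.idx 9 (by omega)] at e5 e6
  have hag₈ : Agree 12 14 s₃ s₈ := hag₇.trans hag'' (by omega) (by omega)
  have hL₈ := hL₃.of_agree hag₈ (by omega) (by omega)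
  have w16 : (RExp.sub (.var 16) (.mul (.var 15) (.div (orientE 18 20 8) (orientE 18 20 2)))).eval
      s₈ = a₁ - side V i q * (side V k zl / side V k q) := by
    simp only [RExp.eval, orientE_eval, e5, e6, hL₈.pt_two, hag₈.pt (x := 8) (by omega),
      hag''.reg 15 (by omega), hag''.reg 16 (by omega), r15', r16]
    rfl
  rw [w16]
  set F : Plane → ℝ := fun z => side V i p * (side V j z / side V j p) -
    side V i q * (side V k z / side V k q) with hF
  change Ensures L _ (State.setR (s₈.setR 16 (F zl)) 17 _) Q
  have w17 : (RExp.sub (.var 17) (.mul (.var 15) (.div (orientE 18 20 10) (orientE 18 20 2)))).eval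
      (s₈.setR 16 (F zl)) = F zh := by
    simp only [RExp.eval, orientE_eval,
      pt_setR_of_ne s₈ (i := 16) (x := 18) (F zl) (by omega) (by omega),
      pt_setR_of_ne s₈ (i := 16) (x := 20) (F zl) (by omega) (by omega),
      pt_setR_of_ne s₈ (i := 16) (x := 10) (F zl) (by omega) (by omega),
      pt_setR_of_ne s₈ (i := 16) (x := 2) (F zl) (by omega) (by omega), e5, e6, hL₈.pt_two,
      hag₈.pt (x := 10) (by omega)]
    simp only [State.setR_reg, Nat.reduceEqDiff, if_false, hag''.reg 15 (by omega),
      hag''.reg 17 (by omega), r15', r17]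
    rfl
  rw [w17]
  refine .seq (.setR ?_)
  set s₉ := (s₈.setR 16 (F zl)).setR 17 (F zh) with hs₉
  have x16 : (RExp.div (.var 16) (.sub (.var 16) (.var 17))).eval s₉ =
      F zl / (F zl - F zh) := by
    simp [RExp.eval, hs₉]
  rw [x16]
  have hag₉ : Agree 12 14 s₃ (s₉.setR 16 (F zl / (F zl - F zh))) :=
    ((hag₈.setR (by omega)).setR (by omega)).setR (by omega)
  refine Ensures.interpolate (by omega) (by omega) (by omega) ?_
  rw [hag₉.pt (by omega), hag₉.pt (by omega), State.setR_reg, if_pos rfl, ← hzl, ← hzh]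
  obtain ⟨hz1, hz2⟩ := hroot₃.solve hV h.hp h.hq h.hpq hM₁' hM₃ (F := F) (fun z => rfl)
  apply hQ
  · exact (hag₄.trans ((Agree.refl s₃).trans hag₉ (show 8 ≤ 12 by omega) (show 8 ≤ 14 by omega))
      le_rfl le_rfl).setPt le_rfl
  · rw [pt_setPt_self]; exact hz1
  · rw [pt_setPt_self]; exact hz2

end HilbertPlane

namespace HilbertPlane

open RealRAM

variable {L m : ℕ} {V : ℕ → Plane} {p q : Plane} {f b : ℕ} {s : State} {Q : State → Prop}

/-! ### Locating the side that carries the limit point -/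

/-- Finds the limit point on the side in the index register `5`, between its vertices or the points
where it is crossed by `pq`. -/
def sideProg : Prog :=
  .seq (loadSide 7) <|
  .seq (.setR 16 (.div (orientE 18 20 0) (.sub (orientE 18 20 0) (orientE 18 20 2)))) <|
  .seq (interpolate 12 0 2 16) <|
  .seq (.ite (.ltI (.var 1) (.var 5)) (loadV 5 8) (copyPt 8 12)) <|
  .seq (.ite (.ltI (.var 2) (.var 6)) (copyPt 10 12) (loadV 6 10)) rootProg

/-- Finds the limit point to the left of `pq` and stores it in the point `8`. -/
def leftProg : Prog :=
  .seq (.setI 5 (.var 1)) <|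
  .seq (.setI 6 (.add (.var 2) (.lit 1))) <|
  .seq (bisect 5 6 <|
    .seq (.setI 7 (.half (.add (.var 5) (.var 6)))) <|
    .seq (loadV 7 12) <|
    .seq balanceProg <|
    .ite (.ltR (.lit 0) (.var 17)) (.setI 5 (.var 7)) (.setI 6 (.var 7))) <|
  .seq (.setI 7 (.var 5)) <|
  .seq (.ite (.ltI (.var 2) (.var 6)) (.setR 17 (.lit (-1))) (.seq (loadV 6 12) balanceProg)) <|
  .ite (.ltR (.var 17) (.lit 0)) sideProg (copyPt 8 12)

theorem CrossedPolygon.crossing_point (h : CrossedPolygon m V p q f b) {i : ℕ}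
    (hi : orient p q (V i) * orient p q (V (i + 1)) ≤ 0)
    (hne : orient p q (V i) ≠ orient p q (V (i + 1))) {z : Plane}
    (hz : z = AffineMap.lineMap p q (side V i p / (side V i p - side V i q))) :
    z ∈ body V ∧ side V i z = 0 ∧ orient p q z = 0 := by
  obtain ⟨g, hg, hig, hsg⟩ := h.poly.exists_crossing_point hi hne
  have hd : side V i p - side V i q ≠ 0 := by
    rw [side_sub_side]
    exact sub_ne_zero.2 hne.symm
  obtain ⟨t, rfl⟩ := exists_lineMap_eq h.hpq hsg
  have ht : t = side V i p / (side V i p - side V i q) := by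
    rw [eq_div_iff hd]
    rw [side_lineMap] at hig
    linarith
  rw [hz, ← ht]
  exact ⟨hg, hig, hsg⟩

/-- On the sides `f` and `b` the vertex beyond the line is replaced by the crossing point, where the
sign of `balance` is known without evaluation. -/
theorem Ensures.sideProg (h : CrossedPolygon m V p q f b) (hL : 2 * m + 2 ≤ 2 ^ L)
    (hs : CrossedLayout m V p q f b s) {i : ℕ} (hfi : f ≤ i) (hib : i ≤ b) (i5 : s.idx 5 = i)
    (i6 : s.idx 6 = i + 1) (i7 : s.idx 7 = i)
    (hlo : i = f ∨ 0 < balance m V p q i (V i))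
    (hhi : i = b ∨ balance m V p q i (V (i + 1)) < 0)
    (hQ : ∀ s', Agree 5 8 s s' → pt s' 8 ∈ bisectorEnds (body V) p q →
      0 < orient p q (pt s' 8) → Q s') :
    Ensures L sideProg s Q := by
  have hV := h.poly
  have hbm := h.cross.lt_add
  have hfm := h.lt_size
  have hfb := h.cross.lt
  refine .seq (Ensures.loadSide hV hs.toLayout (by omega) (by omega)
    fun s₁ hag₁ e1 e2 => .seq (.setR (.seq (Ensures.interpolate (by omega) (by omega) (by omega) ?_))))
  have hL₁ := hs.of_agree hag₁ (by omega) (by omega)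
  rw [i7] at e1 e2
  have ev : (RExp.div (orientE 18 20 0) (.sub (orientE 18 20 0) (orientE 18 20 2))).eval s₁ =
      side V i p / (side V i p - side V i q) := by
    simp only [RExp.eval, orientE_eval, e1, e2, hL₁.pt_zero, hL₁.pt_two, side]
  rw [ev, pt_setR_of_ne _ _ (by omega) (by omega), pt_setR_of_ne _ _ (by omega) (by omega),
    State.setR_reg, if_pos rfl, hL₁.pt_zero, hL₁.pt_two]
  -- This is meaningless if the side is parallel to `pq`, but it is used only for `i = f` and `i =
  -- b`, where the crossing is transversal.
  set z : Plane := AffineMap.lineMap p q (side V i p / (side V i p - side V i q)) with hz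
  set s₂ := (s₁.setR 16 (side V i p / (side V i p - side V i q))).setPt 12 z with hs₂
  have hag₂ : Agree 15 12 s s₂ :=
    (((Agree.refl s).trans hag₁ le_rfl (by omega)).setR (by omega)).setPt le_rfl
  have z₂ : pt s₂ 12 = z := pt_setPt_self _ _ _
  set zl : Plane := if f < i then V i else z with hzl
  set zh : Plane := if b < i + 1 then z else V (i + 1) with hzh
  have first : ∀ R : State → Prop, (∀ s₃, Agree 15 8 s s₃ → pt s₃ 8 = zl → pt s₃ 12 = z → R s₃) →
      Ensures L (.ite (.ltI (.var 1) (.var 5)) (HilbertPlane.loadV 5 8) (HilbertPlane.copyPt 8 12)) s₂ R := by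
    intro R hR
    have hag₂' : Agree 15 8 s s₂ := (Agree.refl s).trans hag₂ le_rfl (by omega)
    have i1 : s₂.idx 1 = f := by rw [hag₂.idx 1 (by omega), hs.start]
    have i5' : s₂.idx 5 = i := by rw [hag₂.idx 5 (by omega), i5]
    refine .ite (fun hb => ?_) (fun hb => ?_)
    · simp only [BExp.Holds, IExp.eval, i1, i5'] at hb
      refine Ensures.loadV hV (hs.of_agree hag₂ (by omega) (by omega)).toLayout (by omega)
        fun n => ?_
      apply hR
      · exact (hag₂'.setI (by omega)).setPt le_rfl
      · rw [pt_setPt_self, i5', hzl, if_pos hb]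
      · rw [pt_setPt_of_lt _ _ (by omega), pt_setI, z₂]
    · simp only [BExp.Holds, IExp.eval, i1, i5'] at hb
      refine Ensures.copyPt (by omega) ?_
      apply hR
      · exact hag₂'.setPt le_rfl
      · rw [pt_setPt_self, z₂, hzl, if_neg hb]
      · rw [pt_setPt_of_lt _ _ (by omega), z₂]
  refine .seq (first _ fun s₃ hag₃ h8 h12 => ?_)
  have hL₃ := hs.of_agree hag₃ (by omega) (by omega)
  have second : ∀ R : State → Prop, (∀ s₄, Agree 15 8 s s₄ → pt s₄ 8 = zl → pt s₄ 10 = zh → R s₄) →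
      Ensures L (.ite (.ltI (.var 2) (.var 6)) (HilbertPlane.copyPt 10 12) (HilbertPlane.loadV 6 10)) s₃ R := by
    intro R hR
    have i2 : s₃.idx 2 = b := hL₃.finish
    have i6' : s₃.idx 6 = i + 1 := by rw [hag₃.idx 6 (by omega), i6]
    refine .ite (fun hb => ?_) (fun hb => ?_)
    · simp only [BExp.Holds, IExp.eval, i2, i6'] at hb
      refine Ensures.copyPt (by omega) ?_
      apply hR
      · exact hag₃.setPt (by omega)
      · rw [pt_setPt_of_lt _ _ (by omega), h8]
      · rw [pt_setPt_self, h12, hzh, if_pos hb]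
    · simp only [BExp.Holds, IExp.eval, i2, i6'] at hb
      refine Ensures.loadV hV hL₃.toLayout (by omega) fun n => ?_
      apply hR
      · exact (hag₃.setI (by omega)).setPt (by omega)
      · rw [pt_setPt_of_lt _ _ (by omega), pt_setI, h8]
      · rw [pt_setPt_self, i6', hzh, if_neg hb]
  refine .seq (second _ fun s₄ hag₄ h8 h10 => ?_)
  have hleft : zl ∈ body V ∧ side V i zl = 0 ∧ 0 ≤ orient p q zl ∧ (f < i → 0 < orient p q zl) ∧
      0 ≤ balance m V p q i zl := by
    by_cases hfi' : f < i
    · rw [hzl, if_pos hfi']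
      have := hV.left_vertex h.cross hfi' hib
      exact ⟨hV.vertex_mem i, side_left V i, this.le, fun _ => this,
        (hlo.resolve_left (by omega)).le⟩
    · rw [hzl, if_neg hfi']
      have e : i = f := by omega
      obtain ⟨k1, k2, k3⟩ := h.crossing_point (i := i)
        (by rw [e]; exact mul_nonpos_of_nonpos_of_nonneg h.cross.start_nonpos h.cross.start_pos.le)
        (by rw [e]; exact (h.cross.start_nonpos.trans_lt h.cross.start_pos).ne) hz
      refine ⟨k1, k2, k3.ge, fun h' => absurd h' hfi',
        (hV.balance_pos_of_line h.hp h.hq h.hpq k3 k2 ?_).le⟩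
      have := side_sub_side V i p q
      rw [e] at this ⊢
      linarith [h.cross.start_nonpos, h.cross.start_pos]
  have hright : zh ∈ body V ∧ side V i zh = 0 ∧ 0 ≤ orient p q zh ∧ (i < b → 0 < orient p q zh) ∧
      balance m V p q i zh ≤ 0 := by
    by_cases hib' : b < i + 1
    · rw [hzh, if_pos hib']
      have e : i = b := by omega
      obtain ⟨k1, k2, k3⟩ := h.crossing_point (i := i)
        (by rw [e]; exact mul_nonpos_of_nonneg_of_nonpos h.cross.end_pos.le h.cross.end_nonpos)
        (by rw [e]; exact (h.cross.end_nonpos.trans_lt h.cross.end_pos).ne') hz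
      refine ⟨k1, k2, k3.ge, fun h' => absurd h' (by omega),
        (hV.balance_neg_of_line h.hp h.hq h.hpq k3 k2 ?_).le⟩
      have := side_sub_side V i p q
      rw [e] at this ⊢
      linarith [h.cross.end_nonpos, h.cross.end_pos]
    · rw [hzh, if_neg hib']
      have := hV.left_vertex h.cross (j := i + 1) (by omega) (by omega)
      exact ⟨hV.vertex_mem (i + 1), side_right V i, this.le, fun _ => this,
        (hhi.resolve_left (by omega)).le⟩
  obtain ⟨l1, l2, l3, l4, l5⟩ := hleft
  obtain ⟨r1, r2, r3, r4, r5⟩ := hright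
  have hroot : RootBracket m V p q i zl zh := by
    refine ⟨l1, r1, l2, r2, l3, r3, ?_, l5, r5⟩
    -- As `f < b`, at most one end of the segment is a crossing point with `pq`; the other is
    -- strictly on the left.
    rcases lt_or_ge f i with h' | h'
    · linarith [l4 h']
    · linarith [r4 (by omega)]
  have i7' : s₄.idx 7 = i := by rw [hag₄.idx 7 (by omega), i7]
  refine Ensures.rootProg h hL (hs.of_agree hag₄ (by omega) (by omega)) (by omega)
    (by rw [i7', h8, h10]; exact hroot) fun s₅ hag₅ => hQ s₅ ?_
  exact ((Agree.refl s).trans hag₄ (show 5 ≤ 15 by omega) le_rfl).trans hag₅ (by omega) le_rfl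

/-- At the vertex `V k` the search tests the side `k` that starts there. It ends with a side `i`
whose comparison is positive at its start, while that of side `i + 1` is nonpositive at `V (i + 1)`,
up to the conventions at `f` and `b`. The comparison of side `i` at `V (i + 1)` then decides between
the interior of the side and the vertex. -/
theorem Ensures.leftProg (h : CrossedPolygon m V p q f b) (hL : 2 * m + 2 ≤ 2 ^ L)
    (hs : CrossedLayout m V p q f b s)
    (hQ : ∀ s', Agree 5 8 s s' → pt s' 8 ∈ bisectorEnds (body V) p q →
      0 < orient p q (pt s' 8) → Q s') :
    Ensures L leftProg s Q := by
  have hV := h.poly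
  have hbm := h.cross.lt_add
  have hfm := h.lt_size
  have hfb := h.cross.lt
  refine .seq (.setI (.seq (.setI (.seq ?_))))
  refine Ensures.bisect (I := fun s' => Agree 5 8 s s' ∧ f ≤ s'.idx 5 ∧ s'.idx 5 < s'.idx 6 ∧
    s'.idx 6 ≤ b + 1 ∧ (s'.idx 5 = f ∨ 0 < balance m V p q (s'.idx 5) (V (s'.idx 5))) ∧
    (s'.idx 6 = b + 1 ∨ balance m V p q (s'.idx 6) (V (s'.idx 6)) ≤ 0))
    ?_ ?_ (fun s' hs' => hs'.2.2.1) ?_ ?_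
  · refine ⟨((Agree.refl s).setI le_rfl).setI (by omega), ?_⟩
    simp only [IExp.eval, State.setI_idx, hs.start, hs.finish]
    simp only [Nat.reduceEqDiff, if_false, if_true]
    exact ⟨le_rfl, by omega, le_rfl, .inl trivial, .inl trivial⟩
  · simp only [IExp.eval, State.setI_idx, hs.start, hs.finish]
    simp only [Nat.reduceEqDiff, if_false, if_true]
    omega
  · rintro s₁ ⟨hag, h1, h2, h3, h4, h5⟩ hlt
    set mid := (s₁.idx 5 + s₁.idx 6) / 2 with hmid
    have hag₂ : Agree 5 8 s (s₁.setI 7 mid) := hag.setI (by omega)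
    refine .seq (.setI (.seq (Ensures.loadV hV
      (hs.of_agree hag₂ (by omega) (by omega)).toLayout ?_ fun n => ?_)))
    · simp only [State.setI_idx, if_true]
      omega
    have e7 : (s₁.setI 7 mid).idx 7 = mid := by simp
    rw [e7]
    set s₂ := ((s₁.setI 7 mid).setI 16 n).setPt 12 (V mid) with hs₂
    have hag₃ : Agree 5 8 s s₂ := (hag₂.setI (by omega)).setPt (by omega)
    have h12 : pt s₂ 12 = V mid := pt_setPt_self _ _ _
    have i5 : s₂.idx 5 = s₁.idx 5 := by simp [hs₂]
    have i6 : s₂.idx 6 = s₁.idx 6 := by simp [hs₂]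
    have i7 : s₂.idx 7 = mid := by simp [hs₂]
    have hsm := hV.left_vertex h.cross (j := mid) (by omega) (by omega)
    refine .seq (Ensures.balanceProg h hL (hs.of_agree hag₃ (by omega) (by omega)) (h12 ▸ hsm)
      (by omega) fun s₃ hag₄ hval => ?_)
    rw [i7, h12] at hval
    have hag₅ : Agree 5 8 s s₃ := hag₃.trans hag₄ (by omega) (by omega)
    rw [← hag₄.idx 5 (by omega)] at i5
    rw [← hag₄.idx 6 (by omega)] at i6
    rw [← hag₄.idx 7 (by omega)] at i7
    refine .ite (fun hb => .setI ⟨⟨hag₅.setI le_rfl, ?_⟩, ?_⟩)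
      (fun hb => .setI ⟨⟨hag₅.setI (by omega), ?_⟩, ?_⟩)
    · simp only [BExp.Holds, RExp.eval, Int.cast_zero, hval] at hb
      simp only [IExp.eval, State.setI_idx, i7]
      simp only [Nat.reduceEqDiff, if_false, if_true, i6]
      exact ⟨by omega, by omega, h3, .inr hb, h5⟩
    · simp [IExp.eval, i6, i7]
    · simp only [BExp.Holds, RExp.eval, Int.cast_zero, hval, not_lt] at hb
      simp only [IExp.eval, State.setI_idx, i7]
      simp only [Nat.reduceEqDiff, if_false, if_true, i5]
      exact ⟨h1, by omega, by omega, h4, .inr hb⟩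
    · simp [IExp.eval, i5, i7]
  · rintro s₁ ⟨hag, h1, h2, h3, h4, h5⟩ heq
    set i := s₁.idx 5 with hi
    refine .seq (.setI ?_)
    change Ensures L _ (s₁.setI 7 i) Q
    set s₂ := s₁.setI 7 i with hs₂
    have hag₂ : Agree 5 8 s s₂ := hag.setI (by omega)
    have i5 : s₂.idx 5 = i := by simp [hs₂, hi]
    have i6 : s₂.idx 6 = i + 1 := by simp [hs₂, heq]
    have i7 : s₂.idx 7 = i := by simp [hs₂]
    have hL₂ := hs.of_agree hag₂ (by omega) (by omega)
    -- For `i = b` the end vertex is not on the left, and the value `-1` stands for the negative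
    -- comparison at the entry point.
    have test : ∀ R : State → Prop,
        (∀ s₃, Agree 12 8 s₂ s₃ → (i = b → s₃.reg 17 < 0) →
          (i < b → s₃.reg 17 = balance m V p q i (V (i + 1)) ∧ pt s₃ 12 = V (i + 1)) → R s₃) →
        Ensures L (.ite (.ltI (.var 2) (.var 6)) (.setR 17 (.lit (-1)))
          (.seq (HilbertPlane.loadV 6 12) HilbertPlane.balanceProg)) s₂ R := by
      intro R hR
      refine .ite (fun hb => .setR ?_) (fun hb => ?_)
      · simp only [BExp.Holds, IExp.eval, hL₂.finish, i6] at hb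
        exact hR _ ((Agree.refl s₂).setR (by omega)) (fun _ => by simp [RExp.eval])
          (fun h' => by omega)
      · simp only [BExp.Holds, IExp.eval, hL₂.finish, i6] at hb
        refine .seq (Ensures.loadV hV hL₂.toLayout (by omega) fun n => ?_)
        rw [i6]
        set s₃ := (s₂.setI 16 n).setPt 12 (V (i + 1)) with hs₃
        have hag₃ : Agree 12 8 s₂ s₃ := ((Agree.refl s₂).setI (by omega)).setPt (by omega)
        have h12 : pt s₃ 12 = V (i + 1) := pt_setPt_self _ _ _
        have i7' : s₃.idx 7 = i := by rw [hag₃.idx 7 (by omega), i7]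
        have hsm := hV.left_vertex h.cross (j := i + 1) (by omega) (by omega)
        refine Ensures.balanceProg h hL (hL₂.of_agree hag₃ (by omega) (by omega)) (h12 ▸ hsm)
          (by omega) fun s₄ hag₄ hval => ?_
        rw [i7', h12] at hval
        refine hR _ (hag₃.trans hag₄ le_rfl (by omega)) (fun h' => by omega) fun _ => ⟨hval, ?_⟩
        rw [hag₄.pt (by omega), h12]
    refine .seq (test _ fun s₃ hag₃ hneg hval => ?_)
    have hag₄ : Agree 5 8 s s₃ := hag₂.trans hag₃ (by omega) le_rfl
    refine .ite (fun hb => ?_) (fun hb => ?_)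
    · simp only [BExp.Holds, RExp.eval, Int.cast_zero] at hb
      refine Ensures.sideProg h hL (hs.of_agree hag₄ (by omega) (by omega)) h1 (by omega)
        (by rw [hag₃.idx 5 (by omega), i5]) (by rw [hag₃.idx 6 (by omega), i6])
        (by rw [hag₃.idx 7 (by omega), i7]) h4 ?_
        fun s₄ hag₅ => hQ s₄ (hag₄.trans hag₅ le_rfl le_rfl)
      rcases (show i ≤ b by omega).eq_or_lt with h' | h'
      · exact .inl h'
      · right
        rwa [(hval h').1] at hb
    · simp only [BExp.Holds, RExp.eval, Int.cast_zero] at hb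
      have h' : i < b := by
        rcases (show i ≤ b by omega).eq_or_lt with h' | h'
        · exact absurd (hneg h') hb
        · exact h'
      obtain ⟨k1, k2⟩ := hval h'
      rw [k1, not_lt] at hb
      refine Ensures.copyPt (by omega) ?_
      -- At `V (i + 1)` the comparison is nonnegative for side `i` by the test and nonpositive for
      -- side `i + 1` by the invariant, so the vertex is a limit point.
      have h5' := h5.resolve_left (by omega)
      rw [heq] at h5'
      apply hQ
      · exact hag₄.setPt le_rfl
      · rw [pt_setPt_self, k2]
        exact hV.mem_bisectorEnds h.hp h.hq (hV.vertex_mem _) (side_right V i) (side_left V (i + 1))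
          hb h5'
      · rw [pt_setPt_self, k2]
        exact hV.left_vertex h.cross (by omega) (by omega)

/-! ### Locating the sides crossed by the line -/

/-- Tests whether the point `x` lies to the left of `pq` (or not, according to `pos`). -/
def sideTest (pos : Bool) (x : ℕ) : BExp :=
  bif pos then .ltR (.lit 0) (orientE 0 2 x) else .not (.ltR (.lit 0) (orientE 0 2 x))

/-- The property tested by `sideTest`. -/
def OnSide (p q : Plane) (pos : Bool) (z : Plane) : Prop := 0 < orient p q z ↔ pos = true

theorem sideTest_holds (hs : Layout m V p q s) (pos : Bool) (x : ℕ) :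
    (sideTest pos x).Holds s ↔ OnSide p q pos (pt s x) := by
  cases pos <;> simp [sideTest, OnSide, BExp.Holds, RExp.eval, hs.pt_zero, hs.pt_two]

theorem onSide_not (p q : Plane) (pos : Bool) (z : Plane) :
    OnSide p q (!pos) z ↔ ¬ OnSide p q pos z := by
  cases pos <;> simp [OnSide]

/-- Binary search for a change of side between the index registers `5` and `6`. -/
def transitionProg (pos : Bool) : Prog :=
  bisect 5 6 <|
    .seq (.setI 7 (.half (.add (.var 5) (.var 6)))) <|
    .seq (loadV 7 20) <|
    .ite (sideTest pos 20) (.setI 5 (.var 7)) (.setI 6 (.var 7))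

/-- Only the different answers at the two ends are needed; no monotonicity in between is used. -/
theorem Ensures.transitionProg (hV : CyclicPolygon m V) (hL : 2 * m + 2 ≤ 2 ^ L)
    (hs : Layout m V p q s) {pos : Bool} (hlt : s.idx 5 < s.idx 6) (hm : s.idx 6 ≤ m)
    (hlo : OnSide p q pos (V (s.idx 5))) (hhi : ¬ OnSide p q pos (V (s.idx 6)))
    (hQ : ∀ s', Agree 5 18 s s' → s.idx 5 ≤ s'.idx 5 → s'.idx 5 < s.idx 6 →
      OnSide p q pos (V (s'.idx 5)) → ¬ OnSide p q pos (V (s'.idx 5 + 1)) → Q s') :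
    Ensures L (transitionProg pos) s Q := by
  refine Ensures.bisect (I := fun s' => Agree 5 18 s s' ∧ s.idx 5 ≤ s'.idx 5 ∧
    s'.idx 5 < s'.idx 6 ∧ s'.idx 6 ≤ s.idx 6 ∧ OnSide p q pos (V (s'.idx 5)) ∧
    ¬ OnSide p q pos (V (s'.idx 6))) ⟨Agree.refl s, le_rfl, hlt, le_rfl, hlo, hhi⟩ (by omega)
    (fun s' hs' => hs'.2.2.1) ?_ ?_
  · rintro s₁ ⟨hag, h1, h2, h3, h4, h5⟩ hlt
    set mid := (s₁.idx 5 + s₁.idx 6) / 2 with hmid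
    have hag₂ : Agree 5 18 s (s₁.setI 7 mid) := hag.setI (by omega)
    refine .seq (.setI (.seq (Ensures.loadV hV (hs.of_agree hag₂ (by omega) (by omega)) ?_
      fun n => ?_)))
    · simp only [State.setI_idx, if_true]
      omega
    have e7 : (s₁.setI 7 mid).idx 7 = mid := by simp
    rw [e7]
    have hag₃ : Agree 5 18 s (((s₁.setI 7 mid).setI 16 n).setPt 20 (V mid)) :=
      (hag₂.setI (by omega)).setPt (by omega)
    have hL₃ := hs.of_agree hag₃ (by omega) (by omega)
    refine .ite (fun hb => .setI ⟨⟨hag₃.setI le_rfl, ?_⟩, ?_⟩)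
      (fun hb => .setI ⟨⟨hag₃.setI (by omega), ?_⟩, ?_⟩)
    · rw [sideTest_holds hL₃, pt_setPt_self] at hb
      simp only [IExp.eval, State.setI_idx, setPt_idx]
      simp only [Nat.reduceEqDiff, if_false, if_true]
      exact ⟨by omega, by omega, h3, hb, h5⟩
    · simp [IExp.eval]
    · rw [sideTest_holds hL₃, pt_setPt_self] at hb
      simp only [IExp.eval, State.setI_idx, setPt_idx]
      simp only [Nat.reduceEqDiff, if_false, if_true]
      exact ⟨h1, by omega, by omega, h4, hb⟩
    · simp [IExp.eval]
  · rintro s₁ ⟨hag, h1, h2, h3, h4, h5⟩ heq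
    rw [heq] at h5
    exact hQ s₁ hag h1 (by omega) h4 h5

/-- Binary search for the angular position of `p`, seen from the vertex `0`; the vertex is stored
in the point `18`. -/
def fanProg : Prog :=
  .seq (.setI 5 (.lit 0)) <| .seq (loadV 5 18) <|
  .seq (.setI 5 (.lit 1)) <| .seq (.setI 6 (.sub (.var 0) (.lit 1))) <|
  bisect 5 6 <|
    .seq (.setI 7 (.half (.add (.var 5) (.var 6)))) <|
    .seq (loadV 7 20) <|
    .ite (.ltR (orientE 18 0 20) (.lit 0)) (.setI 5 (.var 7)) (.setI 6 (.var 7))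

theorem Ensures.fanProg (hV : CyclicPolygon m V) (hp : p ∈ openBody V) (hL : 2 * m + 2 ≤ 2 ^ L)
    (hs : Layout m V p q s)
    (hQ : ∀ s', Agree 5 18 s s' → pt s' 18 = V 0 → 1 ≤ s'.idx 5 → s'.idx 6 = s'.idx 5 + 1 →
      s'.idx 6 ≤ m - 1 → orient (V 0) p (V (s'.idx 5)) < 0 →
      0 ≤ orient (V 0) p (V (s'.idx 6)) → Q s') :
    Ensures L fanProg s Q := by
  have h3 := hV.three_le
  refine .seq (.setI (.seq (Ensures.loadV hV
    (hs.of_agree ((Agree.refl s).setI (show 5 ≤ 5 by omega)) (by omega) (by omega : 4 ≤ 18)) ?_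
    fun n => .seq (.setI (.seq (.setI ?_))))))
  · simp [IExp.eval]; omega
  have e0 : V (((s.setI 5 ((IExp.lit 0).eval s))).idx 5) = V 0 := by simp [IExp.eval]
  rw [e0]
  refine Ensures.bisect (I := fun s' => Agree 5 18 s s' ∧ pt s' 18 = V 0 ∧ 1 ≤ s'.idx 5 ∧
    s'.idx 5 < s'.idx 6 ∧ s'.idx 6 ≤ m - 1 ∧ orient (V 0) p (V (s'.idx 5)) < 0 ∧
    0 ≤ orient (V 0) p (V (s'.idx 6))) ?_ ?_ (fun s' hs' => hs'.2.2.2.1) ?_ ?_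
  · refine ⟨(((((Agree.refl s).setI le_rfl).setI (by omega)).setPt le_rfl).setI le_rfl).setI
      (by omega), by simp, ?_⟩
    simp only [IExp.eval, State.setI_idx, setPt_idx]
    simp only [Nat.reduceEqDiff, if_false, if_true, OfNat.zero_ne_ofNat, hs.size]
    refine ⟨le_rfl, by omega, le_rfl, ?_, ?_⟩
    · have := hp 0
      rw [side, orient_swap_right] at this
      simp only [zero_add] at this
      linarith
    · have h := hp (m - 1)
      rw [side, show m - 1 + 1 = 0 + m by omega, hV.periodic, ← orient_rotate] at h
      exact h.le
  · simp only [IExp.eval, State.setI_idx, setPt_idx]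
    simp only [Nat.reduceEqDiff, if_false, if_true, OfNat.zero_ne_ofNat, hs.size]
    omega
  · rintro s₁ ⟨hag, h18, h1, h2, h3, h4, h5⟩ hlt
    set mid := (s₁.idx 5 + s₁.idx 6) / 2 with hmid
    have hag₂ : Agree 5 18 s (s₁.setI 7 mid) := hag.setI (by omega)
    refine .seq (.setI (.seq (Ensures.loadV hV (hs.of_agree hag₂ (by omega) (by omega)) ?_
      fun n => ?_)))
    · simp only [State.setI_idx, if_true]
      omega
    have e7 : (s₁.setI 7 mid).idx 7 = mid := by simp
    rw [e7]
    set s₂ := ((s₁.setI 7 mid).setI 16 n).setPt 20 (V mid) with hs₂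
    have hag₃ : Agree 5 18 s s₂ := (hag₂.setI (by omega)).setPt (by omega)
    have hL₃ := hs.of_agree hag₃ (by omega) (by omega)
    have h18' : pt s₂ 18 = V 0 := by rw [hs₂, pt_setPt_of_lt _ _ (by omega)]; exact h18
    have h20 : pt s₂ 20 = V mid := pt_setPt_self _ _ _
    refine .ite (fun hb => .setI ⟨⟨hag₃.setI le_rfl, h18', ?_⟩, ?_⟩)
      (fun hb => .setI ⟨⟨hag₃.setI (by omega), h18', ?_⟩, ?_⟩)
    · simp only [BExp.Holds, orientE_eval, RExp.eval, Int.cast_zero, h18', h20, hL₃.pt_zero] at hb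
      simp only [IExp.eval, State.setI_idx, setPt_idx, hs₂]
      simp only [Nat.reduceEqDiff, if_false, if_true]
      exact ⟨by omega, by omega, h3, hb, h5⟩
    · simp [IExp.eval, hs₂]
    · simp only [BExp.Holds, orientE_eval, RExp.eval, Int.cast_zero, h18', h20, hL₃.pt_zero,
        not_lt] at hb
      simp only [IExp.eval, State.setI_idx, setPt_idx, hs₂]
      simp only [Nat.reduceEqDiff, if_false, if_true]
      exact ⟨h1, by omega, by omega, h4, hb⟩
    · simp [IExp.eval, hs₂]
  · rintro s₁ ⟨hag, h18, h1, h2, h3, h4, h5⟩ heq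
    exact hQ s₁ hag h18 h1 heq h3 h4 h5

/-- Stores in the index register `4` a vertex on the other side of `pq` than the vertex `0`, whose
side is `pos`. -/
def anchorProg (pos : Bool) : Prog :=
  .seq (loadV 5 20) <|
  .ite (sideTest (!pos) 20) (.setI 4 (.var 5)) <|
  .seq (loadV 6 20) <|
  .ite (sideTest (!pos) 20) (.setI 4 (.var 6)) (.setI 4 (.sub (.var 0) (.lit 1)))

/-- By `exists_anchor`, if the two vertices around `p` in the fan fail, the last vertex `m - 1`
succeeds and need not be tested. -/
theorem Ensures.anchorProg (hV : CyclicPolygon m V) (hp : p ∈ openBody V) (hpq : p ≠ q)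
    (hs : Layout m V p q s) {pos : Bool} (hpos : OnSide p q pos (V 0)) (h1 : 1 ≤ s.idx 5)
    (h2 : s.idx 6 = s.idx 5 + 1) (h3 : s.idx 6 ≤ m - 1) (h4 : orient (V 0) p (V (s.idx 5)) < 0)
    (h5 : 0 ≤ orient (V 0) p (V (s.idx 6)))
    (hQ : ∀ s', Agree 4 18 s s' → 1 ≤ s'.idx 4 → s'.idx 4 < m →
      OnSide p q (!pos) (V (s'.idx 4)) → Q s') :
    Ensures L (anchorProg pos) s Q := by
  have hm3 := hV.three_le
  refine .seq (Ensures.loadV hV hs (by omega) fun n => ?_)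
  set s₁ := (s.setI 16 n).setPt 20 (V (s.idx 5)) with hs₁
  have hag₁ : Agree 4 18 s s₁ := ((Agree.refl s).setI (by omega)).setPt (by omega)
  have hL₁ := hs.of_agree hag₁ (by omega) (by omega)
  have i5 : s₁.idx 5 = s.idx 5 := by simp [hs₁]
  have i6 : s₁.idx 6 = s.idx 6 := by simp [hs₁]
  refine .ite (fun hb => .setI (hQ _ (hag₁.setI le_rfl) ?_ ?_ ?_)) (fun hb => ?_)
  · simp only [State.setI_idx, if_true, IExp.eval]; omega
  · simp only [State.setI_idx, if_true, IExp.eval]; omega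
  · rw [sideTest_holds hL₁, pt_setPt_self] at hb
    simp only [State.setI_idx, if_true, IExp.eval, i5]
    exact hb
  rw [sideTest_holds hL₁, pt_setPt_self] at hb
  refine .seq (Ensures.loadV hV hL₁ (by omega) fun n' => ?_)
  set s₂ := (s₁.setI 16 n').setPt 20 (V (s₁.idx 6)) with hs₂
  have hag₂ : Agree 4 18 s s₂ := (hag₁.setI (by omega)).setPt (by omega)
  have hL₂ := hs.of_agree hag₂ (by omega) (by omega)
  have i6' : s₂.idx 6 = s.idx 6 := by simp [hs₂, i6]
  refine .ite (fun hb' => .setI (hQ _ (hag₂.setI le_rfl) ?_ ?_ ?_))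
    (fun hb' => .setI (hQ _ (hag₂.setI le_rfl) ?_ ?_ ?_))
  · simp only [State.setI_idx, if_true, IExp.eval]; omega
  · simp only [State.setI_idx, if_true, IExp.eval]; omega
  · rw [sideTest_holds hL₂, pt_setPt_self, i6] at hb'
    simp only [State.setI_idx, if_true, IExp.eval, i6']
    exact hb'
  · simp only [State.setI_idx, if_true, IExp.eval, hL₂.size]; omega
  · simp only [State.setI_idx, if_true, IExp.eval, hL₂.size]; omega
  · rw [sideTest_holds hL₂, pt_setPt_self, i6] at hb'
    simp only [State.setI_idx, if_true, IExp.eval, hL₂.size]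
    rw [h2] at h5 hb'
    have key := hV.exists_anchor hp hpq h4 h5
    simp only [OnSide] at hb hb' hpos ⊢
    cases pos <;> grind

/-- Stores the sides crossed by `pq` in the index registers `1` and `2`, when the side of the vertex
`0` is `pos`. -/
def crossProg (pos : Bool) : Prog :=
  .seq (anchorProg pos) <|
  .seq (.setI 5 (.lit 0)) <| .seq (.setI 6 (.var 4)) <| .seq (transitionProg pos) <|
  .seq (.setI 3 (.var 5)) <|
  .seq (.setI 5 (.var 4)) <| .seq (.setI 6 (.var 0)) <| .seq (transitionProg (!pos)) <|
  bif pos then .seq (.setI 1 (.var 5)) (.setI 2 (.add (.var 3) (.var 0)))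
  else .seq (.setI 1 (.var 3)) (.setI 2 (.var 5))

/-- The anchor splits the cycle of vertices into two arcs, from `0` to the anchor and from the
anchor to `m`, whose ends lie on different sides of `pq`; each contains one crossed side. -/
theorem Ensures.crossProg (hV : CyclicPolygon m V) (hp : p ∈ openBody V) (hq : q ∈ openBody V)
    (hpq : p ≠ q) (hL : 2 * m + 2 ≤ 2 ^ L)
    (hs : Layout m V p q s) {pos : Bool} (hpos : OnSide p q pos (V 0)) (h1 : 1 ≤ s.idx 5)
    (h2 : s.idx 6 = s.idx 5 + 1) (h3 : s.idx 6 ≤ m - 1) (h4 : orient (V 0) p (V (s.idx 5)) < 0)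
    (h5 : 0 ≤ orient (V 0) p (V (s.idx 6)))
    (hQ : ∀ s' f b, Agree 1 18 s s' → CrossedPolygon m V p q f b →
      CrossedLayout m V p q f b s' → Q s') :
    Ensures L (crossProg pos) s Q := by
  have hm3 := hV.three_le
  refine .seq (Ensures.anchorProg hV hp hpq hs hpos h1 h2 h3 h4 h5
    fun s₁ hag₁ k1 k2 k3 => .seq (.setI (.seq (.setI ?_))))
  set s₂ := (s₁.setI 5 ((IExp.lit 0).eval s₁)).setI 6
    ((IExp.var 4).eval (s₁.setI 5 ((IExp.lit 0).eval s₁))) with hs₂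
  have hag₂ : Agree 3 18 s s₂ :=
    (((Agree.refl s).trans hag₁ (by omega) le_rfl).setI (by omega)).setI (by omega)
  have hL₂ := hs.of_agree hag₂ (by omega) (by omega)
  have i5 : s₂.idx 5 = 0 := by simp [hs₂, IExp.eval]
  have i6 : s₂.idx 6 = s₁.idx 4 := by simp [hs₂, IExp.eval]
  have i4 : s₂.idx 4 = s₁.idx 4 := by simp [hs₂, IExp.eval]
  set w := s₁.idx 4 with hw
  refine .seq (Ensures.transitionProg hV hL hL₂ (by omega) (by omega) (by rw [i5]; exact hpos)
    (by rw [i6, ← onSide_not]; exact k3) fun s₃ hag₃ a1 a2 a3 a4 =>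
      .seq (.setI (.seq (.setI (.seq (.setI ?_))))))
  rw [i6] at a2
  set t := s₃.idx 5 with ht
  have i4' : s₃.idx 4 = w := by rw [hag₃.idx 4 (by omega), i4]
  have hag₃' : Agree 3 18 s s₃ := hag₂.trans hag₃ (by omega) le_rfl
  have hL₃ := hs.of_agree hag₃' (by omega) (by omega)
  set s₄ := ((s₃.setI 3 ((IExp.var 5).eval s₃)).setI 5 ((IExp.var 4).eval _)).setI 6
    ((IExp.var 0).eval ((s₃.setI 3 ((IExp.var 5).eval s₃)).setI 5 ((IExp.var 4).eval _))) with hs₄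
  have hag₄ : Agree 3 18 s s₄ := ((hag₃'.setI le_rfl).setI (by omega)).setI (by omega)
  have hL₄ := hs.of_agree hag₄ (by omega) (by omega)
  have j3 : s₄.idx 3 = t := by simp [hs₄, IExp.eval, ht]
  have j5 : s₄.idx 5 = w := by simp [hs₄, IExp.eval, i4']
  have j6 : s₄.idx 6 = m := by simp [hs₄, IExp.eval, hL₃.size]
  have hVm : V m = V 0 := by simpa using hV.periodic 0
  refine .seq (Ensures.transitionProg hV hL hL₄ (by omega) (by omega) (by rw [j5]; exact k3)
    (by rw [j6, hVm, onSide_not, not_not]; exact hpos) fun s₅ hag₅ b1 b2 b3 b4 => ?_)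
  rw [j6] at b2
  rw [j5] at b1
  rw [onSide_not] at b3 b4
  rw [not_not] at b4
  set u := s₅.idx 5 with hu
  have j3' : s₅.idx 3 = t := by rw [hag₅.idx 3 (by omega), j3]
  have hag₆ : Agree 1 18 s s₅ :=
    ((Agree.refl s).trans hag₄ (by omega) le_rfl).trans hag₅ (by omega) le_rfl
  have hL₅ := hs.of_agree hag₆ (by omega) (by omega)
  cases pos with
  | true =>
    simp only [OnSide, iff_true, not_lt] at a3 a4 b3 b4
    refine .seq (.setI (.setI ?_))
    have hag₇ := (hag₆.setI (n := (IExp.var 5).eval s₅) (show 1 ≤ 1 by omega)).setI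
      (n := (IExp.add (.var 3) (.var 0)).eval (s₅.setI 1 ((IExp.var 5).eval s₅)))
      (show 1 ≤ 2 by omega)
    -- With `V 0` on the left, the left arc passes through index `m`, so the entry side is
    -- represented one period later.
    refine hQ _ u (t + m) hag₇
      ⟨hV, hp, hq, hpq, ⟨by omega, by omega, b3, b4, ?_, ?_⟩, b2⟩
      ⟨hs.of_agree hag₇ le_rfl (by omega), ?_, ?_⟩
    · rw [hV.periodic]; exact a3
    · rw [show t + m + 1 = t + 1 + m by ring, hV.periodic]; exact a4
    · simp [IExp.eval, hu]
    · simp [IExp.eval, j3', hL₅.size]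
  | false =>
    simp only [OnSide, Bool.false_eq_true, iff_false, not_lt, not_le] at a3 a4 b3 b4
    refine .seq (.setI (.setI ?_))
    have hag₇ := (hag₆.setI (n := (IExp.var 3).eval s₅) (show 1 ≤ 1 by omega)).setI
      (n := (IExp.var 5).eval (s₅.setI 1 ((IExp.var 3).eval s₅))) (show 1 ≤ 2 by omega)
    refine hQ _ t u hag₇
      ⟨hV, hp, hq, hpq, ⟨by omega, by omega, a3, a4, b3, b4⟩, by omega⟩
      ⟨hs.of_agree hag₇ le_rfl (by omega), ?_, ?_⟩
    · simp [IExp.eval, j3']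
    · simp [IExp.eval, hu]

/-- Computes the limit point to the left of `pq` and stores it in the point `8`. -/
def limitProg : Prog :=
  .seq fanProg <|
  .seq (.ite (.ltR (.lit 0) (orientE 0 2 18)) (crossProg true) (crossProg false)) leftProg

theorem Ensures.limitProg (hV : CyclicPolygon m V) (hp : p ∈ openBody V) (hq : q ∈ openBody V)
    (hpq : p ≠ q) (hL : 2 * m + 2 ≤ 2 ^ L) (hs : Layout m V p q s)
    (hQ : ∀ s', Agree 1 8 s s' → (∃ f b, Crossing m V p q f b) →
      pt s' 8 ∈ bisectorEnds (body V) p q → 0 < orient p q (pt s' 8) → Q s') :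
    Ensures L limitProg s Q := by
  refine .seq (Ensures.fanProg hV hp hL hs fun s₁ hag₁ h18 k1 k2 k3 k4 k5 => ?_)
  have hL₁ := hs.of_agree hag₁ (by omega) (by omega)
  have fin : ∀ s' f b, Agree 1 18 s₁ s' → CrossedPolygon m V p q f b →
      CrossedLayout m V p q f b s' → Ensures L HilbertPlane.leftProg s' Q := by
    intro s' f b hag h hL'
    refine Ensures.leftProg h hL hL' fun s'' hag' => hQ s'' ?_ ⟨f, b, h.cross⟩
    exact (((Agree.refl s).trans hag₁ (show 1 ≤ 5 by omega) (show 8 ≤ 18 by omega)).trans hag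
      le_rfl (by omega)).trans hag' (by omega) le_rfl
  refine .seq (.ite (fun hb => ?_) (fun hb => ?_))
  · simp only [BExp.Holds, orientE_eval, RExp.eval, Int.cast_zero, h18, hL₁.pt_zero,
      hL₁.pt_two] at hb
    exact Ensures.crossProg hV hp hq hpq hL hL₁ (by simpa [OnSide] using hb) k1 k2 k3 k4 k5 fin
  · simp only [BExp.Holds, orientE_eval, RExp.eval, Int.cast_zero, h18, hL₁.pt_zero,
      hL₁.pt_two] at hb
    exact Ensures.crossProg hV hp hq hpq hL hL₁ (by simpa [OnSide] using hb) k1 k2 k3 k4 k5 fin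

/-- Computes the limit points on both sides of `pq`. -/
def mainProg : Prog :=
  .seq limitProg <| .seq (copyPt 4 8) <|
  .seq (copyPt 8 0) <| .seq (copyPt 0 2) <| .seq (copyPt 2 8) <|
  .seq limitProg <| .seq (copyPt 0 4) (copyPt 2 8)

/-- The left of the line from `q` to `p` is the right of the line from `p` to `q`. The first result
survives the second run because `limitProg` preserves the real registers below `8`. -/
theorem Ensures.mainProg (hV : CyclicPolygon m V) (hp : p ∈ openBody V) (hq : q ∈ openBody V)
    (hpq : p ≠ q) (hL : 2 * m + 2 ≤ 2 ^ L) (hs : Layout m V p q s) :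
    Ensures L mainProg s fun s' => (∃ f b, Crossing m V p q f b) ∧ (∃ f b, Crossing m V q p f b) ∧
      pt s' 0 ∈ bisectorEnds (body V) p q ∧ 0 < orient p q (pt s' 0) ∧
      pt s' 2 ∈ bisectorEnds (body V) p q ∧ orient p q (pt s' 2) < 0 := by
  refine .seq (Ensures.limitProg hV hp hq hpq hL hs fun s₁ hag₁ hc hx hsx => ?_)
  refine .seq (Ensures.copyPt (by omega) (.seq (Ensures.copyPt (by omega)
    (.seq (Ensures.copyPt (by omega) (.seq (Ensures.copyPt (by omega) ?_)))))))
  have hL₁ := hs.of_agree hag₁ le_rfl (by omega)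
  set x := pt s₁ 8 with hxdef
  set s₂ := s₁.setPt 4 x with hs₂
  have p0 : pt s₂ 0 = p := by rw [hs₂, pt_setPt_of_lt _ _ (by omega), hL₁.pt_zero]
  have p2 : pt s₂ 2 = q := by rw [hs₂, pt_setPt_of_lt _ _ (by omega), hL₁.pt_two]
  have p4 : pt s₂ 4 = x := pt_setPt_self _ _ _
  rw [p0]
  set s₃ := s₂.setPt 8 p with hs₃
  have q2 : pt s₃ 2 = q := by rw [hs₃, pt_setPt_of_lt _ _ (by omega), p2]
  have q4 : pt s₃ 4 = x := by rw [hs₃, pt_setPt_of_lt _ _ (by omega), p4]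
  have q8 : pt s₃ 8 = p := pt_setPt_self _ _ _
  rw [q2]
  set s₄ := s₃.setPt 0 q with hs₄
  have r0 : pt s₄ 0 = q := pt_setPt_self _ _ _
  have r4 : pt s₄ 4 = x := by rw [hs₄, pt_setPt_of_lt _ _ (by omega), q4]
  have r8 : pt s₄ 8 = p := by rw [hs₄, pt_setPt_of_lt _ _ (by omega), q8]
  rw [r8]
  set s₅ := s₄.setPt 2 p with hs₅
  have t4 : pt s₅ 4 = x := by rw [hs₅, pt_setPt_of_lt _ _ (by omega), r4]
  have hL₅ : Layout m V q p s₅ := by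
    refine ⟨hL₁.size, hL₁.vertex, ?_, pt_setPt_self _ _ _⟩
    rw [hs₅, pt_setPt_of_lt _ _ (by omega), r0]
  refine .seq (Ensures.limitProg hV hq hp hpq.symm hL hL₅ fun s₆ hag₆ hc' hy hsy =>
    .seq (Ensures.copyPt (by omega) (Ensures.copyPt (by omega) ?_)))
  have u4 : pt s₆ 4 = x := by rw [hag₆.pt (by omega), t4]
  rw [u4, pt_setPt_of_lt _ _ (show 8 + 1 < 0 ∨ 0 + 1 < 8 by omega), pt_setPt_self,
    pt_setPt_of_lt _ _ (show 0 + 1 < 2 ∨ 2 + 1 < 0 by omega), pt_setPt_self]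
  rw [CyclicPolygon.bisectorEnds_swap] at hy
  rw [orient_swap] at hsy
  exact ⟨hc, hc', hx, hsx, hy, by linarith⟩

theorem mainProg_depth : mainProg.depth = 2 := rfl

end HilbertPlane

/-! ### Correctness and running time of the whole program. -/

theorem mainTheorem11 :
    ∃ (prog : RealRAM.Prog) (C : ℝ),
      ∀ (m : ℕ) (v : Fin m → HilbertPlane.Plane) (p q : HilbertPlane.Plane),
        HilbertPlane.IsConvexPolygon v →
        p ∈ interior (HilbertPlane.region v) →
        q ∈ interior (HilbertPlane.region v) →
        p ≠ q →
        ∀ s : RealRAM.State, HilbertPlane.HoldsInput s v p q →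
          ∃ (t : ℕ) (s' : RealRAM.State) (x y : HilbertPlane.Plane),
            RealRAM.Exec prog s t s' ∧
            (t : ℝ) ≤ C * Real.log m ^ 2 ∧
            HilbertPlane.HoldsOutput s' x y ∧
            x ∈ HilbertPlane.bisectorEnds (HilbertPlane.region v) p q ∧
            0 < HilbertPlane.orient p q x ∧
            y ∈ HilbertPlane.bisectorEnds (HilbertPlane.region v) p q ∧
            HilbertPlane.orient p q y < 0 ∧
            ((∀ i j : Fin m, i ≠ j →
                ¬ HilbertPlane.Concurrent line[ℝ, p, q]
                  (HilbertPlane.sideLine v i) (HilbertPlane.sideLine v j)) →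
              HilbertPlane.bisectorEnds (HilbertPlane.region v) p q = {x, y}) := by
  obtain ⟨K, hK⟩ := HilbertPlane.mainProg.exists_bound_le
  rw [HilbertPlane.mainProg_depth] at hK
  -- With `L = Nat.log 2 m + 2`, the bound is `K * (Nat.log 2 m + 3) ^ 2`. Since `log 2 > 1 / 2` and
  -- `log m ≥ 1` for `m ≥ 3`, the base is at most `5 * log m`.
  refine ⟨HilbertPlane.mainProg, 25 * K, fun m v p q hv hp hq hpq s hs => ?_⟩
  have hm3 : 3 ≤ m := hv.1
  have hm : 0 < m := by omega
  have hV := hv.cyclicPolygon hm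
  rw [hv.region_eq hm] at hp hq ⊢
  rw [hV.interior_body] at hp hq
  have hlay : HilbertPlane.Layout m (HilbertPlane.cyclicExtension hm v) p q s := by
    obtain ⟨h0, h1, h2, h3, h4, h5⟩ := hs
    refine ⟨h0, fun k hk => ?_, HilbertPlane.plane_ext h1 h2, HilbertPlane.plane_ext h3 h4⟩
    simpa [HilbertPlane.cyclicExtension, Nat.mod_eq_of_lt hk] using h5 ⟨k, hk⟩
  have hL : 2 * m + 2 ≤ 2 ^ (Nat.log 2 m + 2) := by
    have := Nat.lt_pow_succ_log_self (b := 2) (by omega) m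
    rw [pow_succ] at this ⊢
    rw [pow_succ]
    omega
  obtain ⟨t, s', hexec, ht, hc, hc', hx, hsx, hy, hsy⟩ :=
    HilbertPlane.Ensures.mainProg hV hp hq hpq hL hlay
  refine ⟨t, s', HilbertPlane.pt s' 0, HilbertPlane.pt s' 2, hexec, ?_, ⟨rfl, rfl, rfl, rfl⟩, hx, hsx,
    hy, hsy, fun hgen => ?_⟩
  · have hlog : 1 ≤ Real.log m := by
      rw [Real.le_log_iff_exp_le (by positivity)]
      have : (3 : ℝ) ≤ m := by exact_mod_cast hm3
      linarith [Real.exp_one_lt_d9]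
    have hnat : (Nat.log 2 m : ℝ) ≤ 2 * Real.log m := by
      have h1 := Real.natLog_le_logb m 2
      rw [Real.logb, Nat.cast_ofNat] at h1
      refine h1.trans ?_
      rw [div_le_iff₀ (Real.log_pos (by norm_num))]
      nlinarith [Real.log_two_gt_d9]
    have h2 : (t : ℝ) ≤ K * (Nat.log 2 m + 3) ^ 2 := by
      have := ht.trans (hK (Nat.log 2 m + 2))
      exact_mod_cast this
    calc (t : ℝ) ≤ K * (Nat.log 2 m + 3) ^ 2 := h2
      _ ≤ K * (5 * Real.log m) ^ 2 := by
        gcongr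
        linarith
      _ = 25 * K * Real.log m ^ 2 := by ring
  · obtain ⟨f, b, hc⟩ := hc
    exact hV.bisectorEnds_eq_pair hc hc' hp hq hpq
      (HilbertPlane.side_ratio_injective hv hm hpq hp hq hgen) hx hy hsx hsy
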